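/- Let $K$ be a field of characteristic zero. **Setting.** Words in $x,z$ are bigraded by depth (degree in $z$) and weight (total degree). Let $\langle-,-\rangle$ be the pairing on $K\langle x,z\rangle$ for which the words are orthonormal, $\langle-,-\rangle^{\otimes 2}$ the induced pairing on the tensor square, and $\sqcup\!\sqcup$ the shuffle product. Put $Y=\{y_n\mid n\ge 1\}$, let $\Delta,\Delta_Y$ be the coproducts (algebra morphisms) on $K\langle x,z\rangle$, $K\langle Y\rangle$ for which the letters are primitive, and let $\pi:K\langle x,z\rangle\to K\langle Y\rangle$ be the linear map with $\pi(x^{n_1-1}z\cdots x^{n_m-1}z)=y_{n_1}\cdots y_{n_m}$, $\pi(1)=1$ and $\pi(K\langle x,z\rangle x)=0$. * $\mathfrak{ls}\subset K\langle x,z\rangle$ is the bigraded space of all $\psi$ such that $\psi$ is primitive for $\Delta$, $\pi(\psi)$ is primitive for $\Delta_Y$, and $\psi$ has no component of depth $0$ and no component of depth $1$ and even weight. $\mathfrak{ls}^\vee$ is its bigraded dual. * The Ihara bracket is $\{w,w'\}=d_w(w')-d_{w'}(w)+ww'-w'w$, where $d_w$ is the derivation with $d_w(x)=0$, $d_w(z)=zw-wz$.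 The Ihara cobracket $\{-,-\}^*$ is its adjoint for $\langle-,-\rangle$ and $\langle-,-\rangle^{\otimes2}$. * $W$ has basis $I(n_1,\dots,n_m)$ ($m\ge1$, $n_i\ge 1$), of depth $m$ and weight $n_1+\dots+n_m$. $U$ has basis $I'(0)$, of depth and weight $0$, and $I'(n_0,\dots,n_m)$ ($m\ge0$, $n_i\ge1$), of depth $m$ and weight $n_0+\dots+n_m$. $V=W\oplus U$. * Put $\{t_1:\dots:t_{m+1}\}=\sum_{n_i\ge1} I(n_1,\dots,n_m)\prod_{i=1}^m(t_i-t_{m+1})^{n_i-1}$ and $\{t_1,\dots,t_m\}=\{t_1:t_1+t_2:\dots:t_1+\dots+t_m:0\}$. $W_R\subset W$ is spanned by the elements $I(2n)$, $n\ge1$, and by the coefficients of $\sum_{\sigma}\{t_{\sigma^{-1}(1)}:\dots:t_{\sigma^{-1}(p+q)}:t_{p+q+1}\}$ and of $\sum_{\sigma}\{t_{\sigma^{-1}(1)},\dots,t_{\sigma^{-1}(p+q)}\}$ for all $p,q\ge1$, the sums being over the $(p,q)$-shuffles $\sigma$. $F=W_R\oplus U\subset V$. * $\tilde\delta:W\to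 W\otimes W$ is the linear map with, for $m\ge1$, $\tilde\delta\{t_1:\dots:t_{m+1}\}=\sum_{k=2}^m\sum_{j=0}^m\{t_{1+j}:\dots:t_{k-1+j}:t_{m+1+j}\}\wedge\{t_{k+j}:\dots:t_{m+1+j}\}$, indices modulo $m+1$, $a\wedge b=a\otimes b-b\otimes a$. * $\phi:V\to K\langle x,z\rangle$ is the linear isomorphism with $\phi(I(n_1,\dots,n_m))=x^{n_m-1}z\cdots x^{n_1-1}z$, $\phi(I'(n_0,\dots,n_m))=(x^{n_m-1}z\cdots x^{n_1-1}zx^{n_0-1})\sqcup\!\sqcup x$, $\phi(I'(0))=1$; and $\phi^\star\{-,-\}^*=(\phi^{-1}\otimes\phi^{-1})\circ\{-,-\}^*\circ\phi$. * $D_{\bullet\bullet}$ is the bigraded space underlying Goncharov's dihedral Lie coalgebra $\widehat{\mathscr D}_{\bullet\bullet}(\{e\})$. Its generators are symbols $I_{n_1,\dots,n_m}(e,\dots,e)$ ($m\ge 1$, $n_i\ge1$). With series $\{t_1:\dots:t_{m+1}\}$ and $\{t_1,\dots,t_m\}$ formed from these symbols as above, its relations are the double shuffle relations (the two shuffle sums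 above vanish for all $p,q\ge1$) and the distribution relations $\{t_1:\dots:t_{m+1}\}=\{-t_1:\dots:-t_{m+1}\}$, $m\ge1$. Goncharov's formula is $\delta\{t_1:\dots:t_{m+1}\}=-\sum_{k=2}^m\sum_{j=0}^m\{t_{1+j}:\dots:t_{k-1+j}:t_{m+1+j}\}\wedge\{t_{k+j}:\dots:t_{m+1+j}\}$, $m\ge1$. A subspace $C$ of $A$ is a coideal for $g:A\to A\otimes A$ if $g(C)\subset C\otimes A+A\otimes C$. A Lie cobracket is an antisymmetric map $A\to A\otimes A$ satisfying the co-Jacobi identity. **Theorem.** 1) The following conditions are equivalent: (C1) $\mathfrak{ls}$ is preserved by the Ihara bracket; (C2) $F$ is a coideal for $\phi^\star\{-,-\}^*:V\to V\otimes V$; (C3) $W_R$ is a coideal for $\tilde\delta:W\to W\otimes W$; (C4) $D_{\bullet\bullet}$ is a Lie coalgebra under Goncharov's formula, i.e. there is a linear map $\delta:D_{\bullet\bullet}\to D_{\bullet\bullet}\otimes D_{\bullet\bullet}$ satisfying the formula, and it makes $D_{\bullet\bullet}$ a bigraded Lie coalgebra. 2) If one of these conditions holds, then $\phi^\star\{-,-\}^*$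 induces a bigraded Lie cobracket $\delta_{V/F}$ on $V/F$; the map dual to the restriction of $\{-,-\}$ to $\mathfrak{ls}$ makes $\mathfrak{ls}^\vee$ a bigraded Lie coalgebra; and $\varepsilon:V/F\to\mathfrak{ls}^\vee$, $\bar v\mapsto\langle\phi(v),-\rangle$, is a well-defined isomorphism of bigraded Lie coalgebras. -/

import Mathlib

open scoped TensorProduct

noncomputable section

namespace DihedralLS

/-! ### The free associative algebra -/

/-- The two letters `x`, `z`. -/
inductive XZ where
  | x : XZ
  | z : XZ
deriving DecidableEq

instance : Fintype XZ where
  elems := {XZ.x, XZ.z}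
  complete := by intro a; cases a <;> decide

section FreeAlg

variable (K : Type*) [Field K] {X : Type*}

/-- The unitary monomial of `K⟨X⟩` attached to a word. -/
def word (w : List X) : FreeAlgebra K X := (w.map (FreeAlgebra.ι K)).prod

variable (X) in
/-- The basis of unitary monomials of the free associative algebra `K⟨X⟩`, indexed by words. -/
def wordBasis : Module.Basis (List X) K (FreeAlgebra K X) :=
  (FreeAlgebra.basisFreeMonoid K X).reindex FreeMonoid.toList

lemma wordBasis_apply (w : List X) : wordBasis K X w = word K w := by
  have h : ∀ v : FreeMonoid X, FreeAlgebra.basisFreeMonoid K X v = word K v.toList := by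
    intro v
    simp only [FreeAlgebra.basisFreeMonoid, Module.Basis.map_apply, Finsupp.coe_basisSingleOne]
    change MonoidAlgebra.lift K (FreeAlgebra K X) (FreeMonoid X)
      (FreeMonoid.lift (FreeAlgebra.ι K)) (MonoidAlgebra.single v 1) = _
    rw [MonoidAlgebra.lift_single, one_smul, FreeMonoid.lift_apply]
    rfl
  simp [wordBasis, h]

lemma word_nil : word K ([] : List X) = 1 := rfl

lemma word_cons (a : X) (w : List X) : word K (a :: w) = FreeAlgebra.ι K a * word K w := by
  simp [word]

lemma word_append (u v : List X) : word K (u ++ v) = word K u * word K v := by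
  simp [word]

variable (X) in
/-- The canonical pairing of `K⟨X⟩`: the unitary monomials are orthonormal. -/
def pairing [DecidableEq X] : FreeAlgebra K X →ₗ[K] Module.Dual K (FreeAlgebra K X) :=
  (wordBasis K X).toDual

variable (X) in
/-- The shuffle coproduct: the algebra morphism with `a ↦ 1 ⊗ a + a ⊗ 1` for every letter `a`. -/
def coproduct : FreeAlgebra K X →ₐ[K] FreeAlgebra K X ⊗[K] FreeAlgebra K X :=
  FreeAlgebra.lift K fun a => 1 ⊗ₜ[K] FreeAlgebra.ι K a + FreeAlgebra.ι K a ⊗ₜ[K] 1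

/-- The shuffle product of two words. -/
def shuffleWord : List X → List X → FreeAlgebra K X
  | [], v => word K v
  | a :: u, [] => word K (a :: u)
  | a :: u, b :: v =>
      FreeAlgebra.ι K a * shuffleWord u (b :: v) + FreeAlgebra.ι K b * shuffleWord (a :: u) v
  termination_by u v => u.length + v.length

variable (X) in
/-- The shuffle product of `K⟨X⟩`, as a bilinear map. -/
def shuffle : FreeAlgebra K X →ₗ[K] FreeAlgebra K X →ₗ[K] FreeAlgebra K X :=
  (wordBasis K X).constr K fun u => (wordBasis K X).constr K fun v => shuffleWord K u v

lemma shuffle_word (u v : List X) :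
    shuffle K X (word K u) (word K v) = shuffleWord K u v := by
  rw [← wordBasis_apply, ← wordBasis_apply, shuffle, Module.Basis.constr_basis,
    Module.Basis.constr_basis]

end FreeAlg

/-! ### Depth and weight, the map `π` -/

section LS

/-- The word `x^{n₁-1} z ⋯ x^{n_m-1} z`. -/
def blockWord (l : List ℕ+) : List XZ :=
  l.flatMap fun n => List.replicate n.natPred XZ.x ++ [XZ.z]

/-- `parse 0 w` is the pair `((n₁, …, n_m), k)` with `w = x^{n₁-1} z ⋯ x^{n_m-1} z x^k`;
the first argument counts the letters `x` read since the last `z`. -/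
def parse : ℕ → List XZ → List ℕ+ × ℕ
  | n, [] => ([], n)
  | n, XZ.x :: w => parse (n + 1) w
  | n, XZ.z :: w => (n.succPNat :: (parse 0 w).1, (parse 0 w).2)

lemma parse_spec (n : ℕ) (w : List XZ) :
    blockWord (parse n w).1 ++ List.replicate (parse n w).2 XZ.x
      = List.replicate n XZ.x ++ w := by
  induction w generalizing n with
  | nil => simp [parse, blockWord]
  | cons a w ih =>
    cases a with
    | x =>
      rw [parse, ih, List.replicate_succ']
      simp
    | z =>
      have := ih 0
      simp only [List.replicate_zero, List.nil_append] at this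
      simp only [parse, blockWord, List.flatMap_cons, Nat.natPred_succPNat, List.append_assoc]
      simp only [blockWord] at this
      rw [this]
      simp

lemma parse_replicate (n k : ℕ) (w : List XZ) :
    parse n (List.replicate k XZ.x ++ w) = parse (n + k) w := by
  induction k generalizing n with
  | zero => simp
  | succ k ih =>
    rw [List.replicate_succ, List.cons_append, parse, ih]
    congr 1
    omega

lemma parse_blockWord (l : List ℕ+) (k : ℕ) :
    parse 0 (blockWord l ++ List.replicate k XZ.x) = (l, k) := by
  induction l with
  | nil =>
    have := parse_replicate 0 k []
    simpa [blockWord, parse] using this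
  | cons n l ih =>
    have h : blockWord (n :: l) ++ List.replicate k XZ.x
        = List.replicate n.natPred XZ.x ++ XZ.z :: (blockWord l ++ List.replicate k XZ.x) := by
      simp [blockWord]
    rw [h, parse_replicate, parse, ih]
    simp

variable (K : Type*) [Field K]

/-- The free associative algebra `K⟨x,z⟩`. -/
abbrev Kxz : Type _ := FreeAlgebra K XZ

/-- The free associative algebra `K⟨Y⟩` on `Y = {y_n | n ≥ 1}`. -/
abbrev KY : Type _ := FreeAlgebra K ℕ+

/-- The component of `K⟨x,z⟩` of depth `p.1` (degree in `z`) and weight `p.2` (total degree). -/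
def xzGrading (p : ℕ × ℕ) : Submodule K (Kxz K) :=
  Submodule.span K (word K '' {w : List XZ | w.count XZ.z = p.1 ∧ w.length = p.2})

/-- The projection `π : K⟨x,z⟩ → K⟨Y⟩` with `π(x^{n₁-1} z ⋯ x^{n_m-1} z) = y_{n₁} ⋯ y_{n_m}`,
vanishing on the words that end in `x`. -/
def piMap : Kxz K →ₗ[K] KY K :=
  (wordBasis K XZ).constr K fun w => if (parse 0 w).2 = 0 then word K (parse 0 w).1 else 0

lemma piMap_blockWord (l : List ℕ+) : piMap K (word K (blockWord l)) = word K l := by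
  have h := parse_blockWord l 0
  rw [List.replicate_zero, List.append_nil] at h
  rw [← wordBasis_apply, piMap, Module.Basis.constr_basis, h]
  simp

lemma piMap_mul_x (w : List XZ) : piMap K (word K (w ++ [XZ.x])) = 0 := by
  have h := parse_blockWord (parse 0 w).1 ((parse 0 w).2 + 1)
  rw [List.replicate_succ', ← List.append_assoc, parse_spec, List.replicate_zero,
    List.nil_append] at h
  rw [← wordBasis_apply, piMap, Module.Basis.constr_basis, h]
  simp

/-- The linearized double shuffle space `ls ⊆ K⟨x,z⟩`. -/
def ls : Submodule K (Kxz K) where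
  carrier := {ψ | coproduct K XZ ψ = 1 ⊗ₜ[K] ψ + ψ ⊗ₜ[K] 1 ∧
    coproduct K ℕ+ (piMap K ψ) = 1 ⊗ₜ[K] piMap K ψ + piMap K ψ ⊗ₜ[K] 1 ∧
    (∀ w : List XZ, w.count XZ.z = 0 → (wordBasis K XZ).repr ψ w = 0) ∧
    (∀ w : List XZ, w.count XZ.z = 1 → Even w.length → (wordBasis K XZ).repr ψ w = 0)}
  add_mem' := by
    rintro a b ⟨h1, h2, h3, h4⟩ ⟨g1, g2, g3, g4⟩
    refine ⟨?_, ?_, fun w hw => ?_, fun w hw hw' => ?_⟩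
    · rw [map_add, h1, g1, TensorProduct.tmul_add, TensorProduct.add_tmul]; abel
    · rw [map_add, map_add, h2, g2, TensorProduct.tmul_add, TensorProduct.add_tmul]; abel
    · simp [h3 w hw, g3 w hw]
    · simp [h4 w hw hw', g4 w hw hw']
  zero_mem' := by simp
  smul_mem' := by
    rintro c a ⟨h1, h2, h3, h4⟩
    refine ⟨?_, ?_, fun w hw => ?_, fun w hw hw' => ?_⟩
    · rw [map_smul, h1, TensorProduct.tmul_smul, ← TensorProduct.smul_tmul', smul_add]
    · rw [map_smul, map_smul, h2, TensorProduct.tmul_smul, ← TensorProduct.smul_tmul', smul_add]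
    · simp [h3 w hw]
    · simp [h4 w hw hw']

/-- The bigrading of `ls` by depth and weight. -/
def lsGrading (p : ℕ × ℕ) : Submodule K (ls K) := (xzGrading K p).comap (ls K).subtype

/-! ### The Ihara bracket -/

/-- `derWord v w = d_w(v)` for a word `v`, where `d_w` is the derivation of `K⟨x,z⟩` with
`d_w(x) = 0` and `d_w(z) = zw - wz`. -/
def derWord : List XZ → Kxz K →ₗ[K] Kxz K
  | [] => 0
  | XZ.x :: v => LinearMap.mulLeft K (FreeAlgebra.ι K XZ.x) ∘ₗ derWord v
  | XZ.z :: v =>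
      LinearMap.mulRight K (word K v) ∘ₗ
        (LinearMap.mulLeft K (FreeAlgebra.ι K XZ.z) - LinearMap.mulRight K (FreeAlgebra.ι K XZ.z))
      + LinearMap.mulLeft K (FreeAlgebra.ι K XZ.z) ∘ₗ derWord v

/-- `der w v = d_w(v)`. -/
def der : Kxz K →ₗ[K] Kxz K →ₗ[K] Kxz K :=
  ((wordBasis K XZ).constr K (derWord K)).flip

lemma der_word (w : Kxz K) (v : List XZ) : der K w (word K v) = derWord K v w := by
  rw [← wordBasis_apply, der, LinearMap.flip_apply, Module.Basis.constr_basis]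

lemma der_x (w : Kxz K) : der K w (FreeAlgebra.ι K XZ.x) = 0 := by
  have := der_word K w [XZ.x]
  simpa [word, derWord] using this

lemma der_z (w : Kxz K) :
    der K w (FreeAlgebra.ι K XZ.z)
      = FreeAlgebra.ι K XZ.z * w - w * FreeAlgebra.ι K XZ.z := by
  have := der_word K w [XZ.z]
  simpa [word, derWord] using this

lemma der_leibniz (w a b : Kxz K) : der K w (a * b) = der K w a * b + a * der K w b := by
  have key : ∀ u v : List XZ, der K w (word K u * word K v)
      = der K w (word K u) * word K v + word K u * der K w (word K v) := by
    intro u v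
    rw [← word_append, der_word, der_word, der_word]
    induction u with
    | nil => simp [derWord, word]
    | cons c u ih =>
      cases c <;>
      · simp only [List.cons_append, derWord, LinearMap.comp_apply, LinearMap.add_apply,
          LinearMap.mulLeft_apply, LinearMap.mulRight_apply, LinearMap.sub_apply, ih,
          word_append, word_cons]
        noncomm_ring
  have h : (LinearMap.mul K (Kxz K)).compr₂ (der K w)
      = (LinearMap.mul K (Kxz K)) ∘ₗ (der K w)
        + ((LinearMap.mul K (Kxz K)).compl₂ (der K w)) := by
    refine (wordBasis K XZ).ext fun u => (wordBasis K XZ).ext fun v => ?_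
    simpa [wordBasis_apply] using key u v
  simpa using LinearMap.congr_fun (LinearMap.congr_fun h a) b

/-- The Ihara bracket `{w,w'} = d_w(w') - d_{w'}(w) + ww' - w'w`. -/
def ihara : Kxz K →ₗ[K] Kxz K →ₗ[K] Kxz K :=
  der K - (der K).flip + (LinearMap.mul K (Kxz K) - (LinearMap.mul K (Kxz K)).flip)

lemma ihara_apply (a b : Kxz K) :
    ihara K a b = der K a b - der K b a + (a * b - b * a) := by
  simp [ihara]

/-- `ls` is preserved by the Ihara bracket. -/
def LsStable : Prop := ∀ a ∈ ls K, ∀ b ∈ ls K, ihara K a b ∈ ls K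

/-- The Ihara bracket restricted to `ls`. -/
def iharaLs (h : LsStable K) : ls K →ₗ[K] ls K →ₗ[K] ls K :=
  LinearMap.mk₂ K (fun a b => ⟨ihara K a b, h a a.2 b b.2⟩)
    (fun a a' b => by ext; simp) (fun c a b => by ext; simp)
    (fun a b b' => by ext; simp) (fun c a b => by ext; simp)

/-- The Ihara cobracket: on a word `w` it is the sum of `⟨{u,v}, w⟩ u ⊗ v` over all pairs of words
`u`, `v` with `|u| + |v| = |w|`. -/
def iharaCobracket : Kxz K →ₗ[K] Kxz K ⊗[K] Kxz K :=
  (wordBasis K XZ).constr K fun w =>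
    ∑ p ∈ Finset.HasAntidiagonal.antidiagonal w.length, ∑ u : Fin p.1 → XZ, ∑ v : Fin p.2 → XZ,
      pairing K XZ (ihara K (word K (List.ofFn u)) (word K (List.ofFn v))) (word K w) •
        (word K (List.ofFn u) ⊗ₜ[K] word K (List.ofFn v))

/-- The pairing `⟨-,-⟩^{⊗2}` on `K⟨x,z⟩ ⊗ K⟨x,z⟩`. -/
def pairing₂ : Kxz K ⊗[K] Kxz K →ₗ[K] Module.Dual K (Kxz K ⊗[K] Kxz K) :=
  TensorProduct.dualDistrib K (Kxz K) (Kxz K) ∘ₗ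
    TensorProduct.map (pairing K XZ) (pairing K XZ)

/-- The span of the words of length `n`. -/
def weightPart (n : ℕ) : Submodule K (Kxz K) :=
  Submodule.span K (word K '' {w : List XZ | w.length = n})

lemma word_mem_weightPart (w : List XZ) : word K w ∈ weightPart K w.length :=
  Submodule.subset_span ⟨w, rfl, rfl⟩

lemma mul_mem_weightPart {m n : ℕ} {a b : Kxz K} (ha : a ∈ weightPart K m)
    (hb : b ∈ weightPart K n) : a * b ∈ weightPart K (m + n) := by
  have h := Submodule.mul_mem_mul ha hb
  rw [weightPart, weightPart, Submodule.span_mul_span] at h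
  refine Submodule.span_mono ?_ h
  rintro _ ⟨_, ⟨u, hu, rfl⟩, _, ⟨v, hv, rfl⟩, rfl⟩
  refine ⟨u ++ v, ?_, word_append K u v⟩
  simp only [Set.mem_ofPred_eq] at hu hv
  simp [hu, hv]

lemma letter_mem_weightPart (a : XZ) : FreeAlgebra.ι K a ∈ weightPart K 1 := by
  have := word_mem_weightPart K [a]
  simpa [word] using this

lemma derWord_mem_weightPart (u v : List XZ) :
    derWord K v (word K u) ∈ weightPart K (u.length + v.length) := by
  induction v with
  | nil => simp [derWord]
  | cons c v ih =>
    have e : u.length + (c :: v).length = 1 + (u.length + v.length) := by simp; omega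
    have hx : ∀ c, FreeAlgebra.ι K c * derWord K v (word K u)
        ∈ weightPart K (1 + (u.length + v.length)) := fun c =>
      mul_mem_weightPart K (letter_mem_weightPart K c) ih
    rw [e]
    cases c with
    | x => simpa [derWord] using hx XZ.x
    | z =>
      simp only [derWord, LinearMap.comp_apply, LinearMap.add_apply,
        LinearMap.mulLeft_apply, LinearMap.mulRight_apply, LinearMap.sub_apply]
      refine Submodule.add_mem _ ?_ (hx XZ.z)
      have h1 := mul_mem_weightPart K (mul_mem_weightPart K (letter_mem_weightPart K XZ.z)
        (word_mem_weightPart K u)) (word_mem_weightPart K v)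
      have h2 := mul_mem_weightPart K (mul_mem_weightPart K (word_mem_weightPart K u)
        (letter_mem_weightPart K XZ.z)) (word_mem_weightPart K v)
      rw [show u.length + 1 + v.length = 1 + (u.length + v.length) by omega] at h2
      rw [show 1 + u.length + v.length = 1 + (u.length + v.length) by omega] at h1
      rw [sub_mul]
      exact Submodule.sub_mem _ h1 h2

lemma ihara_mem_weightPart (u v : List XZ) :
    ihara K (word K u) (word K v) ∈ weightPart K (u.length + v.length) := by
  have h1 := derWord_mem_weightPart K u v
  have h2 := derWord_mem_weightPart K v u
  have h3 := mul_mem_weightPart K (word_mem_weightPart K u) (word_mem_weightPart K v)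
  have h4 := mul_mem_weightPart K (word_mem_weightPart K v) (word_mem_weightPart K u)
  rw [add_comm] at h2 h4
  rw [ihara_apply, der_word, der_word]
  exact Submodule.add_mem _ (Submodule.sub_mem _ h1 h2) (Submodule.sub_mem _ h3 h4)

lemma pairing_word (u v : List XZ) :
    pairing K XZ (word K u) (word K v) = if u = v then 1 else 0 := by
  rw [← wordBasis_apply, ← wordBasis_apply, pairing, Module.Basis.toDual_apply]

lemma pairing_symm (a b : Kxz K) : pairing K XZ a b = pairing K XZ b a := by
  have h : pairing K XZ = (pairing K XZ).flip := by
    refine (wordBasis K XZ).ext fun u => (wordBasis K XZ).ext fun v => ?_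
    simp only [wordBasis_apply, LinearMap.flip_apply, pairing_word, eq_comm]
  conv_lhs => rw [h]
  rfl

lemma pairing_eq_zero {n : ℕ} {a : Kxz K} (ha : a ∈ weightPart K n) (w : List XZ)
    (hw : w.length ≠ n) : pairing K XZ a (word K w) = 0 := by
  have : weightPart K n ≤ LinearMap.ker ((pairing K XZ).flip (word K w)) := by
    rw [weightPart, Submodule.span_le]
    rintro _ ⟨u, hu, rfl⟩
    simp only [Set.mem_ofPred_eq] at hu
    simp only [SetLike.mem_coe, LinearMap.mem_ker, LinearMap.flip_apply, pairing_word]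
    rw [if_neg]
    rintro rfl
    exact hw hu
  simpa using this ha

/-- The Ihara cobracket is the adjoint of the Ihara bracket. -/
theorem iharaCobracket_adjoint (a b c : Kxz K) :
    pairing₂ K (iharaCobracket K a) (b ⊗ₜ[K] c) = pairing K XZ a (ihara K b c) := by
  have key : ∀ w u v : List XZ,
      pairing₂ K (iharaCobracket K (word K w)) (word K u ⊗ₜ[K] word K v)
        = pairing K XZ (word K w) (ihara K (word K u) (word K v)) := by
    intro w u v
    rw [← wordBasis_apply K w, iharaCobracket, Module.Basis.constr_basis]
    simp only [map_sum, map_smul, LinearMap.sum_apply, LinearMap.smul_apply, pairing₂,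
      LinearMap.comp_apply, TensorProduct.map_tmul, TensorProduct.dualDistrib_apply,
      pairing_word, wordBasis_apply]
    rw [pairing_symm K (word K w)]
    by_cases h : u.length + v.length = w.length
    · rw [Finset.sum_eq_single (u.length, v.length)]
      · rw [Finset.sum_eq_single u.get, Finset.sum_eq_single v.get]
        · simp
        · intro v' _ hv'
          rw [if_neg (c := List.ofFn v' = v)]
          · simp
          · intro e
            apply hv'
            apply List.ofFn_injective
            rw [e, List.ofFn_get]
        · simp
        · intro u' _ hu'
          refine Finset.sum_eq_zero fun v' _ => ?_
          rw [if_neg (c := List.ofFn u' = u)]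
          · simp
          · intro e
            apply hu'
            apply List.ofFn_injective
            rw [e, List.ofFn_get]
        · simp
      · intro p _ hp
        refine Finset.sum_eq_zero fun u' _ => Finset.sum_eq_zero fun v' _ => ?_
        by_cases hu : List.ofFn u' = u
        · by_cases hv : List.ofFn v' = v
          · exfalso
            apply hp
            ext
            · simp [← hu]
            · simp [← hv]
          · simp [hv]
        · simp [hu]
      · intro hp
        exact absurd (by simpa using h) hp
    · rw [pairing_eq_zero K (ihara_mem_weightPart K u v) w (Ne.symm h)]
      refine Finset.sum_eq_zero fun p hp => Finset.sum_eq_zero fun u' _ =>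
        Finset.sum_eq_zero fun v' _ => ?_
      by_cases hu : List.ofFn u' = u
      · by_cases hv : List.ofFn v' = v
        · exfalso
          apply h
          rw [Finset.HasAntidiagonal.mem_antidiagonal] at hp
          simp [← hu, ← hv, hp]
        · simp [hv]
      · simp [hu]
  have h1 : ∀ (u v : List XZ) (a : Kxz K),
      pairing₂ K (iharaCobracket K a) (word K u ⊗ₜ[K] word K v)
        = pairing K XZ a (ihara K (word K u) (word K v)) := by
    intro u v a
    have e : (pairing₂ K ∘ₗ iharaCobracket K).flip (word K u ⊗ₜ[K] word K v)
        = (pairing K XZ).flip (ihara K (word K u) (word K v)) := by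
      refine (wordBasis K XZ).ext fun w => ?_
      rw [wordBasis_apply]
      exact key w u v
    exact LinearMap.congr_fun e a
  have h2 : ∀ (v : List XZ) (b : Kxz K),
      pairing₂ K (iharaCobracket K a) (b ⊗ₜ[K] word K v)
        = pairing K XZ a (ihara K b (word K v)) := by
    intro v b
    have e : pairing₂ K (iharaCobracket K a) ∘ₗ
          (TensorProduct.mk K (Kxz K) (Kxz K)).flip (word K v)
        = pairing K XZ a ∘ₗ (ihara K).flip (word K v) := by
      refine (wordBasis K XZ).ext fun w => ?_
      rw [wordBasis_apply]
      exact h1 w v a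
    exact LinearMap.congr_fun e b
  have e : pairing₂ K (iharaCobracket K a) ∘ₗ TensorProduct.mk K (Kxz K) (Kxz K) b
      = pairing K XZ a ∘ₗ ihara K b := by
    refine (wordBasis K XZ).ext fun w => ?_
    rw [wordBasis_apply]
    exact h2 w b
  exact LinearMap.congr_fun e c

end LS

/-! ### Series with values in a vector space -/

section Series

variable {K : Type*} [Field K] {M : Type*} [AddCommGroup M] [Module K M] {τ : Type*}

/-- Formal power series in the variables `τ` with values in `M`, given by their coefficients. -/
abbrev Series (τ M : Type*) : Type _ := (τ →₀ ℕ) → M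

/-- For a family of symbols `I(n₁,…,n_m)` with values in `M` and linear forms `s₁,…,s_m,s₀` in the
variables `τ`, the series
`{s₁ : ⋯ : s_m : s₀} = ∑ I(n₁,…,n_m) (s₁-s₀)^{n₁-1} ⋯ (s_m-s₀)^{n_m-1}`.
Here `n i` stands for `n_i - 1`. As the `s i - s₀` are linear forms, only the `n` with
`∑ n i = deg a` contribute to the coefficient of the monomial `a`. -/
def colonSeries (I : List ℕ+ → M) {m : ℕ} (s : Fin m → MvPolynomial τ K)
    (s₀ : MvPolynomial τ K) : Series τ M := fun a =>
  ∑ n ∈ Finset.Nat.antidiagonalTuple m a.degree,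
    MvPolynomial.coeff a (∏ i, (s i - s₀) ^ n i) • I (List.ofFn fun i => (n i).succPNat)

/-- The series `{s₁, …, s_m} = {s₁ : s₁+s₂ : ⋯ : s₁+⋯+s_m : 0}`. -/
def commaSeries (I : List ℕ+ → M) {m : ℕ} (s : Fin m → MvPolynomial τ K) : Series τ M :=
  colonSeries I (fun i => ∑ j ∈ Finset.Iic i, s j) 0

/-- The product `f ⊗ g` of two series, with values in `M ⊗ M`. -/
def tmulSeries (K : Type*) [Field K] {M : Type*} [AddCommGroup M] [Module K M]
    (f g : Series τ M) : Series τ (M ⊗[K] M) := by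
  classical
  exact fun a => ∑ p ∈ Finset.HasAntidiagonal.antidiagonal a, f p.1 ⊗ₜ[K] g p.2

/-- `f ∧ g = f ⊗ g - g ⊗ f`. -/
def wedgeSeries (K : Type*) [Field K] {M : Type*} [AddCommGroup M] [Module K M]
    (f g : Series τ M) : Series τ (M ⊗[K] M) :=
  tmulSeries K f g - tmulSeries K g f

/-- The variable `t_{r+1}`, the index being taken modulo `m+1`, among `t₁,…,t_{m+1}`. -/
def tvar (K : Type*) [Field K] (m r : ℕ) : MvPolynomial (Fin (m + 1)) K :=
  MvPolynomial.X (Fin.ofNat (m + 1) r)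

/-- The series
`∑_{k=2}^{m} Cycle_{m+1} ({t₁ : ⋯ : t_{k-1} : t_{m+1}} ∧ {t_k : ⋯ : t_{m+1}})`
`= ∑_{k=2}^{m} ∑_{j=0}^{m} {t_{1+j} : ⋯ : t_{k-1+j} : t_{m+1+j}} ∧ {t_{k+j} : ⋯ : t_{m+1+j}}`,
indices modulo `m+1`; the summation variable is `p = k-1`. -/
def cycleSeries (K : Type*) [Field K] {M : Type*} [AddCommGroup M] [Module K M]
    (I : List ℕ+ → M) (m : ℕ) : Series (Fin (m + 1)) (M ⊗[K] M) :=
  ∑ p ∈ Finset.Ico 1 m, ∑ j ∈ Finset.range (m + 1),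
    wedgeSeries K
      (colonSeries I (fun i : Fin p => tvar K m (i + j)) (tvar K m (m + j)))
      (colonSeries I (fun i : Fin (m - p) => tvar K m (p + i + j)) (tvar K m (m + j)))

end Series

/-- The set `S(p,q)` of `(p,q)`-shuffles. -/
def shuffles (p q : ℕ) : Finset (Equiv.Perm (Fin (p + q))) := by
  classical
  exact Finset.univ.filter fun σ =>
    (∀ i j : Fin (p + q), i < j → (j : ℕ) < p → σ i < σ j) ∧
    (∀ i j : Fin (p + q), p ≤ (i : ℕ) → i < j → σ i < σ j)

/-! ### Lie coalgebras, bigradings, bigraded duals -/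

section Coalg

variable {K : Type*} [Field K] {M : Type*} [AddCommGroup M] [Module K M]

/-- The subspace `F ⊗ M + M ⊗ F` of `M ⊗ M`. -/
def coidealTarget (F : Submodule K M) : Submodule K (M ⊗[K] M) :=
  LinearMap.range (TensorProduct.map F.subtype (LinearMap.id : M →ₗ[K] M)) ⊔
    LinearMap.range (TensorProduct.map (LinearMap.id : M →ₗ[K] M) F.subtype)

/-- `F` is a coideal for `δ`: `δ(F) ⊆ F ⊗ M + M ⊗ F`. -/
def IsCoideal (F : Submodule K M) (δ : M →ₗ[K] M ⊗[K] M) : Prop :=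
  ∀ v ∈ F, δ v ∈ coidealTarget F

/-- The cyclic permutation `a ⊗ b ⊗ c ↦ b ⊗ c ⊗ a`. -/
def rot (K M : Type*) [Field K] [AddCommGroup M] [Module K M] :
    M ⊗[K] (M ⊗[K] M) →ₗ[K] M ⊗[K] (M ⊗[K] M) :=
  (TensorProduct.assoc K M M M).toLinearMap ∘ₗ (TensorProduct.comm K M (M ⊗[K] M)).toLinearMap

/-- `δ` is a Lie cobracket: it is antisymmetric and satisfies the co-Jacobi identity. -/
structure IsLieCobracket (δ : M →ₗ[K] M ⊗[K] M) : Prop where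
  antisymm : ∀ a, TensorProduct.comm K M M (δ a) = -δ a
  coJacobi : ∀ a, let t := TensorProduct.map LinearMap.id δ (δ a)
    t + rot K M t + rot K M (rot K M t) = 0

/-- The component of bidegree `p` of `M ⊗ M`, for a bigrading `gr` of `M`. -/
def tensorGrading (gr : ℕ × ℕ → Submodule K M) (p : ℕ × ℕ) : Submodule K (M ⊗[K] M) :=
  ⨆ (q : ℕ × ℕ) (r : ℕ × ℕ) (_ : q + r = p),
    LinearMap.range (TensorProduct.map (gr q).subtype (gr r).subtype)

/-- `M` with the components `gr` and the map `δ` is a bigraded Lie coalgebra. -/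
structure IsBigradedLieCoalgebra (gr : ℕ × ℕ → Submodule K M) (δ : M →ₗ[K] M ⊗[K] M) : Prop where
  isInternal : DirectSum.IsInternal gr
  isLieCobracket : IsLieCobracket δ
  map_grading : ∀ p, ∀ a ∈ gr p, δ a ∈ tensorGrading gr p

/-- The linear forms on `M` that vanish on every component of `M` of bidegree other than `p`. -/
def dualPiece (gr : ℕ × ℕ → Submodule K M) (p : ℕ × ℕ) : Submodule K (Module.Dual K M) :=
  ⨅ (q : ℕ × ℕ) (_ : q ≠ p), (gr q).dualAnnihilator

/-- The bigraded dual of `M`. -/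
def bigradedDual (gr : ℕ × ℕ → Submodule K M) : Submodule K (Module.Dual K M) :=
  ⨆ p, dualPiece gr p

/-- The bigrading of the bigraded dual. -/
def dualGrading (gr : ℕ × ℕ → Submodule K M) (p : ℕ × ℕ) : Submodule K (bigradedDual gr) :=
  (dualPiece gr p).comap (bigradedDual gr).subtype

/-- `δ` is the map dual to the bracket `g`: the element `δ f` of `M^∨ ⊗ M^∨`, seen as a linear
form on `M ⊗ M`, is `a ⊗ b ↦ f (g a b)`. -/
def IsDualCobracket (gr : ℕ × ℕ → Submodule K M) (g : M →ₗ[K] M →ₗ[K] M)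
    (δ : bigradedDual gr →ₗ[K] bigradedDual gr ⊗[K] bigradedDual gr) : Prop :=
  ∀ (f : bigradedDual gr) (a b : M),
    TensorProduct.dualDistrib K M M
      (TensorProduct.map (bigradedDual gr).subtype (bigradedDual gr).subtype (δ f)) (a ⊗ₜ[K] b)
      = f.1 (g a b)

/-- The bigrading induced on a quotient. -/
def quotGrading (gr : ℕ × ℕ → Submodule K M) (F : Submodule K M) (p : ℕ × ℕ) :
    Submodule K (M ⧸ F) :=
  (gr p).map F.mkQ

end Coalg

/-! ### The spaces `W`, `U`, `V` and the subspaces `W_R`, `F` -/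

section Dihedral

/-- The indices `(n₁,…,n_m)`, `m ≥ 1`, `n_i ≥ 1`, of the basis of `W`. -/
abbrev WIndex : Type := {l : List ℕ+ // l ≠ []}

variable (K : Type*) [Field K]

/-- The space `W` with basis the elements `I(n₁,…,n_m)`, `m ≥ 1`. -/
abbrev W : Type _ := WIndex →₀ K

/-- The basis element `I(n₁,…,n_m)` of `W` (and, by convention, `0` for the empty list). -/
def gen (l : List ℕ+) : W K :=
  if h : l ≠ [] then Finsupp.single ⟨l, h⟩ 1 else 0

/-- The weight `n₁ + ⋯ + n_m`. -/
def listWeight (l : List ℕ+) : ℕ := (l.map fun n => (n : ℕ)).sum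

/-- The component of `W` of depth `p.1` and weight `p.2`. -/
def wGrading (p : ℕ × ℕ) : Submodule K (W K) :=
  Finsupp.supported K K {l : WIndex | l.1.length = p.1 ∧ listWeight l.1 = p.2}

/-- The span of the coefficients of
`∑_{σ ∈ S(p,q)} {t_{σ⁻¹(1)} : ⋯ : t_{σ⁻¹(p+q)} : t_{p+q+1}}`, for all `p, q ≥ 1`. -/
def Wst : Submodule K (W K) :=
  Submodule.span K {w | ∃ p q : ℕ, 1 ≤ p ∧ 1 ≤ q ∧ ∃ a : Fin (p + q + 1) →₀ ℕ,
    w = (∑ σ ∈ shuffles p q,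
      colonSeries (gen K) (fun i => (MvPolynomial.X (σ.symm i).castSucc :
        MvPolynomial (Fin (p + q + 1)) K)) (MvPolynomial.X (Fin.last (p + q)))) a}

/-- The span of the coefficients of `∑_{σ ∈ S(p,q)} {t_{σ⁻¹(1)}, …, t_{σ⁻¹(p+q)}}`, for all
`p, q ≥ 1`. -/
def Wsh : Submodule K (W K) :=
  Submodule.span K {w | ∃ p q : ℕ, 1 ≤ p ∧ 1 ≤ q ∧ ∃ a : Fin (p + q) →₀ ℕ,
    w = (∑ σ ∈ shuffles p q,
      commaSeries (gen K) (fun i => (MvPolynomial.X (σ.symm i) :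
        MvPolynomial (Fin (p + q)) K))) a}

/-- The span of the elements `I(2n)`, `n ≥ 1`. -/
def WoneEven : Submodule K (W K) :=
  Submodule.span K {w | ∃ n : ℕ+, Even (n : ℕ) ∧ w = gen K [n]}

/-- The subspace `W_R` of `W`. -/
def WR : Submodule K (W K) := Wst K ⊔ Wsh K ⊔ WoneEven K

/-- The map `δ̃ : W → W ⊗ W` with
`δ̃ {t₁ : ⋯ : t_{m+1}} = ∑_{k=2}^{m} Cycle_{m+1} ({t₁ : ⋯ : t_{k-1} : t_{m+1}} ∧ {t_k : ⋯ : t_{m+1}})`.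
`I(n₁,…,n_m)` is the coefficient of `t₁^{n₁-1} ⋯ t_m^{n_m-1} t_{m+1}^0` in `{t₁ : ⋯ : t_{m+1}}`, so
its image is the coefficient of this monomial on the right; the other coefficients of the formula
follow, since both sides depend on the differences `t_i - t_{m+1}` only. -/
def deltaTilde : W K →ₗ[K] W K ⊗[K] W K :=
  Finsupp.linearCombination K fun l : WIndex =>
    cycleSeries K (gen K) l.1.length
      (Finsupp.equivFunOnFinite.symm
        (Fin.snoc (α := fun _ => ℕ) (fun i : Fin l.1.length => (l.1.get i).natPred) 0))

/-- The indices of the basis of `U`: `none` for `I'(0)` and `some (n₀, (n₁,…,n_m))`, `m ≥ 0`, for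
`I'(n₀,n₁,…,n_m)`. -/
abbrev UIndex : Type := Option (ℕ+ × List ℕ+)

/-- The space `U` with basis the elements `I'(0)` and `I'(n₀,…,n_m)`. -/
abbrev U : Type _ := UIndex →₀ K

/-- Depth and weight of the basis elements of `U`. -/
def uDegree : UIndex → ℕ × ℕ
  | none => (0, 0)
  | some (n₀, l) => (l.length, n₀ + listWeight l)

/-- The component of `U` of depth `p.1` and weight `p.2`. -/
def uGrading (p : ℕ × ℕ) : Submodule K (U K) :=
  Finsupp.supported K K {i : UIndex | uDegree i = p}

/-- `V = W ⊕ U`. -/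
abbrev V : Type _ := W K × U K

/-- The component of `V` of depth `p.1` and weight `p.2`. -/
def vGrading (p : ℕ × ℕ) : Submodule K (V K) := (wGrading K p).prod (uGrading K p)

/-- `F = W_R ⊕ U`. -/
def F : Submodule K (V K) := (WR K).prod ⊤

/-! ### The isomorphism `φ` -/

/-- The values of `φ` on the basis of `U`. -/
def phiU : UIndex → Kxz K
  | none => 1
  | some (n₀, l) =>
      shuffle K XZ (word K (blockWord l.reverse ++ List.replicate n₀.natPred XZ.x))
        (word K [XZ.x])

/-- The map `φ : V → K⟨x,z⟩` with `φ(I(n₁,…,n_m)) = x^{n_m-1} z ⋯ x^{n₁-1} z`,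
`φ(I'(n₀,…,n_m)) = x^{n_m-1} z ⋯ x^{n₁-1} z x^{n₀-1} ⧢ x` and `φ(I'(0)) = 1`. -/
def phi : V K →ₗ[K] Kxz K :=
  (Finsupp.linearCombination K fun l : WIndex => word K (blockWord l.1.reverse)).coprod
    (Finsupp.linearCombination K (phiU K))

/-- On indices `(n₁,…,n_m)`, the sum over `i` of `n_i (n₁,…,n_i+1,…,n_m)`. -/
def raise : List ℕ+ → (List ℕ+ →₀ K)
  | [] => 0
  | n :: l => (n : K) • Finsupp.single ((n + 1) :: l) 1 +
      Finsupp.lmapDomain K K (fun l' => n :: l') (raise l)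

/-- `(n₁,…,n_m) ↦ x^{n₁-1} z ⋯ x^{n_m-1} z x^k`. -/
def toWords (k : ℕ) : (List ℕ+ →₀ K) →ₗ[K] Kxz K :=
  Finsupp.linearCombination K fun l => word K (blockWord l ++ List.replicate k XZ.x)

lemma shuffleWord_nil_right (u : List XZ) : shuffleWord K u [] = word K u := by
  cases u <;> simp [shuffleWord]

lemma shuffleWord_replicate (k : ℕ) :
    shuffleWord K (List.replicate k XZ.x) [XZ.x]
      = ((k : K) + 1) • word K (List.replicate (k + 1) XZ.x) := by
  induction k with
  | zero => simp [shuffleWord]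
  | succ k ih =>
    rw [List.replicate_succ, shuffleWord, ih, shuffleWord_nil_right, mul_smul_comm,
      ← word_cons, ← word_cons, ← List.replicate_succ, ← List.replicate_succ, Nat.cast_succ]
    simp only [List.replicate_succ]
    module

lemma shuffleWord_replicate_append (k : ℕ) (v : List XZ) :
    shuffleWord K (List.replicate k XZ.x ++ XZ.z :: v) [XZ.x]
      = ((k : K) + 1) • word K (List.replicate (k + 1) XZ.x ++ XZ.z :: v)
        + word K (List.replicate k XZ.x ++ [XZ.z]) * shuffleWord K v [XZ.x] := by
  induction k with
  | zero =>
    simp [shuffleWord, shuffleWord_nil_right, word_cons, word_nil]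
    abel
  | succ k ih =>
    rw [List.replicate_succ, List.cons_append, shuffleWord, ih, shuffleWord_nil_right, mul_add,
      mul_smul_comm, List.cons_append, word_cons K XZ.x (_ ++ [XZ.z]), mul_assoc,
      ← word_cons, ← word_cons, ← List.cons_append, ← List.replicate_succ, ← List.cons_append,
      ← List.replicate_succ, Nat.cast_succ]
    simp only [List.replicate_succ, List.cons_append]
    module

lemma toWords_cons (k : ℕ) (n : ℕ+) (c : List ℕ+ →₀ K) :
    toWords K k (Finsupp.lmapDomain K K (fun l' => n :: l') c)
      = word K (List.replicate n.natPred XZ.x ++ [XZ.z]) * toWords K k c := by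
  induction c using Finsupp.induction_linear with
  | zero => simp
  | add f g hf hg => rw [map_add, map_add, hf, hg, map_add, mul_add]
  | single l r =>
    simp [toWords, blockWord, ← word_append]

lemma shuffle_blockWord (l : List ℕ+) (k : ℕ) :
    shuffle K XZ (word K (blockWord l ++ List.replicate k XZ.x)) (word K [XZ.x])
      = toWords K k (raise K l) + ((k : K) + 1) • toWords K (k + 1) (Finsupp.single l 1) := by
  rw [shuffle_word]
  induction l with
  | nil => simp [blockWord, raise, toWords, shuffleWord_replicate]
  | cons n l ih =>
    have h : ∀ n : ℕ+, ∀ k, blockWord (n :: l) ++ List.replicate k XZ.x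
        = List.replicate n.natPred XZ.x ++ XZ.z :: (blockWord l ++ List.replicate k XZ.x) := by
      simp [blockWord]
    have h2 : (Finsupp.single (n :: l) 1 : List ℕ+ →₀ K)
        = Finsupp.lmapDomain K K (fun l' => n :: l') (Finsupp.single l 1) := by simp
    have h3 : toWords K k (Finsupp.single ((n + 1) :: l) 1)
        = word K (List.replicate (n.natPred + 1) XZ.x ++
            XZ.z :: (blockWord l ++ List.replicate k XZ.x)) := by
      simp only [toWords, Finsupp.linearCombination_single, one_smul, h]
      congr 3
      simp only [PNat.natPred, PNat.add_coe, PNat.one_coe]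
      have := n.pos
      omega
    have h4 : ((n.natPred : K) + 1) = (n : K) := by
      have := PNat.natPred_add_one n
      exact_mod_cast congrArg (Nat.cast : ℕ → K) this
    rw [h, shuffleWord_replicate_append, ih, raise, map_add, map_smul, h3, h4, toWords_cons, h2,
      toWords_cons, mul_add, mul_smul_comm, add_assoc]

/-- The preimage under `φ` of the words `x^{n₁-1} z ⋯ x^{n_m-1} z x^k`. -/
def psi : ℕ → (List ℕ+ →₀ K) →ₗ[K] V K
  | 0 => Finsupp.linearCombination K fun l =>
      if h : l.reverse ≠ [] then (Finsupp.single ⟨l.reverse, h⟩ 1, 0)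
      else (0, Finsupp.single none 1)
  | k + 1 => ((k : K) + 1)⁻¹ •
      ((Finsupp.linearCombination K fun l =>
        ((0, Finsupp.single (some (k.succPNat, l.reverse)) 1) : V K)) - psi k ∘ₗ
          Finsupp.linearCombination K (raise K))

/-- The inverse of `φ`. -/
def phiInv : Kxz K →ₗ[K] V K :=
  (wordBasis K XZ).constr K fun w => psi K (parse 0 w).2 (Finsupp.single (parse 0 w).1 1)

lemma phiInv_toWords (k : ℕ) (c : List ℕ+ →₀ K) : phiInv K (toWords K k c) = psi K k c := by
  induction c using Finsupp.induction_linear with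
  | zero => simp
  | add f g hf hg => rw [map_add, map_add, hf, hg, map_add]
  | single l r =>
    have e2 : (Finsupp.single l r : List ℕ+ →₀ K) = r • Finsupp.single l 1 := by simp
    rw [e2, map_smul, map_smul, map_smul]
    congr 1
    rw [toWords, Finsupp.linearCombination_single, one_smul, ← wordBasis_apply, phiInv,
      Module.Basis.constr_basis, parse_blockWord]

variable [CharZero K]

lemma phi_psi (k : ℕ) (c : List ℕ+ →₀ K) : phi K (psi K k c) = toWords K k c := by
  induction k generalizing c with
  | zero =>
    induction c using Finsupp.induction_linear with
    | zero => simp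
    | add f g hf hg => rw [map_add, map_add, hf, hg, map_add]
    | single l r =>
      by_cases h : l = []
      · subst h; simp [psi, phi, toWords, phiU, blockWord, word_nil]
      · simp [psi, phi, toWords, h]
  | succ k ih =>
    induction c using Finsupp.induction_linear with
    | zero => simp
    | add f g hf hg => rw [map_add, map_add, hf, hg, map_add]
    | single l r =>
      have hk : ((k : K) + 1) ≠ 0 := Nat.cast_add_one_ne_zero k
      have e : phi K ((0, Finsupp.single (some (k.succPNat, l.reverse)) 1) : V K)
          = toWords K k (raise K l) + ((k : K) + 1) • toWords K (k + 1) (Finsupp.single l 1) := by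
        rw [← shuffle_blockWord]
        simp [phi, phiU]
      have e2 : (Finsupp.single l r : List ℕ+ →₀ K) = r • Finsupp.single l 1 := by simp
      rw [e2, map_smul, map_smul, map_smul]
      congr 1
      rw [psi, LinearMap.smul_apply, map_smul, LinearMap.sub_apply, map_sub, LinearMap.comp_apply,
        Finsupp.linearCombination_single, Finsupp.linearCombination_single, ih, one_smul, one_smul,
        e, add_sub_cancel_left, smul_smul, inv_mul_cancel₀ hk, one_smul]

/-- `φ` as a linear isomorphism. -/
def phiEquiv : V K ≃ₗ[K] Kxz K :=
  LinearEquiv.ofLinearMap (phi K) (phiInv K)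
    (by
      refine (wordBasis K XZ).ext fun w => ?_
      rw [LinearMap.comp_apply, phiInv, Module.Basis.constr_basis, phi_psi, toWords,
        Finsupp.linearCombination_single, parse_spec, wordBasis_apply]
      simp)
    (by
      refine LinearMap.prod_ext (Finsupp.lhom_ext' fun l => LinearMap.ext_ring ?_)
        (Finsupp.lhom_ext' fun i => LinearMap.ext_ring ?_)
      · have e : phi K (Finsupp.single l 1, 0) = toWords K 0 (Finsupp.single l.1.reverse 1) := by
          simp [phi, toWords]
        change phiInv K (phi K (Finsupp.single l 1, 0)) = (Finsupp.single l 1, 0)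
        rw [e, phiInv_toWords]
        simp [psi, l.2]
      · change phiInv K (phi K (0, Finsupp.single i 1)) = (0, Finsupp.single i 1)
        rcases i with _ | ⟨n, l⟩
        · have e : phi K (0, Finsupp.single none 1) = toWords K 0 (Finsupp.single [] 1) := by
            simp [phi, phiU, toWords, blockWord, word_nil]
          rw [e, phiInv_toWords]
          simp [psi]
        · have hk : ((n.natPred : K) + 1) ≠ 0 := Nat.cast_add_one_ne_zero _
          have e : phi K (0, Finsupp.single (some (n, l)) 1)
              = toWords K n.natPred (raise K l.reverse) +
                ((n.natPred : K) + 1) • toWords K (n.natPred + 1) (Finsupp.single l.reverse 1) := by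
            rw [← shuffle_blockWord]
            simp [phi, phiU]
          rw [e, map_add, map_smul, phiInv_toWords, phiInv_toWords, psi, LinearMap.smul_apply,
            smul_smul, mul_inv_cancel₀ hk, one_smul, LinearMap.sub_apply, LinearMap.comp_apply,
            Finsupp.linearCombination_single, Finsupp.linearCombination_single, one_smul,
            one_smul, add_sub_cancel]
          simp)

lemma phiEquiv_apply (v : V K) : phiEquiv K v = phi K v := rfl

/-- The pullback `φ^⋆{-,-}^* = (φ⁻¹ ⊗ φ⁻¹) ∘ {-,-}^* ∘ φ` of the Ihara cobracket. -/
def pullbackCobracket : V K →ₗ[K] V K ⊗[K] V K :=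
  TensorProduct.map (phiEquiv K).symm.toLinearMap (phiEquiv K).symm.toLinearMap ∘ₗ
    iharaCobracket K ∘ₗ (phiEquiv K).toLinearMap

end Dihedral

/-! ### The dihedral Lie coalgebra -/

section D

variable (K : Type*) [Field K]

/-- The span of the coefficients of `{t₁ : ⋯ : t_{m+1}} - {-t₁ : ⋯ : -t_{m+1}}`, `m ≥ 1`
(the distribution relations for `l = -1`). -/
def distRel : Submodule K (W K) :=
  Submodule.span K {w | ∃ m : ℕ, 1 ≤ m ∧ ∃ a : Fin (m + 1) →₀ ℕ,
    w = colonSeries (gen K) (fun i : Fin m => (MvPolynomial.X i.castSucc :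
          MvPolynomial (Fin (m + 1)) K)) (MvPolynomial.X (Fin.last m)) a
      - colonSeries (gen K) (fun i : Fin m => (-MvPolynomial.X i.castSucc :
          MvPolynomial (Fin (m + 1)) K)) (-MvPolynomial.X (Fin.last m)) a}

/-- The relations of the dihedral coalgebra of the trivial group: the double shuffle relations
and the distribution relations. -/
def dihedralRel : Submodule K (W K) := Wst K ⊔ Wsh K ⊔ distRel K

/-- The space `D` underlying the dihedral Lie coalgebra of the trivial group, with generators the
symbols `I_{n₁,…,n_m}(e,…,e)`. -/
abbrev Dihedral : Type _ := W K ⧸ dihedralRel K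

/-- The generator `I_{n₁,…,n_m}(e,…,e)` of `D`. -/
def dihedralGen (l : List ℕ+) : Dihedral K := (dihedralRel K).mkQ (gen K l)

/-- Goncharov's formula for a cobracket `δ` on `D`:
`δ {t₁ : ⋯ : t_{m+1}} = -∑_{k=2}^{m} Cycle_{m+1} ({t₁ : ⋯ : t_{k-1} : t_{m+1}} ∧ {t_k : ⋯ : t_{m+1}})`
for all `m ≥ 1`. -/
def GoncharovFormula (δ : Dihedral K →ₗ[K] Dihedral K ⊗[K] Dihedral K) : Prop :=
  ∀ m : ℕ, 1 ≤ m → ∀ a : Fin (m + 1) →₀ ℕ,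
    δ (colonSeries (dihedralGen K) (fun i : Fin m => (MvPolynomial.X i.castSucc :
        MvPolynomial (Fin (m + 1)) K)) (MvPolynomial.X (Fin.last m)) a)
      = -cycleSeries K (dihedralGen K) m a

/-- `D` is a (bigraded) Lie coalgebra under Goncharov's formula. -/
def DihedralIsLieCoalgebra : Prop :=
  ∃ δ : Dihedral K →ₗ[K] Dihedral K ⊗[K] Dihedral K,
    GoncharovFormula K δ ∧
    IsBigradedLieCoalgebra (quotGrading (wGrading K) (dihedralRel K)) δ

end D

end DihedralLS

end

open DihedralLS

open scoped TensorProduct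

noncomputable section

namespace DihedralLS

/-! ### Separating families of linear forms -/

section Separation

variable {K : Type*} [Field K] {A B : Type*} [AddCommGroup A] [Module K A] [AddCommGroup B]
  [Module K B]

/-! Everything is translated into polynomial functions. The word x^{a_0} z x^{a_1} ⋯ z x^{a_m}
becomes the monomial y_0^{a_0} ⋯ y_m^{a_m}, and `ev` evaluates the resulting polynomials. In
characteristic zero an element is determined by these values (`ev_injective`), so a tensor is
determined by the products of two evaluations. The map π sets the last variable to 0 (`evY_piMap`).

For an element without depth 0 part, primitivity for Δ means two things (`primitive_iff`): its
polynomials are invariant under a common translation of all variables, and they satisfy shuffle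
relations in partial sum variables. Primitivity of π(ψ) is the shuffle relations at last variable 0
(`primitiveY_iff`). Translation invariance is the vanishing of the derivation x ↦ 1, z ↦ 0, which is
adjoint to shuffling with x; it is therefore orthogonality to the elements φ(I'(n_0,…,n_m)). The two
families of shuffle relations are the pairings with the two families of generators of W_R. Hence ls
is the orthogonal of φ(F) (`mem_ls_iff`). Conversely F is the orthogonal of ls (`mem_F_of_orth`),
because F is bigraded and only finitely many words have a given bidegree.

(C1) ⇔ (C2) is then formal: the forms defined by ls separate V/F, and the image of δ(v) in V/F ⊗
V/F, paired with a ⊗ b for a, b in ls, is ⟨φ(v), {a,b}⟩.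

(C2) ⇔ (C3) holds because the cobracket of V and the map δ̃ agree modulo F
(`map_redW_pullbackCobracket`). The summand U contributes nothing: the derivation x ↦ 1, z ↦ 0
commutes with d_a when it kills a, so {a,b} stays orthogonal to φ(U) without any hypothesis on ls.
On W, the double shuffle relations give two reversal symmetries, one in the variables themselves and
one in the partial sum variables. Their composite is a rotation, up to the sign of t ↦ -t. In even
degree this is cyclic symmetry. In odd degree it forces the polynomial to vanish in depth at least 2
(the parity theorem), and the conditions defining ls remove the odd degrees in depth 0 and 1. For
cyclically symmetric polynomials the terms of the Ihara bracket assemble into a sum over all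
rotations of the variables (`ev_ihara`), which is the cyclic sum in δ̃ (`dualDistrib_deltaTilde`).

(C3) ⇔ (C4): a distribution relation says that odd degrees vanish, so by the parity theorem it adds
to the double shuffle relations only the I(2n), and the relations of D are W_R (`dihedralRel_eq`).
Goncharov's formula then says that δ is minus the map induced by δ̃. The Ihara bracket satisfies the
Jacobi identity on all of K⟨x,z⟩, so V is a bigraded Lie coalgebra, and antisymmetry, co-Jacobi and
homogeneity pass to its quotients.

The second statement transports the structure of V/F along ε, whose injectivity and image come from
the same bigraded duality. -/

/-- If two families of linear forms separate the points of `A` and `B`, then their products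
separate the points of `A ⊗ B`. -/
theorem tensor_eq_zero_of_separating {ι κ : Type*} (S : ι → Module.Dual K A)
    (T : κ → Module.Dual K B) (hS : ∀ a, (∀ i, S i a = 0) → a = 0)
    (hT : ∀ b, (∀ j, T j b = 0) → b = 0) (x : A ⊗[K] B)
    (hx : ∀ i j, TensorProduct.dualDistrib K A B (S i ⊗ₜ[K] T j) x = 0) : x = 0 := by
  classical
  let b := Module.Basis.ofVectorSpace K B
  let e := TensorProduct.equivFinsuppOfBasisRight (M := A) b
  -- In a basis of `B` the tensor has coordinates in `A`. Pairing with f ⊗ g applies `f` to the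
  -- coordinates and `g` to the vector of `B` they then define.
  have key : ∀ (f : Module.Dual K A) (g : Module.Dual K B) (y : A ⊗[K] B),
      TensorProduct.dualDistrib K A B (f ⊗ₜ[K] g) y
        = g (b.repr.symm (Finsupp.mapRange.linearMap f (e y))) := by
    intro f g y
    induction y using TensorProduct.induction_on with
    | zero => simp
    | add y z hy hz => simp only [map_add, hy, hz]
    | tmul a c =>
      rw [TensorProduct.dualDistrib_apply]
      have h : Finsupp.mapRange.linearMap f (e (a ⊗ₜ[K] c)) = f a • b.repr c := by
        ext i
        simp [e, mul_comm]
      rw [h, map_smul, map_smul, b.repr.symm_apply_apply, smul_eq_mul]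
  apply e.injective
  rw [map_zero]
  ext i
  refine hS _ fun k => ?_
  -- The forms `T` are used first, with `k` fixed: they show that `S k` kills every coordinate,
  -- after which `S` can be applied to each coordinate.
  have h0 : b.repr.symm (Finsupp.mapRange.linearMap (S k) (e x)) = 0 :=
    hT _ fun j => by rw [← key]; exact hx k j
  have h1 : Finsupp.mapRange.linearMap (S k) (e x) = 0 := by
    apply b.repr.symm.injective
    rw [h0, map_zero]
  simpa using DFunLike.congr_fun h1 i

end Separation

/-! ### Values of series -/

section Map

variable {K : Type*} [Field K] {M N : Type*} [AddCommGroup M] [Module K M] [AddCommGroup N]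
  [Module K N] {τ : Type*}

lemma map_tmulSeries (f : M →ₗ[K] N) (g h : Series τ M) (a : τ →₀ ℕ) :
    TensorProduct.map f f (tmulSeries K g h a)
      = tmulSeries K (fun b => f (g b)) (fun b => f (h b)) a := by
  simp [tmulSeries]

lemma map_colonSeries (f : M →ₗ[K] N) (I : List ℕ+ → M) {m : ℕ} (s : Fin m → MvPolynomial τ K)
    (s₀ : MvPolynomial τ K) (a : τ →₀ ℕ) :
    f (colonSeries I s s₀ a) = colonSeries (fun l => f (I l)) s s₀ a := by
  simp [colonSeries]

end Map

section Values

variable {K : Type*} [Field K] {M N : Type*} [AddCommGroup M] [Module K M] [AddCommGroup N]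
  [Module K N] {τ : Type*} [Fintype τ] [DecidableEq τ]

/-- The value at the point `t` of the homogeneous component of degree `d` of a series. -/
def evalSeries (d : ℕ) (t : τ → K) : Series τ M →ₗ[K] M :=
  ∑ a ∈ Finset.univ.finsuppAntidiag d, (∏ i, t i ^ a i) • LinearMap.proj a

lemma evalSeries_apply (d : ℕ) (t : τ → K) (f : Series τ M) :
    evalSeries d t f = ∑ a ∈ Finset.univ.finsuppAntidiag d, (∏ i, t i ^ a i) • f a := by
  simp [evalSeries]

lemma mem_finsuppAntidiag_univ {d : ℕ} {a : τ →₀ ℕ} :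
    a ∈ (Finset.univ : Finset τ).finsuppAntidiag d ↔ a.degree = d := by
  rw [Finset.mem_finsuppAntidiag, Finsupp.degree_eq_sum]
  simp

/-- A vector-valued polynomial function that vanishes identically has zero coefficients. -/
theorem coeff_eq_zero_of_value_eq_zero [Infinite K] (s : Finset (τ →₀ ℕ)) (c : (τ →₀ ℕ) → M)
    (h : ∀ t : τ → K, ∑ a ∈ s, (∏ i, t i ^ a i) • c a = 0) {a : τ →₀ ℕ} (ha : a ∈ s) :
    c a = 0 := by
  rw [← Module.forall_dual_apply_eq_zero_iff K]
  intro f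
  have hp : (∑ b ∈ s, MvPolynomial.monomial b (f (c b)) : MvPolynomial τ K) = 0 := by
    refine MvPolynomial.funext fun t => ?_
    have := congrArg f (h t)
    rw [map_sum, map_zero] at this
    rw [map_sum, map_zero, ← this]
    refine Finset.sum_congr rfl fun b _ => ?_
    rw [MvPolynomial.eval_monomial, map_smul, smul_eq_mul, mul_comm, Finsupp.prod_fintype]
    simp
  have := congrArg (MvPolynomial.coeff a) hp
  simpa [MvPolynomial.coeff_sum, MvPolynomial.coeff_monomial, ha] using this

/-- The coefficients of one total degree form a single polynomial, so identities between series can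
be checked on values of homogeneous components. All relations below are handled in this way. -/
theorem series_eq_zero_of_value [Infinite K] (f : Series τ M)
    (h : ∀ d (t : τ → K), evalSeries d t f = 0) (a : τ →₀ ℕ) : f a = 0 := by
  refine coeff_eq_zero_of_value_eq_zero (K := K) (Finset.univ.finsuppAntidiag a.degree) f
    (fun t => ?_) (mem_finsuppAntidiag_univ.2 rfl)
  rw [← evalSeries_apply]
  exact h _ t

/-- The product of series is a Cauchy product, so values multiply; the total degree is shared
between the two factors in all ways. -/
lemma evalSeries_tmulSeries (d : ℕ) (t : τ → K) (f g : Series τ M) :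
    evalSeries d t (tmulSeries K f g)
      = ∑ p ∈ Finset.HasAntidiagonal.antidiagonal d, evalSeries p.1 t f ⊗ₜ[K] evalSeries p.2 t g := by
  simp only [evalSeries_apply, tmulSeries, TensorProduct.sum_tmul, TensorProduct.tmul_sum,
    Finset.smul_sum, Finset.sum_sigma']
  refine Finset.sum_bij' (fun x _ => ⟨(x.2.1.degree, x.2.2.degree), ⟨x.2.2, x.2.1⟩⟩)
    (fun x _ => ⟨x.2.2 + x.2.1, (x.2.2, x.2.1)⟩) ?_ ?_ ?_ ?_ ?_
  · rintro ⟨a, b, c⟩ h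
    simp only [Finset.mem_sigma, mem_finsuppAntidiag_univ,
      Finset.HasAntidiagonal.mem_antidiagonal] at h ⊢
    obtain ⟨rfl, rfl⟩ := h
    simp
  · rintro ⟨⟨i, j⟩, b, c⟩ h
    simp only [Finset.mem_sigma, mem_finsuppAntidiag_univ,
      Finset.HasAntidiagonal.mem_antidiagonal] at h ⊢
    obtain ⟨rfl, rfl, rfl⟩ := h
    simp
  · rintro ⟨a, b, c⟩ h
    simp only [Finset.mem_sigma, Finset.HasAntidiagonal.mem_antidiagonal] at h
    obtain ⟨_, rfl⟩ := h
    rfl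
  · rintro ⟨⟨i, j⟩, b, c⟩ h
    simp only [Finset.mem_sigma, mem_finsuppAntidiag_univ] at h
    obtain ⟨_, rfl, rfl⟩ := h
    rfl
  · rintro ⟨a, b, c⟩ h
    simp only [Finset.mem_sigma, Finset.HasAntidiagonal.mem_antidiagonal] at h
    obtain ⟨_, rfl⟩ := h
    simp only [TensorProduct.smul_tmul_smul, Finsupp.add_apply, pow_add, Finset.prod_mul_distrib]

/-! ### Values of generating series at lists of scalars -/

/-- `pv I d (t₁,…,t_m)` is the sum of `t₁^{n₁} ⋯ t_m^{n_m} I(n₁+1,…,n_m+1)` over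
`n₁ + ⋯ + n_m = d`. -/
def pv (I : List ℕ+ → M) (d : ℕ) : List K → M
  | [] => if d = 0 then I [] else 0
  | t :: ts => ∑ p ∈ Finset.HasAntidiagonal.antidiagonal d,
      t ^ p.1 • pv (fun l => I (p.1.succPNat :: l)) p.2 ts

lemma sum_antidiagonalTuple_succ (m d : ℕ) (F : (Fin (m + 1) → ℕ) → M) :
    ∑ n ∈ Finset.Nat.antidiagonalTuple (m + 1) d, F n
      = ∑ p ∈ Finset.HasAntidiagonal.antidiagonal d,
          ∑ n ∈ Finset.Nat.antidiagonalTuple m p.2, F (Fin.cons p.1 n) := by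
  rw [Finset.sum_sigma']
  refine Finset.sum_bij' (fun n _ => ⟨(n 0, ∑ i, Fin.tail n i), Fin.tail n⟩)
    (fun x _ => Fin.cons x.1.1 x.2) ?_ ?_ ?_ ?_ ?_
  · intro n h
    rw [Finset.Nat.mem_antidiagonalTuple, Fin.sum_univ_succ] at h
    simp [Finset.Nat.mem_antidiagonalTuple, Fin.tail, h]
  · rintro ⟨⟨i, j⟩, n⟩ h
    simp only [Finset.mem_sigma, Finset.Nat.mem_antidiagonalTuple,
      Finset.HasAntidiagonal.mem_antidiagonal] at h ⊢
    simp [Fin.sum_univ_succ, h]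
  · intro n h
    simp
  · rintro ⟨⟨i, j⟩, n⟩ h
    simp only [Finset.mem_sigma, Finset.Nat.mem_antidiagonalTuple] at h
    obtain ⟨_, rfl⟩ := h
    simp
  · intro n h
    simp

lemma pv_ofFn (I : List ℕ+ → M) (d : ℕ) {m : ℕ} (c : Fin m → K) :
    pv I d (List.ofFn c) = ∑ n ∈ Finset.Nat.antidiagonalTuple m d,
      (∏ i, c i ^ n i) • I (List.ofFn fun i => (n i).succPNat) := by
  induction m generalizing I d with
  | zero => cases d <;> simp [pv, Finset.Nat.antidiagonalTuple_zero_zero,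
      Finset.Nat.antidiagonalTuple_zero_succ]
  | succ m ih =>
    rw [sum_antidiagonalTuple_succ, List.ofFn_succ, pv]
    refine Finset.sum_congr rfl fun p _ => ?_
    rw [ih, Finset.smul_sum]
    refine Finset.sum_congr rfl fun n _ => ?_
    simp [Fin.prod_univ_succ, List.ofFn_succ, smul_smul]

lemma map_pv (f : M →ₗ[K] N) (I : List ℕ+ → M) (d : ℕ) (ts : List K) :
    f (pv I d ts) = pv (fun l => f (I l)) d ts := by
  induction ts generalizing I d with
  | nil => by_cases h : d = 0 <;> simp [pv, h]
  | cons t ts ih => simp [pv, ih]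

lemma pv_map_mul (I : List ℕ+ → M) (d : ℕ) (c : K) (ts : List K) :
    pv I d (ts.map (c * ·)) = c ^ d • pv I d ts := by
  induction ts generalizing I d with
  | nil => by_cases h : d = 0 <;> simp [pv, h]
  | cons t ts ih =>
    simp only [List.map_cons, pv, ih, Finset.smul_sum]
    refine Finset.sum_congr rfl fun p hp => ?_
    rw [Finset.HasAntidiagonal.mem_antidiagonal] at hp
    rw [smul_smul, smul_smul, ← hp]
    congr 1
    ring

/-- The degree of the monomial attached to an index. -/
def idxDegree (l : List ℕ+) : ℕ := (l.map PNat.natPred).sum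

lemma pv_eq_zero (I : List ℕ+ → M) (d : ℕ) (ts : List K)
    (h : ∀ l : List ℕ+, l.length = ts.length → idxDegree l = d → I l = 0) : pv I d ts = 0 := by
  induction ts generalizing I d with
  | nil =>
    rw [pv]
    split_ifs with hd
    · exact h [] rfl (by simp [idxDegree, hd])
    · rfl
  | cons t ts ih =>
    rw [pv]
    refine Finset.sum_eq_zero fun p hp => ?_
    rw [ih, smul_zero]
    intro l hl hd
    rw [Finset.HasAntidiagonal.mem_antidiagonal] at hp
    refine h _ (by simp [hl]) ?_
    simp only [idxDegree] at hd ⊢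
    simp [hd, hp]

/-- On lists of a fixed length, `pv I d` is a homogeneous polynomial function whose coefficients are
the `I l` of that length and of degree `d`. -/
theorem eq_zero_of_pv [Infinite K] (I : List ℕ+ → M) (h : ∀ d (ts : List K), pv I d ts = 0)
    (l : List ℕ+) : I l = 0 := by
  have h1 : ∀ t : Fin l.length → K, ∑ a ∈ Finset.univ.finsuppAntidiag (idxDegree l),
      (∏ i, t i ^ a i) • I (List.ofFn fun i => (a i).succPNat) = 0 := by
    intro t
    rw [← h (idxDegree l) (List.ofFn t), pv_ofFn]
    refine Finset.sum_bij' (fun a _ => a) (fun n _ => Finsupp.equivFunOnFinite.symm n) ?_ ?_ ?_ ?_ ?_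
    · intro a ha
      rw [mem_finsuppAntidiag_univ, Finsupp.degree_eq_sum] at ha
      simpa [Finset.Nat.mem_antidiagonalTuple] using ha
    · intro n hn
      rw [Finset.Nat.mem_antidiagonalTuple] at hn
      rw [mem_finsuppAntidiag_univ, Finsupp.degree_eq_sum]
      simpa using hn
    · intro a _; ext; simp
    · intro a _; ext; simp
    · intro a _; rfl
  have h2 := coeff_eq_zero_of_value_eq_zero (K := K) _
    (fun a : Fin l.length →₀ ℕ => I (List.ofFn fun i => (a i).succPNat)) h1
    (a := Finsupp.equivFunOnFinite.symm fun i => (l.get i).natPred) (by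
      rw [mem_finsuppAntidiag_univ, Finsupp.degree_eq_sum, idxDegree]
      simp only [Finsupp.equivFunOnFinite_symm_apply_apply]
      rw [← List.sum_ofFn]
      congr 1
      conv_rhs => rw [← List.ofFn_get l, List.map_ofFn]
      rfl)
  rw [← h2]
  congr 1
  conv_lhs => rw [← List.ofFn_get l]
  simp

/-- A product of powers of linear forms is homogeneous of degree the sum of the exponents. The
degree `d` part of the series thus involves exactly the exponent tuples of sum `d`, and its value is
the product of the values of the forms. -/
lemma evalSeries_colonSeries (I : List ℕ+ → M) (d : ℕ) (t : τ → K) {m : ℕ}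
    (s : Fin m → MvPolynomial τ K) (s₀ : MvPolynomial τ K) (hs : ∀ i, (s i).IsHomogeneous 1)
    (hs₀ : s₀.IsHomogeneous 1) :
    evalSeries d t (colonSeries I s s₀)
      = pv I d (List.ofFn fun i => MvPolynomial.eval t (s i) - MvPolynomial.eval t s₀) := by
  rw [pv_ofFn, evalSeries_apply]
  have h1 : ∀ a ∈ (Finset.univ : Finset τ).finsuppAntidiag d,
      (∏ i, t i ^ a i) • colonSeries I s s₀ a
        = ∑ n ∈ Finset.Nat.antidiagonalTuple m d,
          ((∏ i, t i ^ a i) * MvPolynomial.coeff a (∏ i, (s i - s₀) ^ n i)) •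
            I (List.ofFn fun i => (n i).succPNat) := by
    intro a ha
    rw [mem_finsuppAntidiag_univ] at ha
    rw [colonSeries, Finset.smul_sum, ha]
    simp only [smul_smul]
  rw [Finset.sum_congr rfl h1, Finset.sum_comm]
  refine Finset.sum_congr rfl fun n hn => ?_
  rw [← Finset.sum_smul]
  congr 1
  have hom : (∏ i, (s i - s₀) ^ n i).IsHomogeneous d := by
    rw [Finset.Nat.mem_antidiagonalTuple] at hn
    rw [← hn]
    refine MvPolynomial.IsHomogeneous.prod _ _ _ fun i _ => ?_
    simpa using ((hs i).sub hs₀).pow (n i)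
  have he : ∏ i, (MvPolynomial.eval t (s i) - MvPolynomial.eval t s₀) ^ n i
      = MvPolynomial.eval t (∏ i, (s i - s₀) ^ n i) := by simp
  rw [he, MvPolynomial.eval_eq']
  symm
  rw [Finset.sum_subset (s₂ := (Finset.univ : Finset τ).finsuppAntidiag d)]
  · exact Finset.sum_congr rfl fun a _ => mul_comm _ _
  · intro a ha
    rw [mem_finsuppAntidiag_univ]
    rw [MvPolynomial.mem_support_iff] at ha
    have := hom ha
    rw [Finsupp.degree_eq_weight_one]
    exact this
  · intro a _ ha
    rw [MvPolynomial.notMem_support_iff.1 ha, zero_mul]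

end Values

/-! ### Sums over shuffles -/

section Shuffle

variable {α M : Type*} [AddCommGroup M]

/-- The sum of the values of `g` over the shuffles of two lists. -/
def shSum (g : List α → M) : List α → List α → M
  | [], v => g v
  | a :: u, [] => g (a :: u)
  | a :: u, b :: v => shSum (fun l => g (a :: l)) u (b :: v) + shSum (fun l => g (b :: l)) (a :: u) v
  termination_by u v => u.length + v.length

lemma shSum_nil_left (g : List α → M) (v : List α) : shSum g [] v = g v := by
  rw [shSum]

lemma shSum_nil_right (g : List α → M) (u : List α) : shSum g u [] = g u := by
  cases u <;> rw [shSum]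

lemma shSum_cons (g : List α → M) (a b : α) (u v : List α) :
    shSum g (a :: u) (b :: v)
      = shSum (fun l => g (a :: l)) u (b :: v) + shSum (fun l => g (b :: l)) (a :: u) v := by
  rw [shSum]

/-- Induction along the recursion that defines `shSum`. -/
theorem shuffle_induction {P : List α → List α → Prop} (hl : ∀ v, P [] v) (hr : ∀ u, P u [])
    (hc : ∀ a b u v, P u (b :: v) → P (a :: u) v → P (a :: u) (b :: v)) (u v : List α) : P u v := by
  induction u generalizing v with
  | nil => exact hl v
  | cons a u ih =>
    induction v with
    | nil => exact hr _
    | cons b v ihv => exact hc a b u v (ih _) ihv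

lemma shSum_congr {g h : List α → M} {u v : List α}
    (H : ∀ l, l.Perm (u ++ v) → g l = h l) : shSum g u v = shSum h u v := by
  induction u, v using shuffle_induction generalizing g h with
  | hl v => simpa [shSum_nil_left] using H v (by simp)
  | hr u => simpa [shSum_nil_right] using H u (by simp)
  | hc a b u v ih₁ ih₂ =>
    rw [shSum_cons, shSum_cons, ih₁ (h := fun l => h (a :: l)), ih₂ (h := fun l => h (b :: l))]
    · intro l hl
      exact H _ ((hl.cons b).trans List.perm_middle.symm)
    · intro l hl
      exact H _ (hl.cons a)

lemma shSum_zero (u v : List α) : shSum (fun _ => (0 : M)) u v = 0 := by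
  induction u, v using shuffle_induction with
  | hl v => rw [shSum_nil_left]
  | hr u => rw [shSum_nil_right]
  | hc a b u v ih₁ ih₂ => rw [shSum_cons, ih₁, ih₂, add_zero]

lemma shSum_eq_zero {g : List α → M} {u v : List α} (H : ∀ l, l.Perm (u ++ v) → g l = 0) :
    shSum g u v = 0 := by
  rw [shSum_congr H, shSum_zero]

lemma shSum_sum {ι : Type*} (s : Finset ι) (g : ι → List α → M) (u v : List α) :
    shSum (fun l => ∑ i ∈ s, g i l) u v = ∑ i ∈ s, shSum (g i) u v := by
  induction u, v using shuffle_induction generalizing g with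
  | hl v => simp [shSum_nil_left]
  | hr u => simp [shSum_nil_right]
  | hc a b u v ih₁ ih₂ => simp [shSum_cons, ih₁, ih₂, Finset.sum_add_distrib]

lemma shSum_add (g h : List α → M) (u v : List α) :
    shSum (g + h) u v = shSum g u v + shSum h u v := by
  have := shSum_sum Finset.univ ![g, h] u v
  simp only [Fin.sum_univ_two, Matrix.cons_val_zero, Matrix.cons_val_one] at this
  exact this

lemma shSum_smul {K : Type*} [Field K] [Module K M] (c : K) (g : List α → M) (u v : List α) :
    shSum (fun l => c • g l) u v = c • shSum g u v := by
  induction u, v using shuffle_induction generalizing g with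
  | hl v => simp [shSum_nil_left]
  | hr u => simp [shSum_nil_right]
  | hc a b u v ih₁ ih₂ => simp [shSum_cons, ih₁, ih₂]

lemma shSum_map {β : Type*} (f : α → β) (g : List β → M) (u v : List α) :
    shSum (fun l => g (l.map f)) u v = shSum g (u.map f) (v.map f) := by
  induction u, v using shuffle_induction generalizing g with
  | hl v => simp [shSum_nil_left]
  | hr u => simp [shSum_nil_right]
  | hc a b u v ih₁ ih₂ =>
    simp only [List.map_cons, shSum_cons]
    rw [ih₁ (fun l => g (f a :: l)), ih₂ (fun l => g (f b :: l))]
    rfl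

/-- A shuffle ends with the last letter of one of the two lists: this is the recursion of `shSum`
read from the right, and it gives compatibility with reversal. -/
lemma shSum_append_singleton (g : List α → M) (a b : α) (u v : List α) :
    shSum g (u ++ [a]) (v ++ [b])
      = shSum (fun l => g (l ++ [a])) u (v ++ [b]) + shSum (fun l => g (l ++ [b])) (u ++ [a]) v := by
  induction u, v using shuffle_induction generalizing g with
  | hl v =>
    induction v generalizing g with
    | nil => simp [shSum_nil_left, shSum_nil_right, shSum_cons, add_comm]
    | cons c v ih =>
      simp only [List.nil_append, List.cons_append, shSum_cons, shSum_nil_left] at ih ⊢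
      rw [ih]
      abel
  | hr u =>
    induction u generalizing g with
    | nil => simp [shSum_nil_left, shSum_nil_right, shSum_cons, add_comm]
    | cons c u ih =>
      simp only [List.nil_append, List.cons_append, shSum_cons, shSum_nil_right] at ih ⊢
      rw [ih]
      abel
  | hc c d u v ih₁ ih₂ =>
    simp only [List.cons_append, shSum_cons] at ih₁ ih₂ ⊢
    rw [ih₁, ih₂]
    abel

lemma shSum_reverse (g : List α → M) (u v : List α) :
    shSum (fun l => g l.reverse) u v = shSum g u.reverse v.reverse := by
  induction u, v using shuffle_induction generalizing g with
  | hl v => simp [shSum_nil_left]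
  | hr u => simp [shSum_nil_right]
  | hc a b u v ih₁ ih₂ =>
    simp only [List.reverse_cons, shSum_cons, shSum_append_singleton]
    rw [ih₁ (fun l => g (l ++ [a])), ih₂ (fun l => g (l ++ [b]))]
    simp

/-- Modulo shuffles, reversal of a list is multiplication by a sign. -/
lemma shSum_antipode (g : List α → M) {n : ℕ}
    (H : ∀ u v, u ≠ [] → v ≠ [] → u.length + v.length = n → shSum g u v = 0) (a : α)
    (r v : List α) (hn : r.length + v.length + 1 = n) :
    shSum (fun l => g (a :: l)) r v = (-1 : ℤ) ^ v.length • g (v.reverse ++ a :: r) := by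
  induction v generalizing a r with
  | nil => simp [shSum_nil_right]
  | cons b v ih =>
    -- In the vanishing sum over the shuffles of `a :: r` and `b :: v`, those beginning with `a` are
    -- opposite to those beginning with `b`. The latter have the same shape with `v` shorter, so
    -- letters of `v` move across one at a time, each with a sign.
    have h := H (a :: r) (b :: v) (by simp) (by simp) (by simp at hn ⊢; omega)
    rw [shSum_cons, ih b (a :: r) (by simp at hn ⊢; omega)] at h
    rw [eq_neg_of_add_eq_zero_left h]
    simp [pow_succ]

/-- The case of `shSum_antipode` in which the list to the right of the moving letter is empty. -/
theorem reverse_of_shSum_eq_zero (g : List α → M) {n : ℕ}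
    (H : ∀ u v, u ≠ [] → v ≠ [] → u.length + v.length = n + 1 → shSum g u v = 0) (l : List α)
    (hl : l.length = n + 1) : g l = (-1 : ℤ) ^ n • g l.reverse := by
  obtain ⟨a, v, rfl⟩ : ∃ a v, l = a :: v := by
    cases l with
    | nil => simp at hl
    | cons a v => exact ⟨a, v, rfl⟩
  have := shSum_antipode g H a [] v (by simpa using hl)
  rw [shSum_nil_left] at this
  rw [this, List.reverse_cons]
  simp at hl
  rw [hl]

lemma shSum_singleton_append (g : List α → M) (a c : α) (v : List α) :
    shSum g [a] (v ++ [c]) = shSum (fun l => g (l ++ [c])) [a] v + g (v ++ [c, a]) := by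
  have := shSum_append_singleton g a c [] v
  simpa [shSum_nil_left, add_comm] using this

end Shuffle

/-! ### Shuffle permutations -/

section Perm

variable {α M : Type*} [AddCommGroup M] {n : ℕ}

/-- The permutation that sends `k` to `0` and is `τ` on the complements of these points. -/
def insPerm (k : Fin (n + 1)) (τ : Equiv.Perm (Fin n)) : Equiv.Perm (Fin (n + 1)) :=
  (finSuccEquiv' k).trans ((Equiv.optionCongr τ).trans (finSuccEquiv' 0).symm)

lemma insPerm_self (k : Fin (n + 1)) (τ : Equiv.Perm (Fin n)) : insPerm k τ k = 0 := by
  simp [insPerm]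

lemma insPerm_succAbove (k : Fin (n + 1)) (τ : Equiv.Perm (Fin n)) (i : Fin n) :
    insPerm k τ (k.succAbove i) = (τ i).succ := by
  simp [insPerm]

lemma insPerm_symm_zero (k : Fin (n + 1)) (τ : Equiv.Perm (Fin n)) :
    (insPerm k τ).symm 0 = k := by
  rw [Equiv.symm_apply_eq, insPerm_self]

lemma insPerm_symm_succ (k : Fin (n + 1)) (τ : Equiv.Perm (Fin n)) (i : Fin n) :
    (insPerm k τ).symm i.succ = k.succAbove (τ.symm i) := by
  rw [Equiv.symm_apply_eq, insPerm_succAbove, Equiv.apply_symm_apply]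

/-- Injectivity, since the preimage of 0 recovers `k`, together with the count (n+1)! = (n+1) · n!.
-/
lemma insPerm_bijective :
    Function.Bijective fun x : Fin (n + 1) × Equiv.Perm (Fin n) => insPerm x.1 x.2 := by
  rw [Fintype.bijective_iff_injective_and_card]
  refine ⟨?_, by simp [Fintype.card_perm, Nat.factorial_succ]⟩
  rintro ⟨k, τ⟩ ⟨k', τ'⟩ h
  simp only at h
  have hk : k = k' := by rw [← insPerm_symm_zero k τ, h, insPerm_symm_zero]
  subst hk
  refine Prod.ext rfl (Equiv.ext fun i => ?_)
  have := insPerm_succAbove k τ i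
  rw [h, insPerm_succAbove] at this
  exact (Fin.succ_injective _ this).symm

/-- `σ` is increasing on `{i | i < p}` and on `{i | p ≤ i}`. -/
def IsShuffle (p : ℕ) (σ : Equiv.Perm (Fin n)) : Prop :=
  (∀ i j : Fin n, i < j → (j : ℕ) < p → σ i < σ j) ∧
    (∀ i j : Fin n, p ≤ (i : ℕ) → i < j → σ i < σ j)

lemma eq_one_of_strictMono (σ : Equiv.Perm (Fin n)) (h : StrictMono σ) : σ = 1 := by
  have : h.orderIsoOfSurjective σ σ.surjective = OrderIso.refl (Fin n) := Subsingleton.elim _ _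
  ext i
  exact congrArg (fun e : Fin n ≃o Fin n => ((e i : Fin n) : ℕ)) this

lemma isShuffle_zero (σ : Equiv.Perm (Fin n)) : IsShuffle 0 σ ↔ σ = 1 := by
  constructor
  · intro h
    exact eq_one_of_strictMono σ fun i j hij => h.2 i j (Nat.zero_le _) hij
  · rintro rfl
    exact ⟨fun i j h _ => h, fun i j _ h => h⟩

lemma isShuffle_self (σ : Equiv.Perm (Fin n)) : IsShuffle n σ ↔ σ = 1 := by
  constructor
  · intro h
    exact eq_one_of_strictMono σ fun i j hij => h.1 i j hij j.2
  · rintro rfl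
    exact ⟨fun i j h _ => h, fun i j _ h => h⟩

/-- Removing the first point of the first block shortens that block by one. -/
lemma isShuffle_insPerm_zero (p : ℕ) (τ : Equiv.Perm (Fin n)) :
    IsShuffle (p + 1) (insPerm 0 τ) ↔ IsShuffle p τ := by
  have hs : ∀ i : Fin n, insPerm 0 τ i.succ = (τ i).succ := fun i => by
    simpa using insPerm_succAbove 0 τ i
  constructor
  · rintro ⟨h₁, h₂⟩
    refine ⟨fun i j hij hj => ?_, fun i j hi hij => ?_⟩
    · have := h₁ i.succ j.succ (by simpa using hij) (by simpa using hj)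
      simpa [hs] using this
    · have := h₂ i.succ j.succ (by simpa using hi) (by simpa using hij)
      simpa [hs] using this
  · rintro ⟨h₁, h₂⟩
    refine ⟨fun i j hij hj => ?_, fun i j hi hij => ?_⟩
    · induction j using Fin.cases with
      | zero => simp at hij
      | succ j =>
        induction i using Fin.cases with
        | zero => rw [insPerm_self, hs]; exact Fin.succ_pos _
        | succ i =>
          have := h₁ i j (by simpa using hij) (by simpa using hj)
          simpa [hs] using this
    · induction j using Fin.cases with
      | zero => simp at hij
      | succ j =>
        induction i using Fin.cases with
        | zero => simp at hi
        | succ i =>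
          have := h₂ i j (by simpa using hi) (by simpa using hij)
          simpa [hs] using this

/-- Removing the first point of the second block leaves the boundary between the blocks at `p`. -/
lemma isShuffle_insPerm_middle (p : ℕ) (hp : p < n + 1) (τ : Equiv.Perm (Fin n)) :
    IsShuffle p (insPerm ⟨p, hp⟩ τ) ↔ IsShuffle p τ := by
  set k : Fin (n + 1) := ⟨p, hp⟩ with hk
  have hs := insPerm_succAbove k τ
  have hlt : ∀ i : Fin n, ((k.succAbove i : Fin (n + 1)) : ℕ) < p ↔ (i : ℕ) < p := by
    intro i
    simp only [Fin.succAbove, hk, Fin.lt_def, Fin.val_castSucc]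
    split_ifs with h
    · simp
    · simp; omega
  have hmono : ∀ i j : Fin n, k.succAbove i < k.succAbove j ↔ i < j := fun i j =>
    Fin.succAbove_lt_succAbove_iff
  constructor
  · rintro ⟨h₁, h₂⟩
    refine ⟨fun i j hij hj => ?_, fun i j hi hij => ?_⟩
    · have := h₁ _ _ ((hmono i j).2 hij) ((hlt j).2 hj)
      simpa [hs] using this
    · have := h₂ _ _ (not_lt.1 fun h => absurd ((hlt i).1 h) (not_lt.2 hi)) ((hmono i j).2 hij)
      simpa [hs] using this
  · rintro ⟨h₁, h₂⟩
    refine ⟨fun i j hij hj => ?_, fun i j hi hij => ?_⟩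
    · have hj' : j ≠ k := by rintro rfl; simp [hk] at hj
      have hi' : i ≠ k := by rintro rfl; simp [hk, Fin.lt_def] at hij hj; omega
      obtain ⟨i, rfl⟩ := Fin.exists_succAbove_eq hi'
      obtain ⟨j, rfl⟩ := Fin.exists_succAbove_eq hj'
      have := h₁ i j ((hmono i j).1 hij) ((hlt j).1 hj)
      simpa [hs] using this
    · have hj' : j ≠ k := by rintro rfl; simp [hk, Fin.lt_def] at hij hi; omega
      obtain ⟨j, rfl⟩ := Fin.exists_succAbove_eq hj'
      by_cases hi' : i = k
      · subst hi'
        rw [insPerm_self, hs]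
        exact Fin.succ_pos _
      · obtain ⟨i, rfl⟩ := Fin.exists_succAbove_eq hi'
        have := h₂ i j (not_lt.1 fun h => absurd ((hlt i).2 h) (not_lt.2 hi)) ((hmono i j).1 hij)
        simpa [hs] using this

/-- A shuffle is increasing on each block, so the point that it sends to 0 is the first point of a
block. -/
lemma eq_zero_or_eq_of_isShuffle (p : ℕ) (hp : p < n + 1) (k : Fin (n + 1))
    (τ : Equiv.Perm (Fin n)) (h : IsShuffle p (insPerm k τ)) : k = 0 ∨ k = ⟨p, hp⟩ := by
  by_contra hk
  push Not at hk
  rcases lt_or_ge (k : ℕ) p with h' | h'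
  · have := h.1 0 k (Fin.pos_of_ne_zero hk.1) h'
    rw [insPerm_self] at this
    exact absurd this (Fin.not_lt_zero _)
  · have := h.2 ⟨p, hp⟩ k le_rfl (lt_of_le_of_ne (by simpa [Fin.le_def] using h') hk.2.symm)
    rw [insPerm_self] at this
    exact absurd this (Fin.not_lt_zero _)

lemma ofFn_insPerm (t : Fin (n + 1) → α) (k : Fin (n + 1)) (τ : Equiv.Perm (Fin n)) :
    List.ofFn (fun i => t ((insPerm k τ).symm i))
      = t k :: List.ofFn (fun i => t (k.succAbove (τ.symm i))) := by
  rw [List.ofFn_succ, insPerm_symm_zero]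
  simp only [insPerm_symm_succ]

lemma ofFn_succAbove (t : Fin (n + 1) → α) (k : Fin (n + 1)) :
    List.ofFn (fun i => t (k.succAbove i)) = (List.ofFn t).eraseIdx k := by
  apply List.ext_getElem
  · rw [List.length_eraseIdx]
    have := k.2
    simp
    omega
  · intro i h₁ h₂
    rw [List.getElem_eraseIdx]
    simp only [List.getElem_ofFn, Fin.succAbove, Fin.lt_def, Fin.val_castSucc]
    split_ifs <;> rfl

-- Shuffles are sorted by σ⁻¹(0), the position of the first letter of the shuffled list. It is 0 or
-- `p`, and deleting it leaves a smaller shuffle; this is the recursion that defines `shSum`.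
open Classical in
theorem sum_isShuffle (p : ℕ) (hp : p ≤ n) (t : Fin n → α) (g : List α → M) :
    ∑ σ : Equiv.Perm (Fin n) with IsShuffle p σ, g (List.ofFn fun i => t (σ.symm i))
      = shSum g ((List.ofFn t).take p) ((List.ofFn t).drop p) := by
  induction n generalizing p g with
  | zero =>
    obtain rfl : p = 0 := by omega
    simp [isShuffle_zero, Finset.filter_eq', shSum_nil_left]
  | succ n ih =>
    rcases Nat.eq_zero_or_pos p with rfl | hp0
    · simp only [isShuffle_zero, Finset.filter_eq', Finset.mem_univ, if_true, Finset.sum_singleton,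
        List.take_zero, List.drop_zero, shSum_nil_left]
      rfl
    rcases hp.eq_or_lt with rfl | hpn
    · simp only [isShuffle_self, Finset.filter_eq', Finset.mem_univ, if_true, Finset.sum_singleton]
      rw [List.take_of_length_le (by simp), List.drop_of_length_le (by simp), shSum_nil_right]
      rfl
    obtain ⟨p, rfl⟩ : ∃ p', p = p' + 1 := ⟨p - 1, by omega⟩
    rw [Finset.sum_filter, ← insPerm_bijective.sum_comp, Fintype.sum_prod_type,
      Fintype.sum_eq_add (0 : Fin (n + 1)) ⟨p + 1, hpn⟩ (by simp [Fin.ext_iff])]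
    · simp only [isShuffle_insPerm_zero, isShuffle_insPerm_middle, ← Finset.sum_filter,
        ofFn_insPerm]
      rw [ih p (by omega) (fun i => t ((0 : Fin (n + 1)).succAbove i)) (fun l => g (t 0 :: l)),
        ih (p + 1) (by omega) (fun i => t (Fin.succAbove ⟨p + 1, hpn⟩ i))
          (fun l => g (t ⟨p + 1, hpn⟩ :: l)), ofFn_succAbove, ofFn_succAbove]
      have hd : (List.ofFn t).drop (p + 1) = t ⟨p + 1, hpn⟩ :: (List.ofFn t).drop (p + 2) := by
        rw [List.drop_eq_getElem_cons (by simpa using hpn)]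
        simp
      have hd' : ((List.ofFn t).eraseIdx (p + 1)).drop (p + 1) = (List.ofFn t).drop (p + 2) := by
        rw [List.eraseIdx_eq_take_drop_succ, List.drop_left']
        simp; omega
      have ht' : ((List.ofFn t).eraseIdx (p + 1)).take (p + 1) = (List.ofFn t).take (p + 1) := by
        rw [List.eraseIdx_eq_take_drop_succ, List.take_left']
        simp; omega
      simp only [hd, hd', ht']
      rw [List.ofFn_succ, Fin.val_zero, List.eraseIdx_cons_zero, List.take_succ_cons, shSum_cons,
        List.drop_succ_cons]
      rw [List.ofFn_succ, List.drop_succ_cons] at hd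
      rw [hd]
      simp
    · rintro k ⟨h₁, h₂⟩
      refine Finset.sum_eq_zero fun τ _ => if_neg fun h => ?_
      rcases eq_zero_or_eq_of_isShuffle _ hpn k τ h with h | h
      · exact h₁ h
      · exact h₂ h

theorem sum_shuffles (p q : ℕ) (t : Fin (p + q) → α) (g : List α → M) :
    ∑ σ ∈ shuffles p q, g (List.ofFn fun i => t (σ.symm i))
      = shSum g ((List.ofFn t).take p) ((List.ofFn t).drop p) := by
  classical
  rw [← sum_isShuffle p (by omega)]
  refine Finset.sum_congr ?_ fun _ _ => rfl
  ext σ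
  rw [shuffles, Finset.mem_filter, Finset.mem_filter]
  rfl

end Perm

/-! ### Dihedral symmetry -/

section Symmetry

variable {K : Type*} [Field K]

/-- The list of the sums `c + t₁ + ⋯ + t_i`. -/
def psumFrom (c : K) : List K → List K
  | [] => []
  | t :: ts => (c + t) :: psumFrom (c + t) ts

/-- The list of partial sums. -/
def psum (l : List K) : List K := psumFrom 0 l

lemma psumFrom_append (c : K) (u v : List K) :
    psumFrom c (u ++ v) = psumFrom c u ++ psumFrom (c + u.sum) v := by
  induction u generalizing c with
  | nil => simp [psumFrom]
  | cons t u ih => simp [psumFrom, ih, add_assoc]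

lemma length_psumFrom (c : K) (u : List K) : (psumFrom c u).length = u.length := by
  induction u generalizing c with
  | nil => rfl
  | cons t u ih => simp [psumFrom, ih]

lemma exists_psumFrom_eq (c : K) (l : List K) : ∃ u, psumFrom c u = l := by
  induction l generalizing c with
  | nil => exact ⟨[], rfl⟩
  | cons a l ih =>
    obtain ⟨u, hu⟩ := ih a
    exact ⟨(a - c) :: u, by simp [psumFrom, hu]⟩

/-- The partial sums of the reversed list are the total minus the original partial sums, read
backwards. The start `c` cancels; it is kept free for the induction. -/
lemma psumFrom_reverse (c : K) (u : List K) (t : K) :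
    psum (t :: u.reverse)
      = ((t + u.sum) :: (psumFrom c u).map fun s => c + u.sum + t - s).reverse := by
  induction u generalizing c with
  | nil => simp [psum, psumFrom]
  | cons a u ih =>
    have h := ih (c + a)
    rw [List.reverse_cons, ← List.cons_append, psum, psumFrom_append, ← psum, h]
    rw [psumFrom, psumFrom, psumFrom, List.map_cons, List.sum_cons, List.sum_cons,
      List.sum_reverse]
    ring_nf
    simp

lemma psum_ofFn {m : ℕ} (s : Fin m → K) :
    psum (List.ofFn s) = List.ofFn fun i => ∑ j ∈ Finset.Iic i, s j := by
  have key : ∀ (c : K), psumFrom c (List.ofFn s)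
      = List.ofFn fun i => c + ∑ j ∈ Finset.Iic i, s j := by
    induction m with
    | zero => simp [psumFrom]
    | succ m ih =>
      intro c
      rw [List.ofFn_succ, List.ofFn_succ, psumFrom, ih]
      congr 1
      · congr 1
        rw [show Finset.Iic (0 : Fin (m + 1)) = {0} by ext i; simp]
        simp
      · congr 1
        funext i
        rw [add_assoc]
        congr 1
        have e : Finset.Iic i.succ = insert 0 ((Finset.Iic i).map (Fin.succEmb m)) := by
          ext j
          refine Fin.cases ?_ (fun j => ?_) j <;> simp
        rw [e, Finset.sum_insert (by simp), Finset.sum_map]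
        rfl
  have := key 0
  simpa [psum] using this

variable {M : Type*} [AddCommGroup M] (g : List K → M)

/-- Each shuffle relation makes a reversal act by a sign depending only on the length: one on the
variables, the other on their successive differences. The signs cancel in the composite of the two
reversals, which is the substitution shown. -/
theorem cyclic_of_double_shuffle
    (hst : ∀ u v, u ≠ [] → v ≠ [] → shSum g u v = 0)
    (hsh : ∀ u v, u ≠ [] → v ≠ [] → shSum (fun l => g (psum l)) u v = 0)
    (ss : List K) (T : K) : g (ss ++ [T]) = g (T :: ss.map fun s => T - s) := by
  obtain ⟨u, rfl⟩ := exists_psumFrom_eq 0 ss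
  have e : psumFrom 0 u ++ [T] = psum (u ++ [T - u.sum]) := by
    simp [psum, psumFrom_append, psumFrom]
  have h1 := reverse_of_shSum_eq_zero (fun l => g (psum l)) (n := u.length)
    (fun u v hu hv _ => hsh u v hu hv) (u ++ [T - u.sum]) (by simp)
  have h2 := reverse_of_shSum_eq_zero g (n := u.length)
    (fun u v hu hv _ => hst u v hu hv) (T :: (psumFrom 0 u).map fun s => T - s)
    (by simp [length_psumFrom])
  rw [e, h1, h2, List.reverse_append, List.reverse_singleton, List.singleton_append,
    psumFrom_reverse 0]
  simp

variable [Module K M]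

/-- The cyclic symmetry, up to the sign that comes from `t ↦ -t`. -/
theorem cyclic_of_double_shuffle' (ε : K)
    (hst : ∀ u v, u ≠ [] → v ≠ [] → shSum g u v = 0)
    (hsh : ∀ u v, u ≠ [] → v ≠ [] → shSum (fun l => g (psum l)) u v = 0)
    (hε : ∀ l, g (l.map fun s => -s) = ε • g l) (ts : List K) (a c : K) :
    g ((ts ++ [c]).map (· - a)) = ε • g ((a :: ts).map (· - c)) := by
  rw [← hε, List.map_append, List.map_singleton, cyclic_of_double_shuffle g hst hsh]
  simp [Function.comp_def]

/-- The parity theorem: in depth at least two, the double shuffle relations annihilate the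
components of odd degree. -/
theorem parity_of_double_shuffle [CharZero K]
    (hst : ∀ u v, u ≠ [] → v ≠ [] → shSum g u v = 0)
    (hsh : ∀ u v, u ≠ [] → v ≠ [] → shSum (fun l => g (psum l)) u v = 0)
    (hε : ∀ l, g (l.map fun s => -s) = -g l) (a b : K) (v : List K) : g (a :: b :: v) = 0 := by
  have hε' : ∀ l, g (l.map fun s => -s) = (-1 : K) • g l := fun l => by simp [hε]
  have cyc := cyclic_of_double_shuffle' g (-1) hst hsh hε'
  -- Two shuffle relations for the same cyclic configuration a, b, v, 0: one with base point 0, the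
  -- other with base point `b`. In degree of odd sign a rotation costs a factor -1, so on adding
  -- them the sums over the shuffles of `a` into `v` cancel.
  have h1 : shSum (fun l => g (l.map (· - 0))) [a] (b :: v) = 0 := by
    rw [shSum_map (· - 0) g]
    exact hst _ _ (by simp) (by simp)
  have h2 : shSum (fun l => g (l.map (· - b))) [a] (v ++ [0]) = 0 := by
    rw [shSum_map (· - b) g]
    exact hst _ _ (by simp) (by simp)
  rw [shSum_cons, shSum_nil_left] at h1
  rw [shSum_singleton_append] at h2
  have h3 : shSum (fun l => g ((l ++ [0]).map (· - b))) [a] v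
      = -shSum (fun l => g ((b :: l).map (· - 0))) [a] v := by
    rw [← neg_one_smul K, ← shSum_smul]
    congr 1
    funext l
    exact cyc l b 0
  -- Two successive rotations, with base point passing from b to a to 0, so that the signs cancel.
  -- The remaining terms of the two relations are therefore equal instead of opposite.
  have h4 : g ((v ++ [0, a]).map (· - b)) = g ((a :: b :: v).map (· - 0)) := by
    have e1 := cyc (v ++ [0]) b a
    have e2 := cyc (b :: v) a 0
    rw [List.append_assoc] at e1
    rw [List.cons_append] at e2
    rw [show v ++ [0, a] = v ++ ([0] ++ [a]) from rfl, e1, e2]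
    simp
  rw [h3, h4] at h2
  have h5 : (2 : K) • g ((a :: b :: v).map (· - 0)) = 0 := by
    rw [two_smul]
    have := congrArg₂ (· + ·) h1 h2
    simp only [add_zero] at this
    rw [← this]
    abel
  simpa using h5

end Symmetry

/-! ### Values of noncommutative polynomials -/

section Eval

variable {R : Type*} [CommRing R]

/-- The value at `(y₀,…,y_m)` of the monomial `y₀^{a₀} ⋯ y_m^{a_m}` attached to the word
`x^{a₀} z x^{a₁} ⋯ z x^{a_m}`. -/
def mon : List XZ → List R → R
  | [], Y => if Y.length = 1 then 1 else 0
  | XZ.x :: w, Y => Y.headD 0 * mon w Y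
  | XZ.z :: w, Y => mon w Y.tail

lemma mon_nil_right (w : List XZ) : mon w ([] : List R) = 0 := by
  induction w with
  | nil => simp [mon]
  | cons a w ih => cases a <;> simp [mon, ih]

lemma map_mon {S : Type*} [CommRing S] (f : R →+* S) (w : List XZ) (Y : List R) :
    f (mon w Y) = mon w (Y.map f) := by
  induction w generalizing Y with
  | nil => by_cases h : Y.length = 1 <;> simp [mon, h]
  | cons a w ih =>
    cases a
    · cases Y <;> simp [mon, ih, mon_nil_right]
    · simp [mon, ih, List.map_tail]

/-- A final `z` opens one more block, which is empty, so the variable attached to it does not occur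
in the monomial. -/
lemma mon_append_z (w : List XZ) (Y : List R) (c : R) :
    mon (w ++ [XZ.z]) (Y ++ [c]) = mon w Y := by
  cases Y with
  | nil =>
    rw [mon_nil_right]
    induction w with
    | nil => simp [mon]
    | cons a w ih => cases a <;> simp_all [mon, mon_nil_right]
  | cons y Y =>
    induction w generalizing y Y with
    | nil => simp [mon]
    | cons a w ih =>
      cases a
      · have := ih y Y
        simp only [List.cons_append, mon, List.headD_cons] at this ⊢
        rw [this]
      · cases Y with
        | nil =>
          simp only [List.cons_append, mon, List.tail_cons, List.nil_append, mon_nil_right]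
          clear ih
          induction w with
          | nil => simp [mon]
          | cons a w ih => cases a <;> simp_all [mon, mon_nil_right]
        | cons y' Y => simpa [mon] using ih y' Y

lemma mon_eq_zero (w : List XZ) (Y : List R) (h : Y.length ≠ w.count XZ.z + 1) : mon w Y = 0 := by
  induction w generalizing Y with
  | nil => rw [mon, if_neg (by simpa using h)]
  | cons a w ih =>
    cases a
    · rw [mon, ih Y (by simpa using h), mul_zero]
    · rw [mon]
      cases Y with
      | nil => exact mon_nil_right _
      | cons y Y => exact ih _ (by simpa using h)

lemma mon_map_mul (c : R) (w : List XZ) (Y : List R) :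
    mon w (Y.map (c * ·)) = c ^ w.count XZ.x * mon w Y := by
  induction w generalizing Y with
  | nil => simp [mon]
  | cons a w ih =>
    cases a
    · cases Y with
      | nil => simp [mon_nil_right]
      | cons y Y =>
        have := ih (y :: Y)
        simp only [List.map_cons, mon, List.headD_cons, List.count_cons_self] at this ⊢
        rw [this]
        ring
    · have := ih Y.tail
      simpa [mon, List.map_tail] using this

variable (K : Type*) [Field K]

/-- `ev ψ Y` is the value at `Y` of the polynomial attached to `ψ`. -/
def ev : Kxz K →ₗ[K] (List K → K) := (wordBasis K XZ).constr K mon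

lemma ev_word (w : List XZ) : ev K (word K w) = mon w := by
  rw [← wordBasis_apply, ev, Module.Basis.constr_basis]

/-- The linear form `ψ ↦ ev ψ Y`. -/
def evAt (Y : List K) : Module.Dual K (Kxz K) := LinearMap.proj Y ∘ₗ ev K

lemma evAt_apply (Y : List K) (ψ : Kxz K) : evAt K Y ψ = ev K ψ Y := rfl

/-- Two linear maps on `K⟨X⟩` that agree on words are equal. -/
lemma linearMap_ext_word {X N : Type*} [AddCommGroup N] [Module K N]
    {f g : FreeAlgebra K X →ₗ[K] N} (h : ∀ w : List X, f (word K w) = g (word K w)) : f = g :=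
  (wordBasis K X).ext fun w => by rw [wordBasis_apply]; exact h w

lemma ev_x_mul (ψ : Kxz K) (Y : List K) :
    ev K (FreeAlgebra.ι K XZ.x * ψ) Y = Y.headD 0 * ev K ψ Y := by
  have : evAt K Y ∘ₗ LinearMap.mulLeft K (FreeAlgebra.ι K XZ.x) = Y.headD 0 • evAt K Y :=
    linearMap_ext_word K fun w => by simp [evAt_apply, ← word_cons, ev_word, mon]
  exact LinearMap.congr_fun this ψ

lemma ev_z_mul (ψ : Kxz K) (Y : List K) :
    ev K (FreeAlgebra.ι K XZ.z * ψ) Y = ev K ψ Y.tail := by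
  have : evAt K Y ∘ₗ LinearMap.mulLeft K (FreeAlgebra.ι K XZ.z) = evAt K Y.tail :=
    linearMap_ext_word K fun w => by simp [evAt_apply, ← word_cons, ev_word, mon]
  exact LinearMap.congr_fun this ψ

lemma ev_nil (ψ : Kxz K) : ev K ψ [] = 0 := by
  have : evAt K [] = 0 := linearMap_ext_word K fun w => by simp [evAt_apply, ev_word, mon_nil_right]
  exact LinearMap.congr_fun this ψ

lemma ev_one (Y : List K) : ev K 1 Y = if Y.length = 1 then 1 else 0 := by
  rw [← word_nil, ev_word, mon]

lemma ev_mul_z (ψ : Kxz K) (Y : List K) (c : K) :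
    ev K (ψ * FreeAlgebra.ι K XZ.z) (Y ++ [c]) = ev K ψ Y := by
  have : evAt K (Y ++ [c]) ∘ₗ LinearMap.mulRight K (FreeAlgebra.ι K XZ.z) = evAt K Y :=
    linearMap_ext_word K fun w => by
      have e : word K w * FreeAlgebra.ι K XZ.z = word K (w ++ [XZ.z]) := by
        simp [word_append, word_cons, word_nil]
      simp only [LinearMap.comp_apply, LinearMap.mulRight_apply, evAt_apply, e, ev_word,
        mon_append_z]
  exact LinearMap.congr_fun this ψ

/-! ### Values of polynomials in the `y_n` -/

/-- The value at `(t₁,…,t_m)` of the monomial `t₁^{n₁-1} ⋯ t_m^{n_m-1}`. -/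
def monY : List ℕ+ → List R → R
  | [], Y => if Y = [] then 1 else 0
  | _ :: _, [] => 0
  | n :: l, y :: Y => y ^ n.natPred * monY l Y

lemma monY_append (l : List ℕ+) (Y : List R) (n : ℕ+) (y : R) :
    monY (l ++ [n]) (Y ++ [y]) = monY l Y * y ^ n.natPred := by
  induction l generalizing Y with
  | nil =>
    cases Y with
    | nil => simp [monY]
    | cons a Y => simp [monY]
  | cons k l ih =>
    cases Y with
    | nil => cases l <;> simp [monY]
    | cons a Y => simp [monY, ih, mul_assoc]

lemma monY_reverse (l : List ℕ+) (Y : List R) : monY l.reverse Y.reverse = monY l Y := by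
  induction l generalizing Y with
  | nil => simp [monY]
  | cons n l ih =>
    cases Y with
    | nil =>
      rw [List.reverse_cons, List.reverse_nil]
      cases h : l.reverse ++ [n] with
      | nil => simp at h
      | cons a l' => rfl
    | cons y Y => rw [List.reverse_cons, List.reverse_cons, monY_append, ih, monY, mul_comm]

/-- `evY Ψ Y` is the value at `Y` of the polynomial attached to `Ψ`. -/
def evY : KY K →ₗ[K] (List K → K) := (wordBasis K ℕ+).constr K monY

lemma evY_word (w : List ℕ+) : evY K (word K w) = monY w := by
  rw [← wordBasis_apply, evY, Module.Basis.constr_basis]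

/-- The linear form `Ψ ↦ evY Ψ Y`. -/
def evYAt (Y : List K) : Module.Dual K (KY K) := LinearMap.proj Y ∘ₗ evY K

lemma evYAt_apply (Y : List K) (Ψ : KY K) : evYAt K Y Ψ = evY K Ψ Y := rfl

lemma evY_mul_cons (n : ℕ+) (Ψ : KY K) (y : K) (Y : List K) :
    evY K (FreeAlgebra.ι K n * Ψ) (y :: Y) = y ^ n.natPred * evY K Ψ Y := by
  have : evYAt K (y :: Y) ∘ₗ LinearMap.mulLeft K (FreeAlgebra.ι K n)
      = y ^ n.natPred • evYAt K Y :=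
    linearMap_ext_word K fun w => by simp [evYAt_apply, ← word_cons, evY_word, monY]
  exact LinearMap.congr_fun this Ψ

lemma evY_mul_nil (n : ℕ+) (Ψ : KY K) : evY K (FreeAlgebra.ι K n * Ψ) [] = 0 := by
  have : evYAt K [] ∘ₗ LinearMap.mulLeft K (FreeAlgebra.ι K n) = 0 :=
    linearMap_ext_word K fun w => by simp [evYAt_apply, ← word_cons, evY_word, monY]
  exact LinearMap.congr_fun this Ψ

lemma evY_one (Y : List K) : evY K 1 Y = if Y = [] then 1 else 0 := by
  rw [← word_nil, evY_word, monY]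

lemma mon_replicate_append (k : ℕ) (w : List XZ) (Y : List R) :
    mon (List.replicate k XZ.x ++ w) Y = Y.headD 0 ^ k * mon w Y := by
  induction k with
  | zero => simp
  | succ k ih => rw [List.replicate_succ, List.cons_append, mon, ih, pow_succ']; ring

lemma mon_blockWord (l : List ℕ+) (k : ℕ) (Y : List R) :
    mon (blockWord l ++ List.replicate k XZ.x) (Y ++ [0]) = if k = 0 then monY l Y else 0 := by
  induction l generalizing Y with
  | nil =>
    have h := mon_replicate_append k [] (Y ++ [(0 : R)])
    rw [List.append_nil] at h
    rw [blockWord, List.flatMap_nil, List.nil_append, h]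
    cases Y with
    | nil => cases k <;> simp [mon, monY]
    | cons y Y => simp [mon, monY]
  | cons n l ih =>
    have h : blockWord (n :: l) ++ List.replicate k XZ.x
        = List.replicate n.natPred XZ.x ++ XZ.z :: (blockWord l ++ List.replicate k XZ.x) := by
      simp [blockWord]
    rw [h, mon_replicate_append, mon]
    cases Y with
    | nil => simp [mon_nil_right, monY]
    | cons y Y =>
      rw [List.cons_append, List.tail_cons, ih, List.headD_cons]
      split_ifs <;> simp [monY]

/-- Putting 0 for the last variable kills the monomials of the words that end in `x`, which are
those killed by π, and leaves the other monomials unchanged. -/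
lemma evY_piMap (ψ : Kxz K) (Y : List K) : evY K (piMap K ψ) Y = ev K ψ (Y ++ [0]) := by
  have : evYAt K Y ∘ₗ piMap K = evAt K (Y ++ [0]) :=
    linearMap_ext_word K fun w => by
      have hw := parse_spec 0 w
      rw [List.replicate_zero, List.nil_append] at hw
      rw [LinearMap.comp_apply, evYAt_apply, evAt_apply, ev_word]
      conv_rhs => rw [← hw, mon_blockWord]
      rw [← wordBasis_apply, piMap, Module.Basis.constr_basis]
      split_ifs
      · rw [evY_word]
      · simp
  exact LinearMap.congr_fun this ψ

/-! ### Sums over degrees -/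

/-- Homogeneous functions of distinct degrees are linearly independent. -/
theorem eq_zero_of_sum_homogeneous [CharZero K] {M : Type*} [AddCommGroup M] [Module K M] (N : ℕ)
    (c : ℕ → M) (h : ∀ r : K, ∑ d ∈ Finset.range N, r ^ d • c d = 0) (d : ℕ) (hd : d < N) :
    c d = 0 := by
  have := coeff_eq_zero_of_value_eq_zero (K := K) (τ := Unit)
    ((Finset.range N).image fun d => Finsupp.single () d) (fun a => c (a ())) (fun t => ?_)
    (a := Finsupp.single () d) (Finset.mem_image_of_mem _ (Finset.mem_range.2 hd))
  · simpa using this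
  · rw [Finset.sum_image]
    · simpa using h (t ())
    · intro a _ b _ hab
      simpa using DFunLike.congr_fun hab ()

lemma pv_sum {M ι : Type*} [AddCommGroup M] [Module K M] (s : Finset ι) (c : ι → K)
    (I : ι → List ℕ+ → M) (d : ℕ) (ts : List K) :
    pv (fun l => ∑ i ∈ s, c i • I i l) d ts = ∑ i ∈ s, c i • pv (I i) d ts := by
  induction ts generalizing I d with
  | nil => by_cases h : d = 0 <;> simp [pv, h]
  | cons t ts ih =>
    simp only [pv, ih, Finset.smul_sum]
    rw [Finset.sum_comm]
    exact Finset.sum_congr rfl fun i _ => Finset.sum_congr rfl fun p _ => smul_comm _ _ _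

lemma pv_single (l₀ : List ℕ+) (d : ℕ) (ts : List K) :
    pv (fun l => if l = l₀ then (1 : K) else 0) d ts
      = if d = idxDegree l₀ then monY l₀ ts else 0 := by
  induction ts generalizing l₀ d with
  | nil =>
    cases l₀ with
    | nil => simp [pv, idxDegree, monY]
    | cons n l => simp [pv, monY]
  | cons t ts ih =>
    rw [pv]
    cases l₀ with
    | nil =>
      simp only [reduceCtorEq, if_false, monY, ite_self]
      refine Finset.sum_eq_zero fun p _ => ?_
      rw [pv_eq_zero _ _ _ (fun _ _ _ => rfl), smul_zero]
    | cons n l =>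
      have e : ∀ p ∈ Finset.HasAntidiagonal.antidiagonal d,
          t ^ p.1 • pv (fun l' => if p.1.succPNat :: l' = n :: l then (1 : K) else 0) p.2 ts
            = if p = (n.natPred, idxDegree l) then t ^ n.natPred * monY l ts else 0 := by
        rintro ⟨i, j⟩ _
        by_cases hi : i = n.natPred
        · subst hi
          simp only [PNat.succPNat_natPred, List.cons.injEq, true_and, ih, Prod.mk.injEq]
          split_ifs <;> simp
        · have hne : i.succPNat ≠ n := by
            rintro rfl
            simp at hi
          rw [pv_eq_zero]
          · simp [hi]
          · intro l' _ _
            simp [hne]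
      rw [Finset.sum_congr rfl e, Finset.sum_ite_eq']
      simp only [Finset.HasAntidiagonal.mem_antidiagonal, monY]
      have : idxDegree (n :: l) = n.natPred + idxDegree l := by simp [idxDegree]
      rw [this]
      simp [eq_comm]

lemma idxDegree_reverse (l : List ℕ+) : idxDegree l.reverse = idxDegree l := by
  simp [idxDegree, List.map_reverse]

/-- The polynomial function attached to `Ψ` is the sum of its homogeneous components. -/
theorem exists_sum_pv (Ψ : KY K) : ∃ N : ℕ,
    (∀ d ≥ N, ∀ ts : List K, pv (fun l => (wordBasis K ℕ+).repr Ψ l.reverse) d ts = 0) ∧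
    ∀ ts : List K, ∑ d ∈ Finset.range N, pv (fun l => (wordBasis K ℕ+).repr Ψ l.reverse) d ts
      = evY K Ψ ts.reverse := by
  classical
  set s := ((wordBasis K ℕ+).repr Ψ).support with hs
  refine ⟨s.sup idxDegree + 1, fun d hd ts => pv_eq_zero _ _ _ fun l _ hl => ?_, fun ts => ?_⟩
  · by_contra hne
    have : l.reverse ∈ s := by rw [hs, Finsupp.mem_support_iff]; exact hne
    have := Finset.le_sup (f := idxDegree) this
    rw [idxDegree_reverse] at this
    omega
  · have h1 : (fun l : List ℕ+ => (wordBasis K ℕ+).repr Ψ l.reverse)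
        = fun l => ∑ l₀ ∈ s, (wordBasis K ℕ+).repr Ψ l₀ • if l = l₀.reverse then (1 : K) else 0 := by
      funext l
      have e : ∀ l₀ : List ℕ+, l = l₀.reverse ↔ l.reverse = l₀ := fun l₀ => by
        constructor
        · rintro rfl; simp
        · rintro rfl; simp
      simp only [e, smul_eq_mul, mul_ite, mul_one, mul_zero, Finset.sum_ite_eq]
      split_ifs with h
      · rfl
      · rwa [hs, Finsupp.notMem_support_iff] at h
    have h2 : evY K Ψ ts.reverse = ∑ l₀ ∈ s, (wordBasis K ℕ+).repr Ψ l₀ * monY l₀ ts.reverse := by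
      have e := (wordBasis K ℕ+).linearCombination_repr Ψ
      rw [Finsupp.linearCombination_apply, Finsupp.sum] at e
      have e' := congrArg (evYAt K ts.reverse) e
      simp only [map_sum, map_smul, wordBasis_apply, evYAt_apply, evY_word, smul_eq_mul] at e'
      exact e'.symm
    rw [h2, h1]
    simp only [pv_sum]
    rw [Finset.sum_comm]
    refine Finset.sum_congr rfl fun l₀ hl₀ => ?_
    rw [← Finset.smul_sum, smul_eq_mul]
    congr 1
    simp only [pv_single, idxDegree_reverse]
    rw [Finset.sum_ite_eq' (Finset.range _) (idxDegree l₀), if_pos, ← monY_reverse,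
      List.reverse_reverse]
    rw [Finset.mem_range]
    exact Nat.lt_succ_of_le (Finset.le_sup hl₀)

theorem evY_injective [CharZero K] (Ψ : KY K) (h : ∀ Y, evY K Ψ Y = 0) : Ψ = 0 := by
  obtain ⟨N, hN, hs⟩ := exists_sum_pv K Ψ
  have h0 : ∀ l : List ℕ+, (wordBasis K ℕ+).repr Ψ l.reverse = 0 := by
    refine eq_zero_of_pv (K := K) _ fun d ts => ?_
    by_cases hd : N ≤ d
    · exact hN d hd ts
    · refine eq_zero_of_sum_homogeneous K N
        -- Rescaling the variables by `r` multiplies the component of degree `d` by r^d, which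
        -- separates the components.
        (fun d => pv (fun l => (wordBasis K ℕ+).repr Ψ l.reverse) d ts) (fun r => ?_) d (by omega)
      have := hs (ts.map (r * ·))
      rw [h] at this
      simpa only [pv_map_mul] using this
  apply (wordBasis K ℕ+).repr.injective
  ext l
  simpa using h0 l.reverse

/-- Reduction to K⟨Y⟩: multiplying by `z` on the right frees the last variable, so that no
information is lost when π sets the new last variable to 0. -/
theorem ev_injective [CharZero K] (ψ : Kxz K) (h : ∀ Y, ev K ψ Y = 0) : ψ = 0 := by
  have h0 : piMap K (ψ * FreeAlgebra.ι K XZ.z) = 0 := by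
    refine evY_injective K _ fun Y => ?_
    rw [evY_piMap, ev_mul_z, h]
  apply (wordBasis K XZ).repr.injective
  ext w
  -- The words w z are in bijection with the words in the y_n, so every coefficient of `ψ` is a
  -- coefficient of π(ψ z).
  have key : ((wordBasis K ℕ+).coord (parse 0 (w ++ [XZ.z])).1) ∘ₗ piMap K ∘ₗ
      LinearMap.mulRight K (FreeAlgebra.ι K XZ.z) = (wordBasis K XZ).coord w := by
    refine linearMap_ext_word K fun w' => ?_
    have e : word K w' * FreeAlgebra.ι K XZ.z = word K (w' ++ [XZ.z]) := by
      simp [word_append, word_cons, word_nil]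
    have hz : ∀ (n : ℕ) (w : List XZ), (parse n (w ++ [XZ.z])).2 = 0 := by
      intro n w
      induction w generalizing n with
      | nil => simp [parse]
      | cons a w ih => cases a <;> simp [parse, ih]
    have hinj : (parse 0 (w' ++ [XZ.z])).1 = (parse 0 (w ++ [XZ.z])).1 ↔ w' = w := by
      constructor
      · intro h
        have h1 := parse_spec 0 (w' ++ [XZ.z])
        have h2 := parse_spec 0 (w ++ [XZ.z])
        rw [hz] at h1 h2
        rw [h, h2] at h1
        simpa using h1.symm
      · rintro rfl; rfl
    rw [LinearMap.comp_apply, LinearMap.comp_apply, LinearMap.mulRight_apply, e,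
      ← wordBasis_apply K (w' ++ _), piMap, Module.Basis.constr_basis, hz, if_pos rfl,
      ← wordBasis_apply, ← wordBasis_apply, Module.Basis.coord_apply, Module.Basis.coord_apply,
      Module.Basis.repr_self, Module.Basis.repr_self, Finsupp.single_apply, Finsupp.single_apply]
    simp only [hinj]
  have := LinearMap.congr_fun key ψ
  rw [LinearMap.comp_apply, LinearMap.comp_apply, LinearMap.mulRight_apply, h0, map_zero] at this
  simpa using this.symm

end Eval

/-! ### Coproducts tested against evaluations -/

section Coproduct

variable (K : Type*) [Field K]

lemma dualDistrib_mul {A : Type*} [Ring A] [Algebra K A] (f g : Module.Dual K A) (p q : A)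
    (t : A ⊗[K] A) :
    TensorProduct.dualDistrib K A A (f ⊗ₜ[K] g) ((p ⊗ₜ[K] q) * t)
      = TensorProduct.dualDistrib K A A
          ((f ∘ₗ LinearMap.mulLeft K p) ⊗ₜ[K] (g ∘ₗ LinearMap.mulLeft K q)) t := by
  induction t using TensorProduct.induction_on with
  | zero => simp
  | add a b ha hb => rw [mul_add, map_add, map_add, ha, hb]
  | tmul a b => simp

lemma coproduct_ι_mul {X : Type*} (a : X) (ψ : FreeAlgebra K X) :
    coproduct K X (FreeAlgebra.ι K a * ψ)
      = (1 ⊗ₜ[K] FreeAlgebra.ι K a) * coproduct K X ψ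
        + (FreeAlgebra.ι K a ⊗ₜ[K] 1) * coproduct K X ψ := by
  rw [map_mul, coproduct, FreeAlgebra.lift_ι_apply, add_mul]

/-! ### Primitive elements of `K⟨Y⟩` -/

/-- On values, a leading letter y_n gives a power of the first variable, which is then removed. The
coproduct puts this letter in the left or in the right factor: this is the choice of the first
letter of a shuffle of `u` and `v`. -/
lemma evY_coproduct (Ψ : KY K) (u v : List K) :
    TensorProduct.dualDistrib K _ _ (evYAt K u ⊗ₜ[K] evYAt K v) (coproduct K ℕ+ Ψ)
      = shSum (evY K Ψ) u v := by
  have key : ∀ (w : List ℕ+) (u v : List K),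
      TensorProduct.dualDistrib K _ _ (evYAt K u ⊗ₜ[K] evYAt K v) (coproduct K ℕ+ (word K w))
        = shSum (evY K (word K w)) u v := by
    intro w
    have hc : ∀ (n : ℕ+) (y : K) (Y : List K),
        evYAt K (y :: Y) ∘ₗ LinearMap.mulLeft K (FreeAlgebra.ι K n)
          = y ^ n.natPred • evYAt K Y := fun n y Y => LinearMap.ext fun Ψ => by
      simpa [evYAt_apply] using evY_mul_cons K n Ψ y Y
    have hn : ∀ (n : ℕ+), evYAt K [] ∘ₗ LinearMap.mulLeft K (FreeAlgebra.ι K n) = 0 :=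
      fun n => LinearMap.ext fun Ψ => by simpa [evYAt_apply] using evY_mul_nil K n Ψ
    induction w with
    | nil =>
      intro u v
      rw [word_nil, map_one, Algebra.TensorProduct.one_def, TensorProduct.dualDistrib_apply,
        evYAt_apply, evYAt_apply, evY_one, evY_one]
      cases u with
      | nil => simp [shSum_nil_left, evY_one]
      | cons a u =>
        rw [shSum_eq_zero, if_neg (by simp), zero_mul]
        intro l hl
        rw [evY_one, if_neg]
        rintro rfl
        simpa using hl.length_eq
    | cons n w ih =>
      intro u v
      have hw : ∀ (y : K), (fun l => evY K (FreeAlgebra.ι K n * word K w) (y :: l))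
          = fun l => y ^ n.natPred • evY K (word K w) l := fun y => by
        funext l
        rw [evY_mul_cons, smul_eq_mul]
      rw [word_cons, coproduct_ι_mul, map_add, dualDistrib_mul, dualDistrib_mul,
        LinearMap.mulLeft_one, LinearMap.comp_id, LinearMap.comp_id]
      rcases u with _ | ⟨a, u⟩ <;> rcases v with _ | ⟨b, v⟩
      · simp [hn, shSum_nil_left, evY_mul_nil]
      · rw [hn, hc, TensorProduct.tmul_smul, map_smul, LinearMap.smul_apply, ih]
        simp [shSum_nil_left, evY_mul_cons]
      · rw [hn, hc, ← TensorProduct.smul_tmul', map_smul, LinearMap.smul_apply, ih]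
        simp [shSum_nil_right, evY_mul_cons]
      · rw [hc, hc, TensorProduct.tmul_smul, ← TensorProduct.smul_tmul', map_smul, map_smul,
          LinearMap.smul_apply, LinearMap.smul_apply, ih, ih, shSum_cons, hw, hw, shSum_smul,
          shSum_smul, add_comm]
  have : (TensorProduct.dualDistrib K _ _ (evYAt K u ⊗ₜ[K] evYAt K v)) ∘ₗ
      (coproduct K ℕ+).toLinearMap
      = { toFun := fun Ψ => shSum (evY K Ψ) u v
          map_add' := fun a b => by simp only [map_add, shSum_add]
          map_smul' := fun c a => (congrArg (fun f => shSum f u v) (map_smul (evY K) c a)).trans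
            (shSum_smul c _ u v) } :=
    linearMap_ext_word K fun w => key w u v
  exact LinearMap.congr_fun this Ψ

/-- Products of evaluations separate the points of the tensor square, and the evaluation of 1 is
nonzero only at the empty list. The pairs with an empty member give only the vanishing of the
constant term. -/
theorem primitiveY_iff [CharZero K] (Ψ : KY K) :
    coproduct K ℕ+ Ψ = 1 ⊗ₜ[K] Ψ + Ψ ⊗ₜ[K] 1 ↔
      evY K Ψ [] = 0 ∧ ∀ u v, u ≠ [] → v ≠ [] → shSum (evY K Ψ) u v = 0 := by
  have hr : ∀ u v, TensorProduct.dualDistrib K _ _ (evYAt K u ⊗ₜ[K] evYAt K v)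
      (1 ⊗ₜ[K] Ψ + Ψ ⊗ₜ[K] 1) = evY K 1 u * evY K Ψ v + evY K Ψ u * evY K 1 v := by
    intro u v
    rw [map_add, TensorProduct.dualDistrib_apply, TensorProduct.dualDistrib_apply]
    rfl
  constructor
  · intro h
    have H : ∀ u v, shSum (evY K Ψ) u v = evY K 1 u * evY K Ψ v + evY K Ψ u * evY K 1 v := by
      intro u v
      rw [← evY_coproduct, h, hr]
    refine ⟨?_, fun u v hu hv => ?_⟩
    · simpa [shSum_nil_left, evY_one] using H [] []
    · simpa [evY_one, hu, hv] using H u v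
  · rintro ⟨h0, h⟩
    rw [← sub_eq_zero]
    refine tensor_eq_zero_of_separating (evYAt K) (evYAt K) (evY_injective K) (evY_injective K) _ ?_
    intro u v
    rw [map_sub, evY_coproduct, hr, sub_eq_zero, evY_one, evY_one]
    by_cases hu : u = []
    · subst hu
      simp [shSum_nil_left, h0]
    · by_cases hv : v = []
      · subst hv
        simp [shSum_nil_right, hu]
      · simp [h u v hu hv, hu, hv]

/-! ### Primitive elements of `K⟨x,z⟩` -/

/-- The sum of the values of `g` at the lists `(Y_{i₀} + Y'_{j₀}, Y_{i₁} + Y'_{j₁}, …)`, over the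
lattice paths from the beginning to the end of both lists. -/
def latSum {K : Type*} [Field K] (g : List K → K) : List K → List K → K
  | [], _ => 0
  | _ :: _, [] => 0
  | y :: Y, y' :: Y' => (if Y = [] ∧ Y' = [] then g [y + y'] else 0)
      + latSum (fun l => g ((y + y') :: l)) Y (y' :: Y')
      + latSum (fun l => g ((y + y') :: l)) (y :: Y) Y'
  termination_by Y Y' => Y.length + Y'.length

variable {K}

lemma latSum_nil_left (g : List K → K) (Y' : List K) : latSum g [] Y' = 0 := by
  rw [latSum]

lemma latSum_nil_right (g : List K → K) (Y : List K) : latSum g Y [] = 0 := by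
  cases Y <;> rw [latSum]

lemma latSum_cons (g : List K → K) (y y' : K) (Y Y' : List K) :
    latSum g (y :: Y) (y' :: Y') = (if Y = [] ∧ Y' = [] then g [y + y'] else 0)
      + latSum (fun l => g ((y + y') :: l)) Y (y' :: Y')
      + latSum (fun l => g ((y + y') :: l)) (y :: Y) Y' := by
  rw [latSum]

lemma latSum_congr {g h : List K → K} (H : ∀ l, l ≠ [] → g l = h l) (Y Y' : List K) :
    latSum g Y Y' = latSum h Y Y' := by
  induction Y, Y' using shuffle_induction generalizing g h with
  | hl v => rw [latSum_nil_left, latSum_nil_left]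
  | hr u => rw [latSum_nil_right, latSum_nil_right]
  | hc a b u v ih₁ ih₂ =>
    rw [latSum_cons, latSum_cons, H _ (by simp), ih₁ (fun l _ => H _ (by simp)),
      ih₂ (fun l _ => H _ (by simp))]

lemma latSum_add (g h : List K → K) (Y Y' : List K) :
    latSum (fun l => g l + h l) Y Y' = latSum g Y Y' + latSum h Y Y' := by
  induction Y, Y' using shuffle_induction generalizing g h with
  | hl v => simp [latSum_nil_left]
  | hr u => simp [latSum_nil_right]
  | hc a b u v ih₁ ih₂ =>
    rw [latSum_cons, latSum_cons, latSum_cons, ih₁, ih₂]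
    split_ifs <;> ring

lemma latSum_mul (c : K) (g : List K → K) (Y Y' : List K) :
    latSum (fun l => c * g l) Y Y' = c * latSum g Y Y' := by
  induction Y, Y' using shuffle_induction generalizing g with
  | hl v => simp [latSum_nil_left]
  | hr u => simp [latSum_nil_right]
  | hc a b u v ih₁ ih₂ =>
    rw [latSum_cons, latSum_cons, ih₁, ih₂]
    split_ifs <;> ring

lemma latSum_zero (Y Y' : List K) : latSum (fun _ => (0 : K)) Y Y' = 0 := by
  simpa using latSum_mul 0 (fun _ => (0 : K)) Y Y'

/-- When one of the lists has a single entry there is only one lattice path. -/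
lemma latSum_singleton_left (g : List K → K) (c : K) (Y : List K) (hY : Y ≠ []) :
    latSum g [c] Y = g (Y.map (c + ·)) := by
  induction Y generalizing g with
  | nil => exact absurd rfl hY
  | cons y Y ih =>
    rw [latSum_cons, latSum_nil_left]
    cases Y with
    | nil => simp [latSum_nil_right]
    | cons y' Y => rw [ih _ (by simp)]; simp

lemma latSum_singleton_right (g : List K → K) (c : K) (Y : List K) (hY : Y ≠ []) :
    latSum g Y [c] = g (Y.map (c + ·)) := by
  induction Y generalizing g with
  | nil => exact absurd rfl hY
  | cons y Y ih =>
    rw [latSum_cons, latSum_nil_right]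
    cases Y with
    | nil => simp [latSum_nil_left, add_comm]
    | cons y' Y => rw [ih _ (by simp)]; simp [add_comm]

lemma latSum_map_add (g : List K → K) (c c' : K) (Y Y' : List K) :
    latSum g (Y.map (c + ·)) (Y'.map (c' + ·))
      = latSum (fun l => g (l.map (c + c' + ·))) Y Y' := by
  induction Y, Y' using shuffle_induction generalizing g with
  | hl v => simp [latSum_nil_left]
  | hr u => simp [latSum_nil_right]
  | hc a b u v ih₁ ih₂ =>
    simp only [List.map_cons] at ih₁ ih₂ ⊢
    rw [latSum_cons, latSum_cons, ih₁, ih₂, show c + a + (c' + b) = c + c' + (a + b) by ring]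
    simp

/-- The list `(t₁ + ⋯ + t_m, t₂ + ⋯ + t_m, …, t_m, 0)`. -/
def sufsum : List K → List K
  | [] => [0]
  | t :: ts => (t + ts.sum) :: sufsum ts

lemma sufsum_ne_nil (l : List K) : sufsum l ≠ [] := by
  cases l <;> simp [sufsum]

/-- A lattice path prescribes a shuffle. At each of its points the entry is the sum of the letters
not yet used in `u` and in `v`, that is, a suffix sum of that shuffle. -/
lemma latSum_sufsum (g : List K → K) (u v : List K) :
    latSum g (sufsum u) (sufsum v) = shSum (fun l => g (sufsum l)) u v := by
  induction u, v using shuffle_induction generalizing g with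
  | hl v => rw [sufsum, latSum_singleton_left _ _ _ (sufsum_ne_nil v), shSum_nil_left]; simp
  | hr u => rw [sufsum, latSum_singleton_right _ _ _ (sufsum_ne_nil u), shSum_nil_right]; simp
  | hc a b u v ih₁ ih₂ =>
    rw [shSum_cons, sufsum, sufsum, latSum_cons, if_neg (fun h => sufsum_ne_nil _ h.1), zero_add,
      ← sufsum, ← sufsum, ih₁, ih₂]
    congr 1
    · refine shSum_congr fun l hl => ?_
      rw [sufsum, hl.sum_eq]
      simp [add_assoc]
    · refine shSum_congr fun l hl => ?_
      rw [sufsum, hl.sum_eq]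
      simp only [List.sum_append, List.sum_cons]
      congr 2
      ring

/-- Here `c` is the last entry and `u` consists of the successive differences. By translation
invariance, suffix sums thus account for all nonempty lists. -/
lemma exists_sufsum_eq (l : List K) (hl : l ≠ []) :
    ∃ (c : K) (u : List K), l = (sufsum u).map (c + ·) := by
  induction l with
  | nil => exact absurd rfl hl
  | cons a l ih =>
    cases l with
    | nil => exact ⟨a, [], by simp [sufsum]⟩
    | cons b l =>
      obtain ⟨c, u, hu⟩ := ih (by simp)
      exact ⟨c, (a - c - u.sum) :: u, by rw [hu]; simp [sufsum]⟩

lemma sufsum_eq_reverse (u : List K) : sufsum u = (psum u.reverse).reverse ++ [0] := by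
  induction u with
  | nil => simp [sufsum, psum, psumFrom]
  | cons a u ih =>
    rw [sufsum, ih, List.reverse_cons, psum, psum, psumFrom_append]
    simp [psumFrom, add_comm]

variable (K)

/-- A leading `x` contributes the first variable of one of the two factors, in total y + y'. A
leading `z` removes the first entry of one of the two lists, that is, makes a step of a lattice
path. -/
lemma ev_coproduct (ψ : Kxz K) (Y Y' : List K) :
    TensorProduct.dualDistrib K _ _ (evAt K Y ⊗ₜ[K] evAt K Y') (coproduct K XZ ψ)
      = latSum (ev K ψ) Y Y' := by
  have hx : ∀ Y : List K, evAt K Y ∘ₗ LinearMap.mulLeft K (FreeAlgebra.ι K XZ.x)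
      = Y.headD 0 • evAt K Y := fun Y => LinearMap.ext fun ψ => by
    simpa [evAt_apply] using ev_x_mul K ψ Y
  have hz : ∀ Y : List K, evAt K Y ∘ₗ LinearMap.mulLeft K (FreeAlgebra.ι K XZ.z)
      = evAt K Y.tail := fun Y => LinearMap.ext fun ψ => by
    simpa [evAt_apply] using ev_z_mul K ψ Y
  have hnil : evAt K [] = 0 := LinearMap.ext fun ψ => ev_nil K ψ
  have key : ∀ (w : List XZ) (Y Y' : List K),
      TensorProduct.dualDistrib K _ _ (evAt K Y ⊗ₜ[K] evAt K Y') (coproduct K XZ (word K w))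
        = latSum (ev K (word K w)) Y Y' := by
    intro w
    induction w with
    | nil =>
      intro Y Y'
      rw [word_nil, map_one, Algebra.TensorProduct.one_def, TensorProduct.dualDistrib_apply,
        evAt_apply, evAt_apply, ev_one, ev_one]
      rcases Y with _ | ⟨y, Y⟩
      · simp [latSum_nil_left]
      rcases Y' with _ | ⟨y', Y'⟩
      · simp [latSum_nil_right]
      -- The polynomial of 1 lives in one variable, so only the path of a single point can
      -- contribute.
      have h0 : ∀ l, l ≠ [] → ev K 1 ((y + y') :: l) = 0 := by
        intro l hl
        simp [ev_one, hl]
      rw [latSum_cons, latSum_congr (h := fun _ => 0) h0, latSum_congr (h := fun _ => 0) h0,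
        latSum_zero, latSum_zero, ev_one]
      by_cases h : Y = [] <;> simp [h]
    | cons a w ih =>
      intro Y Y'
      rcases Y with _ | ⟨y, Y⟩
      · simp [latSum_nil_left, hnil]
      rcases Y' with _ | ⟨y', Y'⟩
      · simp [latSum_nil_right, hnil]
      rw [word_cons, coproduct_ι_mul, map_add, dualDistrib_mul, dualDistrib_mul,
        LinearMap.mulLeft_one, LinearMap.comp_id, LinearMap.comp_id]
      cases a with
      | x =>
        rw [hx, hx, TensorProduct.tmul_smul, ← TensorProduct.smul_tmul', map_smul, map_smul,
          LinearMap.smul_apply, LinearMap.smul_apply, ih, latSum_cons, latSum_cons]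
        simp only [ev_x_mul, List.headD_cons, latSum_mul, smul_eq_mul]
        split_ifs <;> ring
      | z =>
        rw [hz, hz, ih, ih, latSum_cons]
        simp only [ev_z_mul, List.tail_cons, ev_nil, ite_self, zero_add]
        exact add_comm _ _
  have : (TensorProduct.dualDistrib K _ _ (evAt K Y ⊗ₜ[K] evAt K Y')) ∘ₗ
      (coproduct K XZ).toLinearMap
      = { toFun := fun ψ => latSum (ev K ψ) Y Y'
          map_add' := fun a b => (congrArg (fun f => latSum f Y Y') (map_add (ev K) a b)).trans
            (latSum_add _ _ Y Y')
          map_smul' := fun c a => (congrArg (fun f => latSum f Y Y') (map_smul (ev K) c a)).trans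
            (latSum_mul c _ Y Y') } :=
    linearMap_ext_word K fun w => key w Y Y'
  exact LinearMap.congr_fun this ψ

/-- A one-entry list tests translation invariance, and two suffix sum lists of length at least 2,
where the evaluation of 1 vanishes, test the shuffle relations. Conversely, every pair of nonempty
lists is a pair of translates of suffix sum lists. The absence of a depth 0 part disposes of the
terms with one-variable values. -/
theorem primitive_iff [CharZero K] (ψ : Kxz K) (h0 : ∀ y, ev K ψ [y] = 0) :
    coproduct K XZ ψ = 1 ⊗ₜ[K] ψ + ψ ⊗ₜ[K] 1 ↔
      (∀ c Y, ev K ψ (Y.map (c + ·)) = ev K ψ Y) ∧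
        ∀ u v, u ≠ [] → v ≠ [] → shSum (fun l => ev K ψ (sufsum l)) u v = 0 := by
  have hr : ∀ u v, TensorProduct.dualDistrib K _ _ (evAt K u ⊗ₜ[K] evAt K v)
      (1 ⊗ₜ[K] ψ + ψ ⊗ₜ[K] 1) = ev K 1 u * ev K ψ v + ev K ψ u * ev K 1 v := by
    intro u v
    rw [map_add, TensorProduct.dualDistrib_apply, TensorProduct.dualDistrib_apply]
    rfl
  have h1 : ∀ Y : List K, 2 ≤ Y.length → ev K 1 Y = 0 := fun Y hY => by
    rw [ev_one, if_neg (by omega)]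
  have hlen : ∀ u : List K, u ≠ [] → 2 ≤ (sufsum u).length := by
    intro u hu
    rcases u with _ | ⟨a, u⟩
    · exact absurd rfl hu
    · have := List.length_pos_of_ne_nil (sufsum_ne_nil u)
      simp only [sufsum, List.length_cons]
      omega
  constructor
  · intro h
    have H : ∀ u v, latSum (ev K ψ) u v = ev K 1 u * ev K ψ v + ev K ψ u * ev K 1 v := by
      intro u v
      rw [← ev_coproduct, h, hr]
    refine ⟨fun c Y => ?_, fun u v hu hv => ?_⟩
    · by_cases hY : Y = []
      · subst hY; rfl
      · rw [← latSum_singleton_left (ev K ψ) c Y hY, H, h0, ev_one]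
        simp
    · rw [← latSum_sufsum, H, h1 _ (hlen u hu), h1 _ (hlen v hv)]
      simp
  · rintro ⟨ht, hs⟩
    rw [← sub_eq_zero]
    refine tensor_eq_zero_of_separating (evAt K) (evAt K) (ev_injective K) (ev_injective K) _ ?_
    intro Y Y'
    rw [map_sub, ev_coproduct, hr, sub_eq_zero]
    by_cases hY : Y = []
    · subst hY
      simp [latSum_nil_left, ev_nil]
    by_cases hY' : Y' = []
    · subst hY'
      simp [latSum_nil_right, ev_nil]
    obtain ⟨c, u, rfl⟩ := exists_sufsum_eq Y hY
    obtain ⟨c', v, rfl⟩ := exists_sufsum_eq Y' hY'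
    rw [latSum_map_add]
    simp only [ht]
    rw [latSum_sufsum]
    by_cases hu : u = []
    · subst hu
      simp [shSum_nil_left, sufsum, ev_one, h0]
    by_cases hv : v = []
    · subst hv
      simp [shSum_nil_right, sufsum, ev_one, h0]
    rw [hs u v hu hv, h1 _ (by simpa using hlen u hu), h1 _ (by simpa using hlen v hv)]
    simp

/-! ### Translation invariance -/

/-- The derivation of `K⟨x,z⟩` with `x ↦ 1` and `z ↦ 0`, on words. -/
def dxWord : List XZ → Kxz K
  | [] => 0
  | XZ.x :: w => word K w + FreeAlgebra.ι K XZ.x * dxWord w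
  | XZ.z :: w => FreeAlgebra.ι K XZ.z * dxWord w

/-- The derivation of `K⟨x,z⟩` with `x ↦ 1` and `z ↦ 0`. -/
def dx : Kxz K →ₗ[K] Kxz K := (wordBasis K XZ).constr K (dxWord K)

lemma dx_word (w : List XZ) : dx K (word K w) = dxWord K w := by
  rw [← wordBasis_apply, dx, Module.Basis.constr_basis]

lemma pairing_ι_mul (a b : XZ) (p q : Kxz K) :
    pairing K XZ (FreeAlgebra.ι K a * p) (FreeAlgebra.ι K b * q)
      = if a = b then pairing K XZ p q else 0 := by
  have : (pairing K XZ).compl₁₂ (LinearMap.mulLeft K (FreeAlgebra.ι K a))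
      (LinearMap.mulLeft K (FreeAlgebra.ι K b)) = (if a = b then (1 : K) else 0) • pairing K XZ :=
    linearMap_ext_word K fun u => linearMap_ext_word K fun v => by
      simp only [LinearMap.compl₁₂_apply, LinearMap.mulLeft_apply, ← word_cons, pairing_word,
        LinearMap.smul_apply, List.cons.injEq]
      split_ifs <;> simp_all
  have h := LinearMap.congr_fun (LinearMap.congr_fun this p) q
  simp only [LinearMap.compl₁₂_apply, LinearMap.mulLeft_apply, LinearMap.smul_apply] at h
  rw [h]
  split_ifs <;> simp

lemma pairing_ι_mul_one (a : XZ) (p : Kxz K) : pairing K XZ (FreeAlgebra.ι K a * p) 1 = 0 := by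
  have : (pairing K XZ).flip 1 ∘ₗ (LinearMap.mulLeft K (FreeAlgebra.ι K a)) = 0 :=
    linearMap_ext_word K fun u => by
      rw [LinearMap.comp_apply, LinearMap.mulLeft_apply, ← word_cons, LinearMap.flip_apply,
        ← word_nil, pairing_word]
      simp
  exact LinearMap.congr_fun this p

/-- Shuffling with the letter `x` inserts an `x` at all places, and `dx` deletes each `x` in turn:
the two operations are adjoint. -/
lemma pairing_shuffleWord_x (u : List XZ) (ψ : Kxz K) :
    pairing K XZ (shuffleWord K u [XZ.x]) ψ = pairing K XZ (word K u) (dx K ψ) := by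
  have key : ∀ w : List XZ, pairing K XZ (shuffleWord K u [XZ.x]) (word K w)
      = pairing K XZ (word K u) (dx K (word K w)) := by
    intro w
    rw [dx_word]
    induction w generalizing u with
    | nil =>
      cases u with
      | nil => rw [shuffleWord, word_cons, word_nil, pairing_ι_mul_one, dxWord, map_zero]
      | cons a u => rw [shuffleWord, word_nil, map_add, LinearMap.add_apply, pairing_ι_mul_one,
          pairing_ι_mul_one, dxWord, map_zero, add_zero]
    | cons b w ih =>
      cases u with
      | nil =>
        rw [shuffleWord, word_cons K XZ.x, word_cons K b, pairing_ι_mul]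
        have h1 : ∀ a (p : Kxz K), pairing K XZ (word K []) (FreeAlgebra.ι K a * p) = 0 :=
          fun a p => by rw [pairing_symm, word_nil, pairing_ι_mul_one]
        cases b <;> simp [dxWord, h1]
      | cons a u =>
        rw [shuffleWord, shuffleWord_nil_right, map_add, LinearMap.add_apply, word_cons K b,
          pairing_ι_mul, pairing_ι_mul, ih]
        cases b
        · rw [dxWord, map_add, word_cons K a, pairing_ι_mul]
          simp [add_comm]
        · rw [dxWord, word_cons K a, pairing_ι_mul]
          simp
  have : pairing K XZ (shuffleWord K u [XZ.x]) = pairing K XZ (word K u) ∘ₗ dx K :=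
    linearMap_ext_word K fun w => by simpa using key w
  rw [this]
  rfl

open Polynomial in
/-- The polynomial in `c` with values `ev ψ (y₀ + c, …, y_m + c)`. -/
def evShift (Y : List K) : Kxz K →ₗ[K] K[X] :=
  (wordBasis K XZ).constr K fun w => mon w (Y.map fun y => C y + X)

open Polynomial in
lemma eval_evShift (Y : List K) (ψ : Kxz K) (c : K) :
    (evShift K Y ψ).eval c = ev K ψ (Y.map (c + ·)) := by
  have : Polynomial.leval c ∘ₗ evShift K Y = evAt K (Y.map (c + ·)) :=
    linearMap_ext_word K fun w => by
      rw [LinearMap.comp_apply, evAt_apply, ev_word, ← wordBasis_apply, evShift,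
        Module.Basis.constr_basis, Polynomial.leval_apply, ← Polynomial.coe_evalRingHom, map_mon]
      simp [Function.comp_def, add_comm]
  exact LinearMap.congr_fun this ψ

-- Differentiating in the common shift differentiates each power of each variable, that is, deletes
-- one letter `x` in all possible ways.
open Polynomial in
lemma derivative_evShift (Y : List K) (ψ : Kxz K) :
    derivative (evShift K Y ψ) = evShift K Y (dx K ψ) := by
  have hw : ∀ (w : List XZ) (Y : List K), evShift K Y (word K w)
      = mon w (Y.map fun y => C y + X) := fun w Y => by
    rw [← wordBasis_apply, evShift, Module.Basis.constr_basis]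
  have hx : ∀ (y : K) (Y : List K) (ψ : Kxz K),
      evShift K (y :: Y) (FreeAlgebra.ι K XZ.x * ψ) = (C y + X) * evShift K (y :: Y) ψ := by
    intro y Y ψ
    have : evShift K (y :: Y) ∘ₗ LinearMap.mulLeft K (FreeAlgebra.ι K XZ.x)
        = LinearMap.mulLeft K (C y + X) ∘ₗ evShift K (y :: Y) :=
      linearMap_ext_word K fun w => by simp [← word_cons, hw, mon]
    exact LinearMap.congr_fun this ψ
  have hz : ∀ (Y : List K) (ψ : Kxz K),
      evShift K Y (FreeAlgebra.ι K XZ.z * ψ) = evShift K Y.tail ψ := by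
    intro Y ψ
    have : evShift K Y ∘ₗ LinearMap.mulLeft K (FreeAlgebra.ι K XZ.z) = evShift K Y.tail :=
      linearMap_ext_word K fun w => by simp [← word_cons, hw, mon, List.map_tail]
    exact LinearMap.congr_fun this ψ
  have hn : evShift K [] = 0 := linearMap_ext_word K fun w => by simp [hw, mon_nil_right]
  have key : ∀ (w : List XZ) (Y : List K),
      derivative (evShift K Y (word K w)) = evShift K Y (dx K (word K w)) := by
    intro w
    rw [dx_word]
    induction w with
    | nil =>
      intro Y
      rw [hw, mon, dxWord, map_zero]
      split_ifs <;> simp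
    | cons a w ih =>
      intro Y
      cases a with
      | x =>
        cases Y with
        | nil => simp [hn]
        | cons y Y =>
          rw [word_cons, hx, derivative_mul, ih, dxWord, map_add (evShift K (y :: Y)), hx]
          simp
      | z => rw [word_cons, hz, ih, dxWord, hz]
  have : derivative ∘ₗ evShift K Y = evShift K Y ∘ₗ dx K :=
    linearMap_ext_word K fun w => key w Y
  exact LinearMap.congr_fun this ψ

/-- In characteristic zero a polynomial in the shift is constant if and only if its derivative
vanishes. -/
theorem dx_eq_zero_iff [CharZero K] (ψ : Kxz K) :
    dx K ψ = 0 ↔ ∀ c Y, ev K ψ (Y.map (c + ·)) = ev K ψ Y := by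
  have h0 : ∀ Y : List K, Y.map ((0 : K) + ·) = Y := fun Y => by simp
  constructor
  · intro h c Y
    have hd := derivative_evShift K Y ψ
    rw [h, map_zero] at hd
    have hc := Polynomial.eq_C_of_derivative_eq_zero hd
    have h1 := eval_evShift K Y ψ c
    have h2 := eval_evShift K Y ψ 0
    rw [hc, Polynomial.eval_C] at h1 h2
    rw [← h1, h2, h0]
  · intro h
    refine ev_injective K _ fun Y => ?_
    have hc : evShift K Y ψ = Polynomial.C (ev K ψ Y) := Polynomial.funext fun c => by
      rw [eval_evShift, h, Polynomial.eval_C]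
    have hd := derivative_evShift K Y ψ
    rw [hc, Polynomial.derivative_C] at hd
    have := eval_evShift K Y (dx K ψ) 0
    rw [← hd, h0] at this
    simpa using this.symm

end Coproduct

section Relations

variable (K : Type*) [Field K]

/-! ### The relations in terms of values -/

variable {K} in
lemma exists_ofFn_eq_append {α : Type*} (u v : List α) :
    ∃ t : Fin (u.length + v.length) → α, List.ofFn t = u ++ v := by
  refine ⟨fun i => (u ++ v).get (i.cast (by simp)), List.ext_getElem (by simp) fun i h₁ h₂ => ?_⟩
  simp

lemma isHomogeneous_X {τ : Type*} (i : τ) :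
    (MvPolynomial.X i : MvPolynomial τ K).IsHomogeneous 1 := MvPolynomial.isHomogeneous_X K i

variable {M : Type*} [AddCommGroup M] [Module K M] (f : W K →ₗ[K] M)

/-- The value of the generating series of relations is a sum over shuffles of values of `pv` at the
differences of the variables. The target of `f` is arbitrary because the criterion serves both for
quotient maps and for the forms `pairW K ψ`. -/
theorem Wst_le_ker_iff [CharZero K] :
    Wst K ≤ LinearMap.ker f ↔
      ∀ d u v, u ≠ [] → v ≠ [] → shSum (pv (K := K) (fun l => f (gen K l)) d) u v = 0 := by
  have key : ∀ (p q d : ℕ) (t : Fin (p + q + 1) → K),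
      evalSeries d t (fun a => f ((∑ σ ∈ shuffles p q,
        colonSeries (gen K) (fun i => (MvPolynomial.X (σ.symm i).castSucc :
          MvPolynomial (Fin (p + q + 1)) K)) (MvPolynomial.X (Fin.last (p + q)))) a))
      = shSum (pv (K := K) (fun l => f (gen K l)) d)
          ((List.ofFn fun i : Fin (p + q) => t i.castSucc - t (Fin.last (p + q))).take p)
          ((List.ofFn fun i : Fin (p + q) => t i.castSucc - t (Fin.last (p + q))).drop p) := by
    intro p q d t
    rw [← sum_shuffles]
    have e : (fun a => f ((∑ σ ∈ shuffles p q,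
        colonSeries (gen K) (fun i => (MvPolynomial.X (σ.symm i).castSucc :
          MvPolynomial (Fin (p + q + 1)) K)) (MvPolynomial.X (Fin.last (p + q)))) a))
        = ∑ σ ∈ shuffles p q, colonSeries (fun l => f (gen K l))
          (fun i => (MvPolynomial.X (σ.symm i).castSucc :
          MvPolynomial (Fin (p + q + 1)) K)) (MvPolynomial.X (Fin.last (p + q))) := by
      funext a
      simp only [Finset.sum_apply, map_sum, map_colonSeries]
    rw [e, map_sum]
    refine Finset.sum_congr rfl fun σ _ => ?_
    rw [evalSeries_colonSeries _ _ _ _ _ (fun i => isHomogeneous_X K _) (isHomogeneous_X K _)]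
    simp
  constructor
  · intro h d u v hu hv
    obtain ⟨t, ht⟩ := exists_ofFn_eq_append u v
    -- With the last variable at 0 the differences are the arbitrary entries of u and v.
    have := key u.length v.length d (Fin.snoc (α := fun _ => K) t 0)
    simp only [Fin.snoc_castSucc, Fin.snoc_last, sub_zero, ht, List.take_left', List.drop_left'] at this
    rw [← this, evalSeries_apply]
    refine Finset.sum_eq_zero fun a _ => ?_
    rw [LinearMap.mem_ker.1 (h (Submodule.subset_span ⟨u.length, v.length,
      List.length_pos_of_ne_nil hu, List.length_pos_of_ne_nil hv, a, rfl⟩)), smul_zero]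
  · intro h
    rw [Wst, Submodule.span_le]
    rintro _ ⟨p, q, hp, hq, a, rfl⟩
    rw [SetLike.mem_coe, LinearMap.mem_ker]
    refine series_eq_zero_of_value (K := K) (fun a => f ((∑ σ ∈ shuffles p q,
        colonSeries (gen K) (fun i => (MvPolynomial.X (σ.symm i).castSucc :
          MvPolynomial (Fin (p + q + 1)) K)) (MvPolynomial.X (Fin.last (p + q)))) a)) ?_ a
    intro d t
    rw [key]
    apply h
    · rw [← List.length_pos_iff_ne_nil]; simp; omega
    · rw [← List.length_pos_iff_ne_nil]; simp; omega

/-- The same argument as for `Wst_le_ker_iff`, the entries being now the partial sums of the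
shuffled list. -/
theorem Wsh_le_ker_iff [CharZero K] :
    Wsh K ≤ LinearMap.ker f ↔
      ∀ d u v, u ≠ [] → v ≠ [] →
        shSum (fun l : List K => pv (fun l => f (gen K l)) d (psum l)) u v = 0 := by
  have key : ∀ (p q d : ℕ) (t : Fin (p + q) → K),
      evalSeries d t (fun a => f ((∑ σ ∈ shuffles p q,
        commaSeries (gen K) (fun i => (MvPolynomial.X (σ.symm i) :
          MvPolynomial (Fin (p + q)) K))) a))
      = shSum (fun l : List K => pv (fun l => f (gen K l)) d (psum l))
          ((List.ofFn t).take p) ((List.ofFn t).drop p) := by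
    intro p q d t
    rw [← sum_shuffles]
    have e : (fun a => f ((∑ σ ∈ shuffles p q,
        commaSeries (gen K) (fun i => (MvPolynomial.X (σ.symm i) :
          MvPolynomial (Fin (p + q)) K))) a))
        = ∑ σ ∈ shuffles p q, commaSeries (fun l => f (gen K l))
          (fun i => (MvPolynomial.X (σ.symm i) : MvPolynomial (Fin (p + q)) K)) := by
      funext a
      simp only [Finset.sum_apply, map_sum, commaSeries, map_colonSeries]
    rw [e, map_sum]
    refine Finset.sum_congr rfl fun σ _ => ?_
    rw [commaSeries, evalSeries_colonSeries _ _ _ _ _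
      (fun i => MvPolynomial.IsHomogeneous.sum _ _ _ fun j _ => isHomogeneous_X K _)
      (MvPolynomial.isHomogeneous_zero _ _ _), psum_ofFn]
    simp
  constructor
  · intro h d u v hu hv
    obtain ⟨t, ht⟩ := exists_ofFn_eq_append u v
    have := key u.length v.length d t
    simp only [ht, List.take_left', List.drop_left'] at this
    rw [← this, evalSeries_apply]
    refine Finset.sum_eq_zero fun a _ => ?_
    rw [LinearMap.mem_ker.1 (h (Submodule.subset_span ⟨u.length, v.length,
      List.length_pos_of_ne_nil hu, List.length_pos_of_ne_nil hv, a, rfl⟩)), smul_zero]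
  · intro h
    rw [Wsh, Submodule.span_le]
    rintro _ ⟨p, q, hp, hq, a, rfl⟩
    rw [SetLike.mem_coe, LinearMap.mem_ker]
    refine series_eq_zero_of_value (K := K) (fun a => f ((∑ σ ∈ shuffles p q,
        commaSeries (gen K) (fun i => (MvPolynomial.X (σ.symm i) :
          MvPolynomial (Fin (p + q)) K))) a)) ?_ a
    intro d t
    rw [key]
    apply h
    · rw [← List.length_pos_iff_ne_nil]; simp; omega
    · rw [← List.length_pos_iff_ne_nil]; simp; omega

/-- Changing the sign of all variables multiplies the degree `d` part by (-1)^d. The relation is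
then empty in even degree and is twice the series in odd degree. -/
theorem distRel_le_ker_iff [CharZero K] :
    distRel K ≤ LinearMap.ker f ↔
      ∀ d ts, ts ≠ [] → Odd d → pv (K := K) (fun l => f (gen K l)) d ts = 0 := by
  have key : ∀ (m d : ℕ) (t : Fin (m + 1) → K),
      evalSeries d t (fun a => f (colonSeries (gen K) (fun i : Fin m => (MvPolynomial.X i.castSucc :
          MvPolynomial (Fin (m + 1)) K)) (MvPolynomial.X (Fin.last m)) a
        - colonSeries (gen K) (fun i : Fin m => (-MvPolynomial.X i.castSucc :
          MvPolynomial (Fin (m + 1)) K)) (-MvPolynomial.X (Fin.last m)) a))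
      = (1 - (-1 : K) ^ d) • pv (K := K) (fun l => f (gen K l)) d
          (List.ofFn fun i : Fin m => t i.castSucc - t (Fin.last m)) := by
    intro m d t
    have e : (fun a => f (colonSeries (gen K) (fun i : Fin m => (MvPolynomial.X i.castSucc :
          MvPolynomial (Fin (m + 1)) K)) (MvPolynomial.X (Fin.last m)) a
        - colonSeries (gen K) (fun i : Fin m => (-MvPolynomial.X i.castSucc :
          MvPolynomial (Fin (m + 1)) K)) (-MvPolynomial.X (Fin.last m)) a))
        = colonSeries (fun l => f (gen K l)) (fun i : Fin m => (MvPolynomial.X i.castSucc :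
          MvPolynomial (Fin (m + 1)) K)) (MvPolynomial.X (Fin.last m))
        - colonSeries (fun l => f (gen K l)) (fun i : Fin m => (-MvPolynomial.X i.castSucc :
          MvPolynomial (Fin (m + 1)) K)) (-MvPolynomial.X (Fin.last m)) := by
      funext a
      simp only [map_sub, map_colonSeries, Pi.sub_apply]
    rw [e, map_sub,
      evalSeries_colonSeries _ _ _ _ _ (fun i => isHomogeneous_X K _) (isHomogeneous_X K _),
      evalSeries_colonSeries _ _ _ _ _ (fun i => (isHomogeneous_X K _).neg)
        (isHomogeneous_X K _).neg, sub_smul, one_smul, ← pv_map_mul, List.map_ofFn]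
    congr 3
    · simp
    · funext i
      simp only [Function.comp_apply, map_neg, MvPolynomial.eval_X]
      ring
  constructor
  · intro h d ts hts hd
    have := key ts.length d (Fin.snoc (α := fun _ => K) ts.get 0)
    simp only [Fin.snoc_castSucc, Fin.snoc_last, sub_zero, List.ofFn_get, hd.neg_one_pow] at this
    rw [evalSeries_apply, Finset.sum_eq_zero] at this
    · simpa [show (1 : K) + 1 ≠ 0 by norm_num] using this.symm
    · intro a _
      rw [LinearMap.mem_ker.1 (h (Submodule.subset_span ⟨ts.length,
        List.length_pos_of_ne_nil hts, a, rfl⟩)), smul_zero]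
  · intro h
    rw [distRel, Submodule.span_le]
    rintro _ ⟨m, hm, a, rfl⟩
    rw [SetLike.mem_coe, LinearMap.mem_ker]
    refine series_eq_zero_of_value (K := K) (fun a => f (colonSeries (gen K)
        (fun i : Fin m => (MvPolynomial.X i.castSucc :
          MvPolynomial (Fin (m + 1)) K)) (MvPolynomial.X (Fin.last m)) a
        - colonSeries (gen K) (fun i : Fin m => (-MvPolynomial.X i.castSucc :
          MvPolynomial (Fin (m + 1)) K)) (-MvPolynomial.X (Fin.last m)) a)) ?_ a
    intro d t
    rw [key]
    rcases Nat.even_or_odd d with hd | hd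
    · simp [hd.neg_one_pow]
    · rw [h _ _ _ hd, smul_zero]
      rw [← List.length_pos_iff_ne_nil]; simp; omega

lemma pv_singleton {M : Type*} [AddCommGroup M] [Module K M] (I : List ℕ+ → M) (d : ℕ) (t : K) :
    pv I d [t] = t ^ d • I [d.succPNat] := by
  have := pv_ofFn I d (fun _ : Fin 1 => t)
  simpa [Finset.Nat.antidiagonalTuple_one] using this

lemma pv_map_neg {M : Type*} [AddCommGroup M] [Module K M] (I : List ℕ+ → M) (d : ℕ)
    (ts : List K) : pv I d (ts.map fun s => -s) = (-1 : K) ^ d • pv I d ts := by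
  rw [← pv_map_mul]
  simp

/-- The relations of the dihedral coalgebra are the relations `W_R`. -/
theorem dihedralRel_eq [CharZero K] : dihedralRel K = WR K := by
  have hmk : ∀ (S T : Submodule K (W K)), S ≤ T → S ≤ LinearMap.ker T.mkQ := fun S T h => by
    rwa [Submodule.ker_mkQ]
  apply le_antisymm
  · have h1 := (Wst_le_ker_iff K (WR K).mkQ).1 (hmk _ _ (le_sup_left.trans le_sup_left))
    have h2 := (Wsh_le_ker_iff K (WR K).mkQ).1 (hmk _ _ (le_sup_right.trans le_sup_left))
    refine sup_le le_sup_left ?_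
    rw [← Submodule.ker_mkQ (WR K), distRel_le_ker_iff]
    intro d ts hts hd
    -- In depth 1, odd degree `d` is the generator of even weight d + 1. In depth at least 2 the
    -- parity theorem applies in the quotient.
    rcases ts with _ | ⟨a, _ | ⟨b, ts⟩⟩
    · exact absurd rfl hts
    · rw [pv_singleton]
      have : (WR K).mkQ (gen K [d.succPNat]) = 0 := by
        rw [Submodule.mkQ_apply, Submodule.Quotient.mk_eq_zero]
        refine (le_sup_right : WoneEven K ≤ _) (Submodule.subset_span ⟨_, ?_, rfl⟩)
        rw [Nat.succPNat_coe]
        exact hd.add_one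
      rw [this, smul_zero]
    · refine parity_of_double_shuffle _ (h1 d) (h2 d) (fun l => ?_) a b ts
      rw [pv_map_neg, hd.neg_one_pow]
      simp
  -- Conversely, the generators of even weight are distribution relations in depth 1, read off at
  -- the value 1 of the variable.
  · refine sup_le le_sup_left ?_
    have h := (distRel_le_ker_iff K (dihedralRel K).mkQ).1 (hmk _ _ le_sup_right)
    rw [WoneEven, Submodule.span_le]
    rintro _ ⟨n, hn, rfl⟩
    have := h n.natPred [1] (by simp) (by
      rw [← PNat.natPred_add_one n, Nat.even_add_one, Nat.not_even_iff_odd] at hn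
      exact hn)
    rw [pv_singleton, one_pow, one_smul, PNat.succPNat_natPred] at this
    simpa using this

/-! ### The orthogonal of `F` -/

lemma pairing_word_left {X : Type*} [DecidableEq X] (w : List X) (ψ : FreeAlgebra K X) :
    pairing K X (word K w) ψ = (wordBasis K X).repr ψ w := by
  have : pairing K X (word K w) = (wordBasis K X).coord w :=
    linearMap_ext_word K fun v => by
      rw [← wordBasis_apply, ← wordBasis_apply, pairing, Module.Basis.toDual_apply,
        Module.Basis.coord_apply, Module.Basis.repr_self, Finsupp.single_apply]
      simp [eq_comm]
  rw [this]
  rfl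

lemma repr_piMap (ψ : Kxz K) (l : List ℕ+) :
    (wordBasis K ℕ+).repr (piMap K ψ) l = pairing K XZ (word K (blockWord l)) ψ := by
  have : (wordBasis K ℕ+).coord l ∘ₗ piMap K = pairing K XZ (word K (blockWord l)) :=
    linearMap_ext_word K fun w => by
      have hw := parse_spec 0 w
      rw [List.replicate_zero, List.nil_append] at hw
      rw [pairing_word, LinearMap.comp_apply, ← wordBasis_apply, piMap, Module.Basis.constr_basis]
      by_cases h : (parse 0 w).2 = 0
      · rw [if_pos h, ← wordBasis_apply, Module.Basis.coord_apply, Module.Basis.repr_self,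
          Finsupp.single_apply]
        rw [h, List.replicate_zero, List.append_nil] at hw
        congr 1
        refine propext ⟨?_, ?_⟩
        · rintro rfl; exact hw
        · intro e
          have := parse_blockWord l 0
          rw [List.replicate_zero, List.append_nil, e] at this
          rw [this]
      · rw [if_neg h, map_zero, if_neg]
        intro e
        apply h
        have := parse_blockWord l 0
        rw [List.replicate_zero, List.append_nil, e] at this
        rw [this]
  exact LinearMap.congr_fun this ψ

/-- The linear form `w ↦ ⟨φ(w), ψ⟩` on `W`. -/
def pairW (ψ : Kxz K) : W K →ₗ[K] K := (pairing K XZ).flip ψ ∘ₗ phi K ∘ₗ LinearMap.inl K (W K) (U K)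

lemma pairW_apply (ψ : Kxz K) (w : W K) : pairW K ψ w = pairing K XZ (phi K (w, 0)) ψ := rfl

lemma pairW_gen (ψ : Kxz K) (l : List ℕ+) (hl : l ≠ []) :
    pairW K ψ (gen K l) = pairing K XZ (word K (blockWord l.reverse)) ψ := by
  rw [pairW_apply, gen, dif_pos hl, phi]
  simp

/-- The index list is reversed because φ writes n_m first. Orthogonality to 1 makes the formula hold
for the empty list as well, where `gen` is 0 by convention. -/
lemma pairW_gen' (ψ : Kxz K) (h0 : pairing K XZ 1 ψ = 0) (l : List ℕ+) :
    pairW K ψ (gen K l) = (wordBasis K ℕ+).repr (piMap K ψ) l.reverse := by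
  rw [repr_piMap]
  by_cases hl : l = []
  · subst hl
    rw [gen, dif_neg (by simp), map_zero, List.reverse_nil]
    exact h0.symm
  · exact pairW_gen K ψ l hl

/-- Relations that commute with homotheties hold for the homogeneous components if and only if
they hold for the sum of the components. -/
theorem shSum_pv_iff [CharZero K] (Ψ : KY K) (h : List K → List K)
    (hh : ∀ (c : K) l, h (l.map (c * ·)) = (h l).map (c * ·)) :
    (∀ d u v, u ≠ [] → v ≠ [] →
      shSum (fun l => pv (fun l => (wordBasis K ℕ+).repr Ψ l.reverse) d (h l)) u v = 0) ↔
    ∀ u v, u ≠ [] → v ≠ [] → shSum (fun l => evY K Ψ (h l).reverse) u v = 0 := by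
  obtain ⟨N, hN, hs⟩ := exists_sum_pv K Ψ
  constructor
  · intro H u v hu hv
    simp only [← hs]
    rw [shSum_sum]
    exact Finset.sum_eq_zero fun d _ => H d u v hu hv
  · intro H d u v hu hv
    by_cases hd : N ≤ d
    · exact shSum_eq_zero fun l _ => hN d hd _
    -- The relations for the rescaled lists say that the combination of the degree `d` sums with
    -- coefficients r^d vanishes for all `r`.
    · refine eq_zero_of_sum_homogeneous K N (fun d =>
        shSum (fun l => pv (fun l => (wordBasis K ℕ+).repr Ψ l.reverse) d (h l)) u v)
        (fun r => ?_) d (by omega)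
      have := H (u.map (r * ·)) (v.map (r * ·)) (by simpa using hu) (by simpa using hv)
      simp only [← hs] at this
      rw [shSum_sum] at this
      rw [← this]
      refine Finset.sum_congr rfl fun d _ => ?_
      rw [← shSum_map, ← shSum_smul]
      simp only [hh, pv_map_mul]

lemma psum_map_mul (c : K) (l : List K) : psum (l.map (c * ·)) = (psum l).map (c * ·) := by
  have : ∀ (b : K), psumFrom (c * b) (l.map (c * ·)) = (psumFrom b l).map (c * ·) := by
    induction l with
    | nil => simp [psumFrom]
    | cons a l ih =>
      intro b
      simp only [List.map_cons, psumFrom, ← mul_add, ih]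
  simpa [psum] using this 0

/-- The reversal in φ only replaces shuffles of `u` and `v` by shuffles of the reversed lists. -/
theorem Wst_le_ker_pairW_iff [CharZero K] (ψ : Kxz K) (h0 : pairing K XZ 1 ψ = 0) :
    Wst K ≤ LinearMap.ker (pairW K ψ) ↔
      ∀ u v, u ≠ [] → v ≠ [] → shSum (evY K (piMap K ψ)) u v = 0 := by
  rw [Wst_le_ker_iff]
  simp only [pairW_gen' K ψ h0]
  have := shSum_pv_iff K (piMap K ψ) id (fun _ _ => rfl)
  simp only [id] at this
  rw [this]
  constructor
  · intro h u v hu hv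
    have := h u.reverse v.reverse (by simpa using hu) (by simpa using hv)
    rw [shSum_reverse] at this
    simpa using this
  · intro h u v hu hv
    rw [shSum_reverse]
    exact h _ _ (by simpa using hu) (by simpa using hv)

/-- The partial sums, reversed by φ and completed by the last variable 0, are the suffix sums of the
reversed list. These are the variables in which primitivity for Δ is expressed. -/
theorem Wsh_le_ker_pairW_iff [CharZero K] (ψ : Kxz K) (h0 : pairing K XZ 1 ψ = 0) :
    Wsh K ≤ LinearMap.ker (pairW K ψ) ↔
      ∀ u v, u ≠ [] → v ≠ [] → shSum (fun l => ev K ψ (sufsum l)) u v = 0 := by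
  rw [Wsh_le_ker_iff]
  simp only [pairW_gen' K ψ h0]
  rw [shSum_pv_iff K (piMap K ψ) psum (psum_map_mul K)]
  have e : ∀ l : List K, evY K (piMap K ψ) (psum l).reverse = ev K ψ (sufsum l.reverse) := by
    intro l
    rw [evY_piMap, sufsum_eq_reverse, List.reverse_reverse]
  simp only [e]
  constructor
  · intro h u v hu hv
    have := h u.reverse v.reverse (by simpa using hu) (by simpa using hv)
    rw [shSum_reverse (fun l => ev K ψ (sufsum l))] at this
    simpa using this
  · intro h u v hu hv
    rw [shSum_reverse (fun l => ev K ψ (sufsum l))]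
    exact h _ _ (by simpa using hu) (by simpa using hv)

lemma count_blockWord (l : List ℕ+) (k : ℕ) :
    (blockWord l ++ List.replicate k XZ.x).count XZ.z = l.length := by
  have hr : ∀ k, (List.replicate k XZ.x).count XZ.z = 0 := fun k => by
    simp [List.count_replicate]
  induction l with
  | nil => simp [blockWord, hr]
  | cons n l ih =>
    have h : blockWord (n :: l) ++ List.replicate k XZ.x
        = List.replicate n.natPred XZ.x ++ XZ.z :: (blockWord l ++ List.replicate k XZ.x) := by
      simp [blockWord]
    rw [h, List.count_append, hr, List.count_cons_self, ih]
    simp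

lemma listWeight_cons (n : ℕ+) (l : List ℕ+) : listWeight (n :: l) = n + listWeight l := by
  simp [listWeight]

lemma length_blockWord (l : List ℕ+) (k : ℕ) :
    (blockWord l ++ List.replicate k XZ.x).length = listWeight l + k := by
  induction l with
  | nil => simp [blockWord, listWeight]
  | cons n l ih =>
    have h : blockWord (n :: l) ++ List.replicate k XZ.x
        = List.replicate n.natPred XZ.x ++ XZ.z :: (blockWord l ++ List.replicate k XZ.x) := by
      simp [blockWord]
    have hn := PNat.natPred_add_one n
    rw [h, List.length_append, List.length_cons, ih]
    rw [List.length_replicate, listWeight_cons]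
    omega

lemma exists_blockWord (w : List XZ) :
    ∃ l k, w = blockWord l ++ List.replicate k XZ.x :=
  ⟨(parse 0 w).1, (parse 0 w).2, by simpa using (parse_spec 0 w).symm⟩

theorem dx_eq_zero_iff_orth (ψ : Kxz K) :
    dx K ψ = 0 ↔ ∀ i : ℕ+ × List ℕ+, pairing K XZ (phiU K (some i)) ψ = 0 := by
  have h : ∀ i : ℕ+ × List ℕ+, pairing K XZ (phiU K (some i)) ψ = (wordBasis K XZ).repr (dx K ψ)
      (blockWord i.2.reverse ++ List.replicate i.1.natPred XZ.x) := by
    rintro ⟨n, l⟩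
    rw [phiU, shuffle_word, pairing_shuffleWord_x, pairing_word_left]
  simp only [h]
  constructor
  · intro h i
    simp [h]
  · intro h
    apply (wordBasis K XZ).repr.injective
    ext w
    obtain ⟨l, k, rfl⟩ := exists_blockWord w
    simpa using h (k.succPNat, l.reverse)

lemma ev_eq_sum (ψ : Kxz K) (Y : List K) :
    ev K ψ Y = ∑ w ∈ ((wordBasis K XZ).repr ψ).support, (wordBasis K XZ).repr ψ w * mon w Y := by
  have e := (wordBasis K XZ).linearCombination_repr ψ
  rw [Finsupp.linearCombination_apply, Finsupp.sum] at e
  have hev := congrArg (evAt K Y) e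
  simp only [map_sum, map_smul, wordBasis_apply, evAt_apply, ev_word, smul_eq_mul] at hev
  exact hev.symm

/-- `ls` is the orthogonal of `φ(F)`. -/
theorem mem_ls_iff [CharZero K] (ψ : Kxz K) :
    ψ ∈ ls K ↔ ∀ v ∈ F K, pairing K XZ (phi K v) ψ = 0 := by
  have hU : ∀ i : UIndex, phi K (0, Finsupp.single i 1) = phiU K i := fun i => by simp [phi]
  have hdepth0 : (∀ w : List XZ, w.count XZ.z = 0 → (wordBasis K XZ).repr ψ w = 0) →
      ∀ y, ev K ψ [y] = 0 := by
    intro h y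
    rw [ev_eq_sum]
    refine Finset.sum_eq_zero fun w _ => ?_
    by_cases hw : w.count XZ.z = 0
    · rw [h w hw, zero_mul]
    · rw [mon_eq_zero, mul_zero]
      simp only [List.length_singleton, ne_eq]
      omega
  constructor
  · rintro ⟨h1, h2, h3, h4⟩
    have h0 : pairing K XZ 1 ψ = 0 := by
      rw [← word_nil, pairing_word_left]
      exact h3 [] (by simp)
    obtain ⟨ht, hs⟩ := (primitive_iff K ψ (hdepth0 h3)).1 h1
    have hWR : WR K ≤ LinearMap.ker (pairW K ψ) := by
      refine sup_le (sup_le ((Wst_le_ker_pairW_iff K ψ h0).2 ((primitiveY_iff K _).1 h2).2)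
        ((Wsh_le_ker_pairW_iff K ψ h0).2 hs)) ?_
      rw [WoneEven, Submodule.span_le]
      rintro _ ⟨n, hn, rfl⟩
      rw [SetLike.mem_coe, LinearMap.mem_ker, pairW_gen _ _ _ (by simp), pairing_word_left]
      have e1 := count_blockWord [n] 0
      have e2 := length_blockWord [n] 0
      rw [List.replicate_zero, List.append_nil] at e1 e2
      refine h4 _ (by simpa using e1) ?_
      rw [List.reverse_singleton, e2]
      simpa [listWeight] using hn
    have hUz : (pairing K XZ).flip ψ ∘ₗ phi K ∘ₗ LinearMap.inr K (W K) (U K) = 0 := by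
      refine Finsupp.lhom_ext' fun i => LinearMap.ext_ring ?_
      change pairing K XZ (phi K (0, Finsupp.single i 1)) ψ = 0
      rw [hU]
      rcases i with _ | i
      · exact h0
      · exact (dx_eq_zero_iff_orth K ψ).1 ((dx_eq_zero_iff K ψ).2 ht) i
    rintro ⟨w, u⟩ hv
    have hw : w ∈ WR K := hv.1
    have e : ((w, u) : V K) = (w, 0) + (0, u) := by simp
    rw [e, map_add, map_add, LinearMap.add_apply]
    have a1 : pairing K XZ (phi K (w, 0)) ψ = 0 := hWR hw
    have a2 : pairing K XZ (phi K (0, u)) ψ = 0 := LinearMap.congr_fun hUz u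
    rw [a1, a2, add_zero]
  · intro h
    have hu : ∀ i, pairing K XZ (phiU K i) ψ = 0 := fun i => by
      rw [← hU]
      exact h _ ⟨(WR K).zero_mem, trivial⟩
    have h0 : pairing K XZ 1 ψ = 0 := hu none
    have hW : WR K ≤ LinearMap.ker (pairW K ψ) := fun w hw => h (w, 0) ⟨hw, trivial⟩
    have hdx := (dx_eq_zero_iff_orth K ψ).2 fun i => hu (some i)
    have ht := (dx_eq_zero_iff K ψ).1 hdx
    have hst := (Wst_le_ker_pairW_iff K ψ h0).1 ((le_sup_left.trans le_sup_left).trans hW)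
    have hsh := (Wsh_le_ker_pairW_iff K ψ h0).1 ((le_sup_right.trans le_sup_left).trans hW)
    -- Depth 0: x^k shuffled with x is (k+1) x^{k+1}, so orthogonality to φ(U) kills every power of
    -- x; the constant term is killed by I'(0).
    have h3 : ∀ w : List XZ, w.count XZ.z = 0 → (wordBasis K XZ).repr ψ w = 0 := by
      intro w hw
      obtain ⟨l, k, rfl⟩ := exists_blockWord w
      rw [count_blockWord, List.length_eq_zero_iff] at hw
      subst hw
      rw [← pairing_word_left]
      rcases k with _ | k
      · exact h0
      · have := pairing_shuffleWord_x K (List.replicate k XZ.x) ψ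
        rw [hdx, map_zero, shuffleWord_replicate, map_smul, LinearMap.smul_apply, smul_eq_mul,
          mul_eq_zero] at this
        rcases this with h | h
        · exact absurd h (Nat.cast_add_one_ne_zero k)
        · simpa [blockWord] using h
    refine ⟨(primitive_iff K ψ (hdepth0 h3)).2 ⟨ht, hsh⟩, (primitiveY_iff K _).2 ⟨?_, hst⟩, h3, ?_⟩
    · rw [evY_piMap]
      exact hdepth0 h3 0
    · intro w hw he
      obtain ⟨l, k, rfl⟩ := exists_blockWord w
      rw [count_blockWord, List.length_eq_one_iff] at hw
      obtain ⟨n, rfl⟩ := hw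
      rw [length_blockWord] at he
      rw [← pairing_word_left]
      -- Depth 1: the vanishing of `dx K ψ` ties the coefficient of x^{n-1} z x^{k+1} to that of x^n
      -- z x^k, a word of the same weight. The trailing x are removed one by one until the relation
      -- I(2n) applies.
      induction k generalizing n with
      | zero =>
        have hg : gen K [n] ∈ WR K :=
          (le_sup_right : WoneEven K ≤ _) (Submodule.subset_span ⟨n, by simpa [listWeight] using he, rfl⟩)
        have := hW hg
        rw [LinearMap.mem_ker, pairW_gen _ _ _ (by simp)] at this
        simpa using this
      | succ k ih =>
        have h1 := pairing_shuffleWord_x K (blockWord [n] ++ List.replicate k XZ.x) ψ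
        rw [hdx, map_zero, ← shuffle_word, shuffle_blockWord] at h1
        have h2 := ih (n + 1) (by
          have : listWeight [n + 1] + k = listWeight [n] + (k + 1) := by
            simp [listWeight]; omega
          rwa [this])
        simp only [raise, map_zero, add_zero, map_smul, toWords, Finsupp.linearCombination_single,
          one_smul, map_add, LinearMap.add_apply, LinearMap.smul_apply, h2] at h1
        rw [smul_zero, zero_add, smul_eq_mul, mul_eq_zero] at h1
        rcases h1 with h | h
        · exact absurd h (Nat.cast_add_one_ne_zero k)
        · exact h

end Relations

section Ihara

variable (K : Type*) [Field K]

/-! ### Bigraded components of `K⟨x,z⟩` -/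

lemma mem_xzGrading_iff {p : ℕ × ℕ} {a : Kxz K} :
    a ∈ xzGrading K p ↔
      ∀ w, (wordBasis K XZ).repr a w ≠ 0 → w.count XZ.z = p.1 ∧ w.length = p.2 := by
  have : (word K : List XZ → Kxz K) = wordBasis K XZ := funext fun w => (wordBasis_apply K w).symm
  rw [xzGrading, this, Module.Basis.mem_span_image]
  simp [Set.subset_def]

lemma word_mem_xzGrading (w : List XZ) : word K w ∈ xzGrading K (w.count XZ.z, w.length) :=
  Submodule.subset_span ⟨w, ⟨rfl, rfl⟩, rfl⟩

lemma mul_mem_xzGrading {p q : ℕ × ℕ} {a b : Kxz K} (ha : a ∈ xzGrading K p)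
    (hb : b ∈ xzGrading K q) : a * b ∈ xzGrading K (p + q) := by
  have h := Submodule.mul_mem_mul ha hb
  rw [xzGrading, xzGrading, Submodule.span_mul_span] at h
  refine Submodule.span_mono ?_ h
  rintro _ ⟨_, ⟨u, ⟨hu, hu'⟩, rfl⟩, _, ⟨v, ⟨hv, hv'⟩, rfl⟩, rfl⟩
  exact ⟨u ++ v, ⟨by simp [hu, hv], by simp [hu', hv']⟩, word_append K u v⟩

lemma x_mem_xzGrading : FreeAlgebra.ι K XZ.x ∈ xzGrading K (0, 1) := by
  have := word_mem_xzGrading K [XZ.x]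
  simpa [word] using this

lemma z_mem_xzGrading : FreeAlgebra.ι K XZ.z ∈ xzGrading K (1, 1) := by
  have := word_mem_xzGrading K [XZ.z]
  simpa [word] using this

lemma der_mem_xzGrading {p q : ℕ × ℕ} {a b : Kxz K} (ha : a ∈ xzGrading K p)
    (hb : b ∈ xzGrading K q) : der K a b ∈ xzGrading K (p + q) := by
  have key : ∀ v : List XZ, der K a (word K v) ∈ xzGrading K (p + (v.count XZ.z, v.length)) := by
    intro v
    rw [der_word]
    induction v with
    | nil => simp [derWord]
    | cons c v ih =>
      cases c with
      | x =>
        have h := mul_mem_xzGrading K (x_mem_xzGrading K) ih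
        have e : p + ((XZ.x :: v).count XZ.z, (XZ.x :: v).length)
            = (0, 1) + (p + (v.count XZ.z, v.length)) := by
          ext
          · simp
          · simp; omega
        rw [e]
        simpa [derWord] using h
      | z =>
        have e : p + ((XZ.z :: v).count XZ.z, (XZ.z :: v).length)
            = (1, 1) + (p + (v.count XZ.z, v.length)) := by
          ext <;> simp <;> omega
        have h := mul_mem_xzGrading K (z_mem_xzGrading K) ih
        have h1 := mul_mem_xzGrading K (mul_mem_xzGrading K (z_mem_xzGrading K) ha)
          (word_mem_xzGrading K v)
        have h2 := mul_mem_xzGrading K (mul_mem_xzGrading K ha (z_mem_xzGrading K))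
          (word_mem_xzGrading K v)
        rw [add_assoc] at h1
        rw [add_comm p, add_assoc] at h2
        rw [e]
        simp only [derWord, LinearMap.comp_apply, LinearMap.add_apply,
          LinearMap.mulLeft_apply, LinearMap.mulRight_apply, LinearMap.sub_apply, sub_mul]
        exact Submodule.add_mem _ (Submodule.sub_mem _ h1 h2) h
  refine Submodule.span_induction (p := fun b _ => der K a b ∈ xzGrading K (p + q)) ?_ ?_ ?_ ?_ hb
  · rintro _ ⟨v, ⟨h1, h2⟩, rfl⟩
    have := key v
    rwa [h1, h2] at this
  · simp
  · intro x y _ _ hx hy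
    rw [map_add]
    exact Submodule.add_mem _ hx hy
  · intro c x _ hx
    rw [map_smul]
    exact Submodule.smul_mem _ c hx

lemma ihara_mem_xzGrading {p q : ℕ × ℕ} {a b : Kxz K} (ha : a ∈ xzGrading K p)
    (hb : b ∈ xzGrading K q) : ihara K a b ∈ xzGrading K (p + q) := by
  have h1 := der_mem_xzGrading K ha hb
  have h2 := der_mem_xzGrading K hb ha
  have h3 := mul_mem_xzGrading K ha hb
  have h4 := mul_mem_xzGrading K hb ha
  rw [add_comm] at h2 h4
  rw [ihara_apply]
  exact Submodule.add_mem _ (Submodule.sub_mem _ h1 h2) (Submodule.sub_mem _ h3 h4)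

lemma ev_eq_zero_of_mem {p : ℕ × ℕ} {a : Kxz K} (ha : a ∈ xzGrading K p) (Y : List K)
    (hY : Y.length ≠ p.1 + 1) : ev K a Y = 0 := by
  rw [ev_eq_sum]
  refine Finset.sum_eq_zero fun w hw => ?_
  rw [Finsupp.mem_support_iff] at hw
  rw [mon_eq_zero, mul_zero]
  rwa [((mem_xzGrading_iff K).1 ha w hw).1]

lemma count_x_add_count_z (w : List XZ) : w.count XZ.x + w.count XZ.z = w.length := by
  induction w with
  | nil => rfl
  | cons a w ih => cases a <;> simp <;> omega

lemma ev_map_mul {p : ℕ × ℕ} {a : Kxz K} (ha : a ∈ xzGrading K p) (c : K) (Y : List K) :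
    ev K a (Y.map (c * ·)) = c ^ (p.2 - p.1) * ev K a Y := by
  rw [ev_eq_sum, ev_eq_sum, Finset.mul_sum]
  refine Finset.sum_congr rfl fun w hw => ?_
  rw [Finsupp.mem_support_iff] at hw
  obtain ⟨h1, h2⟩ := (mem_xzGrading_iff K).1 ha w hw
  have := count_x_add_count_z w
  rw [mon_map_mul, show w.count XZ.x = p.2 - p.1 by omega]
  ring

/-! ### Values of the Ihara bracket -/

/-- In a product of words the last block of the first and the first block of the second merge, so
the two polynomials share the variable in position `p.1`. -/
lemma ev_mul {p : ℕ × ℕ} {a : Kxz K} (ha : a ∈ xzGrading K p) (b : Kxz K) (Y : List K) :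
    ev K (a * b) Y = ev K a (Y.take (p.1 + 1)) * ev K b (Y.drop p.1) := by
  have key : ∀ (u : List XZ) (Y : List K), ev K (word K u * b) Y
      = ev K (word K u) (Y.take (u.count XZ.z + 1)) * ev K b (Y.drop (u.count XZ.z)) := by
    intro u
    induction u with
    | nil =>
      intro Y
      rw [word_nil, one_mul, ev_one]
      cases Y with
      | nil => simp [ev_nil]
      | cons y Y => simp
    | cons c u ih =>
      intro Y
      rw [word_cons, mul_assoc]
      cases c with
      | x =>
        rw [ev_x_mul, ev_x_mul, ih]
        cases Y with
        | nil => simp [ev_nil]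
        | cons y Y => simp [mul_assoc]
      | z =>
        rw [ev_z_mul, ev_z_mul, ih]
        cases Y with
        | nil => simp [ev_nil]
        | cons y Y => simp
  refine Submodule.span_induction (p := fun a _ => ev K (a * b) Y
      = ev K a (Y.take (p.1 + 1)) * ev K b (Y.drop p.1)) ?_ ?_ ?_ ?_ ha
  · rintro _ ⟨u, ⟨h1, _⟩, rfl⟩
    rw [key, h1]
  · simp
  · intro x y _ _ hx hy
    rw [add_mul, map_add, map_add, Pi.add_apply, Pi.add_apply, hx, hy, add_mul]
  · intro c x _ hx
    rw [smul_mul_assoc, map_smul, map_smul, Pi.smul_apply, Pi.smul_apply, hx, smul_mul_assoc]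

/-- The derivation replaces one `z` of `b`, say that between blocks i and i+1, by za - az. In za the
entries given to `a` end with the one shared with block i+1 of `b`; in az they start with the one
shared with block i. -/
lemma ev_der {p : ℕ × ℕ} {a : Kxz K} (ha : a ∈ xzGrading K p) (b : Kxz K) (Y : List K) :
    ev K (der K a b) Y = ∑ i ∈ Finset.range (Y.length - 1 - p.1),
      (ev K a ((Y.drop (i + 1)).take (p.1 + 1)) - ev K a ((Y.drop i).take (p.1 + 1))) *
        ev K b (Y.take (i + 1) ++ Y.drop (i + 1 + p.1)) := by
  have key : ∀ (v : List XZ) (Y : List K), ev K (der K a (word K v)) Y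
      = ∑ i ∈ Finset.range (Y.length - 1 - p.1),
      (ev K a ((Y.drop (i + 1)).take (p.1 + 1)) - ev K a ((Y.drop i).take (p.1 + 1))) *
        ev K (word K v) (Y.take (i + 1) ++ Y.drop (i + 1 + p.1)) := by
    intro v
    simp only [der_word]
    induction v with
    | nil =>
      intro Y
      rw [derWord, LinearMap.zero_apply, map_zero, Pi.zero_apply]
      symm
      refine Finset.sum_eq_zero fun i hi => ?_
      rw [Finset.mem_range] at hi
      rw [word_nil, ev_one, if_neg, mul_zero]
      rw [List.length_append, List.length_take, List.length_drop]
      omega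
    | cons c v ih =>
      intro Y
      rcases Y with _ | ⟨y, Y⟩
      · simp [ev_nil]
      cases c with
      | x =>
        rw [derWord, LinearMap.comp_apply, LinearMap.mulLeft_apply, ev_x_mul, ih, Finset.mul_sum]
        refine Finset.sum_congr rfl fun i _ => ?_
        rw [word_cons, ev_x_mul, List.take_succ_cons, List.cons_append]
        simp only [List.headD_cons]
        ring
      | z =>
        have h1 : ev K (FreeAlgebra.ι K XZ.z * a * word K v) (y :: Y)
            = ev K a (Y.take (p.1 + 1)) * ev K (word K v) (Y.drop p.1) := by
          rw [mul_assoc, ev_z_mul, ev_mul K ha, List.tail_cons]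
        have h2 : ev K (a * FreeAlgebra.ι K XZ.z * word K v) (y :: Y)
            = ev K a ((y :: Y).take (p.1 + 1)) * ev K (word K v) (Y.drop p.1) := by
          rw [mul_assoc, ev_mul K ha, ev_z_mul, List.tail_drop, List.drop_succ_cons]
        simp only [derWord, LinearMap.comp_apply, LinearMap.add_apply,
          LinearMap.mulLeft_apply, LinearMap.mulRight_apply, LinearMap.sub_apply, sub_mul, map_add,
          map_sub, Pi.add_apply, Pi.sub_apply]
        rw [h1, h2, ev_z_mul, List.tail_cons, ih, List.length_cons, Nat.add_sub_cancel]
        by_cases hp : Y.length ≤ p.1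
        · rw [List.drop_of_length_le hp, ev_nil, Nat.sub_eq_zero_of_le hp,
            Nat.sub_eq_zero_of_le (by omega)]
          simp
        -- The leading `z` is the term i = 0; the other occurrences come from the induction
        -- hypothesis, shifted by one.
        · rw [show Y.length - p.1 = Y.length - 1 - p.1 + 1 by omega, Finset.sum_range_succ', add_comm]
          congr 1
          · refine Finset.sum_congr rfl fun i _ => ?_
            rw [word_cons, ev_z_mul, List.take_succ_cons, List.cons_append, List.tail_cons,
              List.drop_succ_cons, List.drop_succ_cons,
              show i + 1 + 1 + p.1 = (i + 1 + p.1) + 1 by omega, List.drop_succ_cons, sub_mul]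
          · rw [word_cons, ev_z_mul, show 0 + 1 + p.1 = p.1 + 1 by omega]
            simp
  have : evAt K Y ∘ₗ der K a = ∑ i ∈ Finset.range (Y.length - 1 - p.1),
      (ev K a ((Y.drop (i + 1)).take (p.1 + 1)) - ev K a ((Y.drop i).take (p.1 + 1))) •
        evAt K (Y.take (i + 1) ++ Y.drop (i + 1 + p.1)) :=
    linearMap_ext_word K fun v => by
      rw [LinearMap.comp_apply, evAt_apply, key, LinearMap.sum_apply]
      rfl
  have h := LinearMap.congr_fun this b
  rw [LinearMap.sum_apply] at h
  exact h

/-- Functions on lists that are invariant under rotation. -/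
def IsCyclic {α β : Type*} (f : List α → β) : Prop := ∀ l c, f (l ++ [c]) = f (c :: l)

lemma IsCyclic.rotate {α β : Type*} {f : List α → β} (hf : IsCyclic f) (l : List α) (n : ℕ) :
    f (l.rotate n) = f l := by
  induction n generalizing l with
  | zero => simp
  | succ n ih =>
    cases l with
    | nil => simp
    | cons a l => rw [List.rotate_cons_succ, ih, hf]

lemma IsCyclic.append_comm {α β : Type*} {f : List α → β} (hf : IsCyclic f) (u v : List α) :
    f (u ++ v) = f (v ++ u) := by
  rw [← hf.rotate (u ++ v) u.length, List.rotate_append_length_eq]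

/-- The product of `f` on the first `p + 1` entries and `g` on the remaining ones, the entry in
position `p` being shared. -/
def splitProd {K : Type*} [Field K] (f g : List K → K) (p : ℕ) (Y : List K) : K :=
  f (Y.take (p + 1)) * g (Y.drop p)

/-- With the variables on a circle, `a` occupies p + 1 consecutive ones and `b` the others together
with one end of this arc, in cyclic order up to rotation. The positive terms share the last entry of
the arc, the product ab being the arc that starts at 0. The negative terms share its first entry and
are read as split products with `b` in front. -/
lemma ev_mul_add_der {p q : ℕ × ℕ} {a b : Kxz K} (ha : a ∈ xzGrading K p)
    (cb : IsCyclic (ev K b)) (Y : List K) (hY : Y.length = p.1 + q.1 + 1) :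
    ev K (a * b) Y + ev K (der K a b) Y
      = ∑ s ∈ Finset.range (q.1 + 1), splitProd (ev K a) (ev K b) p.1 (Y.rotate s)
        - ∑ i ∈ Finset.range q.1, splitProd (ev K b) (ev K a) q.1 (Y.rotate (p.1 + 1 + i)) := by
  have h1 : ∀ s ≤ q.1, splitProd (ev K a) (ev K b) p.1 (Y.rotate s)
      = ev K a ((Y.drop s).take (p.1 + 1)) * ev K b (Y.take s ++ Y.drop (s + p.1)) := by
    intro s hs
    rw [splitProd, List.rotate_eq_drop_append_take (by omega),
      List.take_append_of_le_length (by rw [List.length_drop]; omega),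
      List.drop_append_of_le_length (by rw [List.length_drop]; omega), List.drop_drop,
      cb.append_comm]
  have h2 : ∀ i < q.1, splitProd (ev K b) (ev K a) q.1 (Y.rotate (p.1 + 1 + i))
      = ev K a ((Y.drop i).take (p.1 + 1)) * ev K b (Y.take (i + 1) ++ Y.drop (i + 1 + p.1)) := by
    intro i hi
    have hl : (Y.drop (p.1 + 1 + i)).length = q.1 - i := by
      rw [List.length_drop]; omega
    have hd : (Y.drop (p.1 + 1 + i)).drop q.1 = [] := List.drop_of_length_le (by omega)
    have e₁ : q.1 + 1 - (q.1 - i) = i + 1 := by omega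
    have e₂ : q.1 - (q.1 - i) = i := by omega
    have e₃ : p.1 + 1 + i - i = p.1 + 1 := by omega
    have e₄ : p.1 + 1 + i = i + 1 + p.1 := by omega
    rw [splitProd, List.rotate_eq_drop_append_take (by omega), List.take_append, List.drop_append,
      hl, e₁, e₂, List.take_of_length_le (by rw [hl]; omega),
      hd, List.nil_append, List.take_take, List.drop_take, e₃, e₄, min_eq_left (by omega),
      cb.append_comm (Y.drop _), mul_comm]
  rw [ev_mul K ha, ev_der K ha, show Y.length - 1 - p.1 = q.1 by omega]
  simp only [sub_mul]
  rw [Finset.sum_sub_distrib, Finset.sum_range_succ']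
  have e0 := h1 0 (Nat.zero_le _)
  rw [e0, Finset.sum_congr rfl fun i hi => h1 (i + 1) (by rw [Finset.mem_range] at hi; omega),
    Finset.sum_congr rfl fun i hi => h2 i (Finset.mem_range.1 hi)]
  simp only [List.take_zero, List.drop_zero, List.nil_append, Nat.zero_add]
  ring

/-- The positive terms of ab + d_a(b) cover the rotations 0, …, q, and the negative terms of ba +
d_b(a) give the same split product at the remaining `p.1` rotations. Their difference is the sum
over the whole circle. -/
theorem ev_ihara {p q : ℕ × ℕ} {a b : Kxz K} (ha : a ∈ xzGrading K p) (hb : b ∈ xzGrading K q)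
    (ca : IsCyclic (ev K a)) (cb : IsCyclic (ev K b)) (Y : List K)
    (hY : Y.length = p.1 + q.1 + 1) :
    ev K (ihara K a b) Y = ∑ s ∈ Finset.range Y.length,
      (splitProd (ev K a) (ev K b) p.1 (Y.rotate s)
        - splitProd (ev K b) (ev K a) q.1 (Y.rotate s)) := by
  have h1 := ev_mul_add_der K (q := q) ha cb Y hY
  have h2 := ev_mul_add_der K (q := p) hb ca Y (by omega)
  have e : ev K (ihara K a b) Y = (ev K (a * b) Y + ev K (der K a b) Y)
      - (ev K (b * a) Y + ev K (der K b a) Y) := by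
    rw [ihara_apply]
    simp only [map_add, map_sub, Pi.add_apply, Pi.sub_apply]
    ring
  rw [e, h1, h2, Finset.sum_sub_distrib]
  have s1 := Finset.sum_range_add (fun s => splitProd (ev K a) (ev K b) p.1 (Y.rotate s))
    (q.1 + 1) p.1
  have s2 := Finset.sum_range_add (fun s => splitProd (ev K b) (ev K a) q.1 (Y.rotate s))
    (p.1 + 1) q.1
  rw [show q.1 + 1 + p.1 = Y.length by omega] at s1
  rw [show p.1 + 1 + q.1 = Y.length by omega] at s2
  rw [s1, s2]
  ring

/-! ### Cyclic symmetry of the elements of `ls` -/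

/-- The polynomial has degree `p.2 - p.1`. If this is even, the composite of the two reversals is a
rotation without sign; if it is odd, the polynomial is zero. -/
theorem isCyclic_ev_of_mem_ls [CharZero K] {p : ℕ × ℕ} {a : Kxz K} (hls : a ∈ ls K)
    (ha : a ∈ xzGrading K p) : IsCyclic (ev K a) := by
  have h0 : pairing K XZ 1 a = 0 := by
    rw [← word_nil, pairing_word_left]
    exact hls.2.2.1 [] (by simp)
  have horth := (mem_ls_iff K a).1 hls
  have hW : WR K ≤ LinearMap.ker (pairW K a) := fun w hw => horth (w, 0) ⟨hw, trivial⟩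
  have ht : ∀ c Y, ev K a (Y.map (c + ·)) = ev K a Y := by
    rw [← dx_eq_zero_iff, dx_eq_zero_iff_orth]
    intro i
    have := horth (0, Finsupp.single (some i) 1) ⟨(WR K).zero_mem, trivial⟩
    simpa [phi] using this
  -- The polynomial in the conventions of W: variables in reverse order and base point translated to
  -- 0.
  set g : List K → K := fun l => ev K a (l.reverse ++ [0]) with hg
  have hst : ∀ u v, u ≠ [] → v ≠ [] → shSum g u v = 0 := by
    intro u v hu hv
    have := (Wst_le_ker_pairW_iff K a h0).1 ((le_sup_left.trans le_sup_left).trans hW)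
      u.reverse v.reverse (by simpa using hu) (by simpa using hv)
    rw [← shSum_reverse] at this
    simpa only [evY_piMap] using this
  have hsh : ∀ u v, u ≠ [] → v ≠ [] → shSum (fun l => g (psum l)) u v = 0 := by
    intro u v hu hv
    have := (Wsh_le_ker_pairW_iff K a h0).1 ((le_sup_right.trans le_sup_left).trans hW)
      u.reverse v.reverse (by simpa using hu) (by simpa using hv)
    rw [← shSum_reverse (fun l => ev K a (sufsum l))] at this
    simpa only [sufsum_eq_reverse, List.reverse_reverse] using this
  have hε : ∀ l, g (l.map fun s => -s) = (-1 : K) ^ (p.2 - p.1) • g l := by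
    intro l
    have := ev_map_mul K ha (-1) (l.reverse ++ [0])
    simpa [hg, List.map_reverse] using this
  have hgt : ∀ (l : List K) (c : K), ev K a (l.reverse ++ [c]) = g (l.map (· - c)) := by
    intro l c
    rw [hg, ← ht (-c)]
    simp [List.map_reverse, sub_eq_neg_add]
  have hrev : ∀ l : List K, ∃ l' : List K, l = l'.reverse := fun l => ⟨l.reverse, by simp⟩
  rcases Nat.even_or_odd (p.2 - p.1) with he | ho
  · intro l c
    rw [he.neg_one_pow] at hε
    obtain ⟨l, rfl⟩ := hrev l
    rcases l with _ | ⟨b, ts⟩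
    · rfl
    · have := cyclic_of_double_shuffle' g 1 hst hsh (by simpa using hε) ts b c
      rw [one_smul, ← hgt, ← hgt] at this
      rw [← this]
      simp
  -- Odd degree: the parity theorem covers depth at least 2, while in depth 0 and 1 the element is
  -- zero by the last two conditions defining `ls`. In depth 1, odd degree is even weight.
  · have hz : ∀ Y, ev K a Y = 0 := by
      by_cases hp : p.1 ≤ 1
      · have : a = 0 := by
          apply (wordBasis K XZ).repr.injective
          ext w
          rw [map_zero, Finsupp.zero_apply]
          by_contra hw
          obtain ⟨h1, h2⟩ := (mem_xzGrading_iff K).1 ha w hw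
          rcases Nat.le_one_iff_eq_zero_or_eq_one.1 hp with hp | hp
          · exact hw (hls.2.2.1 w (by omega))
          · refine hw (hls.2.2.2 w (by omega) ?_)
            rw [h2]
            have := count_x_add_count_z w
            rw [hp] at ho h1
            have h3 := ho.add_one
            rwa [Nat.sub_add_cancel (by omega)] at h3
        simp [this]
      · intro Y
        by_cases hY : Y.length = p.1 + 1
        · obtain ⟨b, b', ts, c, rfl⟩ : ∃ b b' ts c, Y = (b :: b' :: ts).reverse ++ [c] := by
            obtain ⟨Y, rfl⟩ := hrev Y
            rcases Y with _ | ⟨c, _ | ⟨b, _ | ⟨b', ts⟩⟩⟩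
            · simp at hY
            · simp at hY; omega
            · simp at hY; omega
            · exact ⟨b, b', ts, c, by simp⟩
          rw [ho.neg_one_pow] at hε
          rw [hgt]
          exact parity_of_double_shuffle g hst hsh (fun l => by simpa using hε l) _ _ _
        · exact ev_eq_zero_of_mem K ha Y hY
    intro l c
    rw [hz, hz]

end Ihara

/-! ### Values of the cobracket `δ̃` -/

section Cobracket

/-- Shifting the index permutes the rotations, since rotating by the full length is the identity. -/
lemma sum_rotate_add {α M : Type*} [AddCommGroup M] (h : List α → M) (Z : List α) (c : ℕ) :
    ∑ s ∈ Finset.range Z.length, h (Z.rotate (s + c)) = ∑ s ∈ Finset.range Z.length, h (Z.rotate s) := by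
  induction c with
  | zero => rfl
  | succ c ih =>
    rw [← ih]
    have h1 := Finset.sum_range_succ (fun s => h (Z.rotate (s + c))) Z.length
    have h2 := Finset.sum_range_succ' (fun s => h (Z.rotate (s + c))) Z.length
    rw [h1] at h2
    have e : Z.rotate (Z.length + c) = Z.rotate (0 + c) := by
      rw [← List.rotate_rotate, List.rotate_length, Nat.zero_add]
    rw [e] at h2
    have := add_right_cancel h2
    rw [this]
    refine Finset.sum_congr rfl fun s _ => ?_
    rw [show s + (c + 1) = s + 1 + c by omega]

/-- Reversal turns rotation by j into rotation by -j, which again runs over the whole circle. -/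
lemma sum_reverse_rotate {α M : Type*} [AddCommGroup M] (h : List α → M) (T : List α) (k : ℕ) :
    ∑ j ∈ Finset.range T.length, h ((T.rotate j).reverse.rotate k)
      = ∑ s ∈ Finset.range T.length, h (T.reverse.rotate s) := by
  have h1 := sum_rotate_add h T.reverse (1 + k)
  rw [List.length_reverse] at h1
  rw [← h1, ← Finset.sum_range_reflect]
  refine Finset.sum_congr rfl fun j hj => ?_
  rw [Finset.mem_range] at hj
  rw [List.reverse_rotate, List.rotate_rotate, Nat.mod_eq_of_lt (by omega)]
  congr 2
  omega

lemma evalSeries_map_sub {K M N τ : Type*} [Field K] [AddCommGroup M] [Module K M]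
    [AddCommGroup N] [Module K N] [Fintype τ] [DecidableEq τ] (d : ℕ) (t : τ → K) (f : M →ₗ[K] N)
    (S : Series τ M) (T : Series τ N) :
    evalSeries d t (fun a => f (S a) - T a) = f (evalSeries d t S) - evalSeries d t T := by
  simp only [evalSeries_apply, map_sum, map_smul, smul_sub, Finset.sum_sub_distrib]

variable (K : Type*) [Field K]

/-- The entries of the first factor in the `j`-th term of the cyclic sum. -/
def cycL {m : ℕ} (t : Fin (m + 1) → K) (p j : ℕ) : List K :=
  List.ofFn fun i : Fin p => t (Fin.ofNat (m + 1) (i + j)) - t (Fin.ofNat (m + 1) (m + j))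

/-- The entries of the second factor in the `j`-th term of the cyclic sum. -/
def cycR {m : ℕ} (t : Fin (m + 1) → K) (p j : ℕ) : List K :=
  List.ofFn fun i : Fin (m - p) =>
    t (Fin.ofNat (m + 1) (p + i + j)) - t (Fin.ofNat (m + 1) (m + j))

/-- The degree `d` part of the product of two values. -/
def pvTmul {M : Type*} [AddCommGroup M] [Module K M] (I : List ℕ+ → M) (d : ℕ) (L L' : List K) :
    M ⊗[K] M :=
  ∑ e ∈ Finset.HasAntidiagonal.antidiagonal d, pv I e.1 L ⊗ₜ[K] pv I e.2 L'

lemma evalSeries_cycleSeries {M : Type*} [AddCommGroup M] [Module K M] (I : List ℕ+ → M)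
    (m d : ℕ) (t : Fin (m + 1) → K) :
    evalSeries d t (cycleSeries K I m) = ∑ p ∈ Finset.Ico 1 m, ∑ j ∈ Finset.range (m + 1),
      (pvTmul K I d (cycL K t p j) (cycR K t p j) - pvTmul K I d (cycR K t p j) (cycL K t p j)) := by
  rw [cycleSeries, map_sum]
  refine Finset.sum_congr rfl fun p _ => ?_
  rw [map_sum]
  refine Finset.sum_congr rfl fun j _ => ?_
  rw [wedgeSeries, map_sub, evalSeries_tmulSeries, evalSeries_tmulSeries]
  have hL : ∀ d, evalSeries d t (colonSeries I (fun i : Fin p => tvar K m (i + j))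
      (tvar K m (m + j))) = pv I d (cycL K t p j) := fun d => by
    simp only [tvar]
    rw [evalSeries_colonSeries _ _ _ _ _ (fun i => isHomogeneous_X K _) (isHomogeneous_X K _)]
    simp [cycL]
  have hR : ∀ d, evalSeries d t (colonSeries I (fun i : Fin (m - p) => tvar K m (p + i + j))
      (tvar K m (m + j))) = pv I d (cycR K t p j) := fun d => by
    simp only [tvar]
    rw [evalSeries_colonSeries _ _ _ _ _ (fun i => isHomogeneous_X K _) (isHomogeneous_X K _)]
    simp [cycR]
  simp only [hL, hR, pvTmul]

/-- At last variable 0 only the monomials without t_{m+1} survive; they are the ones by which δ̃ is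
defined. -/
lemma evalSeries_snoc_zero {M : Type*} [AddCommGroup M] [Module K M] (m d : ℕ) (c : Fin m → K)
    (S : Series (Fin (m + 1)) M) :
    evalSeries d (Fin.snoc (α := fun _ => K) c 0) S
      = ∑ n ∈ Finset.Nat.antidiagonalTuple m d, (∏ i, c i ^ n i) •
          S (Finsupp.equivFunOnFinite.symm (Fin.snoc (α := fun _ => ℕ) n 0)) := by
  classical
  rw [evalSeries_apply]
  symm
  refine Finset.sum_of_injOn (fun n => Finsupp.equivFunOnFinite.symm
    (Fin.snoc (α := fun _ => ℕ) n 0)) ?_ ?_ ?_ ?_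
  · intro n _ n' _ h
    have h' := Finsupp.equivFunOnFinite.symm.injective h
    funext i
    have := congrFun h' i.castSucc
    simpa using this
  · intro n hn
    rw [Finset.mem_coe, Finset.Nat.mem_antidiagonalTuple] at hn
    rw [Finset.mem_coe, mem_finsuppAntidiag_univ, Finsupp.degree_eq_sum, Fin.sum_univ_castSucc]
    simpa using hn
  · intro a ha hna
    have : a (Fin.last m) ≠ 0 := by
      intro h0
      apply hna
      refine ⟨fun i => a i.castSucc, ?_, ?_⟩
      · rw [mem_finsuppAntidiag_univ, Finsupp.degree_eq_sum, Fin.sum_univ_castSucc, h0] at ha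
        rw [Finset.mem_coe, Finset.Nat.mem_antidiagonalTuple]
        simpa using ha
      · ext i
        refine Fin.lastCases ?_ (fun i => ?_) i
        · simp [h0]
        · simp
    rw [Fin.prod_univ_castSucc, Fin.snoc_last, zero_pow this, mul_zero, zero_smul]
  · intro n _
    rw [Fin.prod_univ_castSucc]
    simp

lemma deltaTilde_gen_ofFn {m : ℕ} (hm : 1 ≤ m) (n : Fin m → ℕ) :
    deltaTilde K (gen K (List.ofFn fun i => (n i).succPNat))
      = cycleSeries K (gen K) m
          (Finsupp.equivFunOnFinite.symm (Fin.snoc (α := fun _ => ℕ) n 0)) := by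
  have key : ∀ (m' : ℕ) (l : List ℕ+) (h : l.length = m') (n : Fin m' → ℕ),
      (∀ i : Fin m', (l.get (i.cast h.symm)).natPred = n i) → l ≠ [] →
      deltaTilde K (gen K l) = cycleSeries K (gen K) m'
          (Finsupp.equivFunOnFinite.symm (Fin.snoc (α := fun _ => ℕ) n 0)) := by
    rintro m' l rfl n hn hl
    rw [gen, dif_pos hl, deltaTilde, Finsupp.linearCombination_single, one_smul]
    congr 3
    funext i
    exact hn i
  refine key m _ (by simp) n (fun i => by simp) ?_
  rw [← List.length_pos_iff_ne_nil]
  simp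
  omega

lemma deltaTilde_pv (d : ℕ) {m : ℕ} (hm : 1 ≤ m) (c : Fin m → K) :
    deltaTilde K (pv (gen K) d (List.ofFn c))
      = evalSeries d (Fin.snoc (α := fun _ => K) c 0) (cycleSeries K (gen K) m) := by
  rw [pv_ofFn, map_sum, evalSeries_snoc_zero]
  refine Finset.sum_congr rfl fun n _ => ?_
  rw [map_smul, deltaTilde_gen_ofFn K hm]

/-- The defining formula of `δ̃` holds for all coefficients. -/
theorem deltaTilde_colonSeries [CharZero K] {m : ℕ} (hm : 1 ≤ m) (a : Fin (m + 1) →₀ ℕ) :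
    deltaTilde K (colonSeries (gen K) (fun i : Fin m => (MvPolynomial.X i.castSucc :
        MvPolynomial (Fin (m + 1)) K)) (MvPolynomial.X (Fin.last m)) a)
      = cycleSeries K (gen K) m a := by
  rw [← sub_eq_zero]
  refine series_eq_zero_of_value (K := K) (fun a => deltaTilde K (colonSeries (gen K)
    (fun i : Fin m => (MvPolynomial.X i.castSucc : MvPolynomial (Fin (m + 1)) K))
      (MvPolynomial.X (Fin.last m)) a) - cycleSeries K (gen K) m a) (fun d t => ?_) a
  have e : evalSeries d t (fun a => deltaTilde K (colonSeries (gen K)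
      (fun i : Fin m => (MvPolynomial.X i.castSucc : MvPolynomial (Fin (m + 1)) K))
      (MvPolynomial.X (Fin.last m)) a) - cycleSeries K (gen K) m a)
      = deltaTilde K (evalSeries d t (colonSeries (gen K)
      (fun i : Fin m => (MvPolynomial.X i.castSucc : MvPolynomial (Fin (m + 1)) K))
      (MvPolynomial.X (Fin.last m)))) - evalSeries d t (cycleSeries K (gen K) m) := by
    exact evalSeries_map_sub (M := W K) (N := W K ⊗[K] W K) d t (deltaTilde K) _ _
  rw [e, evalSeries_colonSeries _ _ _ _ _ (fun i => isHomogeneous_X K _) (isHomogeneous_X K _),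
    deltaTilde_pv K d hm, evalSeries_cycleSeries, evalSeries_cycleSeries, sub_eq_zero]
  -- The left side at `t` is the cyclic series at the translated point with last coordinate 0. The
  -- cyclic series depends on differences only, so the translation does not change it.
  have hs : ∀ r, (Fin.snoc (α := fun _ => K) (fun i : Fin m =>
      MvPolynomial.eval t (MvPolynomial.X i.castSucc)
        - MvPolynomial.eval t (MvPolynomial.X (Fin.last m))) 0 : Fin (m + 1) → K) r
      = t r - t (Fin.last m) := by
    intro r
    refine Fin.lastCases ?_ (fun i => ?_) r
    · simp
    · simp
  simp only [cycL, cycR, hs, sub_sub_sub_cancel_right]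

/-! ### Comparison of the two cobrackets -/

lemma idxDegree_add_length (l : List ℕ+) : idxDegree l + l.length = listWeight l := by
  induction l with
  | nil => simp [idxDegree, listWeight]
  | cons n l ih =>
    have := PNat.natPred_add_one n
    rw [listWeight_cons, ← ih]
    simp only [idxDegree, List.map_cons, List.sum_cons, List.length_cons]
    omega

lemma listWeight_reverse (l : List ℕ+) : listWeight l.reverse = listWeight l := by
  rw [← idxDegree_add_length, ← idxDegree_add_length, idxDegree_reverse, List.length_reverse]

lemma pairW_gen_eq_zero {p : ℕ × ℕ} {a : Kxz K} (ha : a ∈ xzGrading K p) (l : List ℕ+)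
    (h : ¬(l.length = p.1 ∧ listWeight l = p.2)) : pairW K a (gen K l) = 0 := by
  by_cases hl : l = []
  · simp [hl, gen]
  rw [pairW_gen K a l hl, pairing_word_left]
  by_contra hne
  apply h
  have := (mem_xzGrading_iff K).1 ha _ hne
  have h1 := count_blockWord l.reverse 0
  have h2 := length_blockWord l.reverse 0
  rw [List.replicate_zero, List.append_nil] at h1 h2
  rw [h1, h2, listWeight_reverse, List.length_reverse] at this
  exact this

/-- For bihomogeneous `a` only the degree weight minus depth occurs, so this single component is the
whole polynomial, evaluated in reverse order with last variable 0. Positive depth ensures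
orthogonality to 1. -/
lemma pv_pairW [CharZero K] {p : ℕ × ℕ} {a : Kxz K} (ha : a ∈ xzGrading K p) (hp : 1 ≤ p.1) (d : ℕ)
    (L : List K) : pv (fun l => pairW K a (gen K l)) d L
      = if L.length = p.1 ∧ d = p.2 - p.1 then ev K a (L.reverse ++ [0]) else 0 := by
  have h0 : pairing K XZ 1 a = 0 := by
    rw [← word_nil, pairing_word_left]
    by_contra h
    have := ((mem_xzGrading_iff K).1 ha _ h).1
    simp at this
    omega
  have hz : ∀ d, ¬(L.length = p.1 ∧ d = p.2 - p.1) →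
      pv (fun l => pairW K a (gen K l)) d L = 0 := by
    intro d hd
    refine pv_eq_zero _ _ _ fun l hl hdl => pairW_gen_eq_zero K ha l ?_
    rintro ⟨h1, h2⟩
    apply hd
    have := idxDegree_add_length l
    omega
  split_ifs with h
  · obtain ⟨N, hN, hs⟩ := exists_sum_pv K (piMap K a)
    have h2 := hs L
    have h3 := fun d (hd : d ≥ N) => hN d hd L
    simp only [← pairW_gen' K a h0] at h2 h3
    rw [evY_piMap] at h2
    rw [← h2]
    by_cases hdN : d < N
    · rw [Finset.sum_eq_single d]
      · intro d' _ hd'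
        exact hz d' (by rintro ⟨_, h'⟩; omega)
      · intro h'
        exact absurd (Finset.mem_range.2 hdN) h'
    · rw [h3 d (by omega), Finset.sum_eq_zero]
      intro d' hd'
      rw [Finset.mem_range] at hd'
      exact hz d' (by rintro ⟨_, h'⟩; omega)
  · exact hz d h

lemma dualDistrib_pvTmul [CharZero K] {p q : ℕ × ℕ} {a b : Kxz K} (ha : a ∈ xzGrading K p)
    (hp : 1 ≤ p.1) (hb : b ∈ xzGrading K q) (hq : 1 ≤ q.1) (d : ℕ) (L L' : List K) :
    TensorProduct.dualDistrib K _ _ (pairW K a ⊗ₜ[K] pairW K b) (pvTmul K (gen K) d L L')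
      = if (L.length = p.1 ∧ L'.length = q.1) ∧ d = (p.2 - p.1) + (q.2 - q.1) then
          ev K a (L.reverse ++ [0]) * ev K b (L'.reverse ++ [0]) else 0 := by
  rw [pvTmul, map_sum]
  simp only [TensorProduct.dualDistrib_apply, map_pv, pv_pairW K ha hp, pv_pairW K hb hq]
  split_ifs with h
  · obtain ⟨⟨h1, h2⟩, rfl⟩ := h
    rw [Finset.sum_eq_single (p.2 - p.1, q.2 - q.1)]
    · simp [h1, h2]
    · rintro ⟨e₁, e₂⟩ he hne
      by_cases h' : e₁ = p.2 - p.1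
      · by_cases h'' : e₂ = q.2 - q.1
        · exact absurd (Prod.ext h' h'') hne
        · simp [h'']
      · simp [h']
    · intro h
      exact absurd (by simp) h
  · refine Finset.sum_eq_zero fun e he => ?_
    rw [Finset.HasAntidiagonal.mem_antidiagonal] at he
    split_ifs with h₁ h₂
    · exact absurd ⟨⟨h₁.1, h₂.1⟩, by omega⟩ h
    all_goals simp

/-- The j-th term of the cyclic sum reads the list of variables rotated by j: the first `p` entries
go to the left factor, the next `m - p` to the right one, and the last is the base point of both. -/
lemma rotate_ofFn {m : ℕ} (t : Fin (m + 1) → K) (j : ℕ) {p : ℕ} (hp : p ≤ m) :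
    ∃ (P Q : List K) (c : K), P.length = p ∧ Q.length = m - p ∧
      (List.ofFn t).rotate j = P ++ Q ++ [c] ∧ cycL K t p j = P.map (· - c) ∧
      cycR K t p j = Q.map (· - c) := by
  refine ⟨List.ofFn fun i : Fin p => t (Fin.ofNat (m + 1) (i + j)),
    List.ofFn fun i : Fin (m - p) => t (Fin.ofNat (m + 1) (p + i + j)),
    t (Fin.ofNat (m + 1) (m + j)), by simp, by simp, ?_, ?_, ?_⟩
  · apply List.ext_getElem
    · simp; omega
    · intro i h₁ h₂
      have hi : i < m + 1 := by simpa using h₁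
      rw [List.getElem_rotate]
      have e : ∀ (h : (i + j) % (List.ofFn t).length < (List.ofFn t).length),
          (List.ofFn t)[(i + j) % (List.ofFn t).length] = t (Fin.ofNat (m + 1) (i + j)) := by
        intro h
        rw [List.getElem_ofFn]
        congr 1
        ext
        simp [Fin.ofNat]
      rw [e]
      rcases lt_or_ge i p with hip | hip
      · rw [List.getElem_append_left (by simp; omega), List.getElem_append_left (by simpa using hip),
          List.getElem_ofFn]
      · rcases lt_or_ge i m with him | him
        · rw [List.getElem_append_left (by simp; omega),
            List.getElem_append_right (by simpa using hip), List.getElem_ofFn]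
          congr 2
          simp
          omega
        · obtain rfl : i = m := by omega
          rw [List.getElem_append_right (by simp; omega)]
          simp
  · rw [cycL, List.map_ofFn]
    rfl
  · rw [cycR, List.map_ofFn]
    rfl

/-- On `ls`, the map `δ̃` is dual to the Ihara bracket, for bihomogeneous elements. -/
theorem dualDistrib_deltaTilde_of_mem [CharZero K] {p q : ℕ × ℕ} {a b : Kxz K}
    (hla : a ∈ ls K) (hlb : b ∈ ls K) (ha : a ∈ xzGrading K p) (hb : b ∈ xzGrading K q)
    (hp : 1 ≤ p.1) (hq : 1 ≤ q.1) (w : W K) :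
    TensorProduct.dualDistrib K _ _ (pairW K a ⊗ₜ[K] pairW K b) (deltaTilde K w)
      = pairW K (ihara K a b) w := by
  have hab := ihara_mem_xzGrading K ha hb
  have ca := isCyclic_ev_of_mem_ls K hla ha
  have cb := isCyclic_ev_of_mem_ls K hlb hb
  have htr : ∀ {a : Kxz K}, a ∈ ls K → ∀ (L : List K) (c : K),
      ev K a ((L.map (· - c)).reverse ++ [0]) = ev K a (L.reverse ++ [c]) := by
    intro a h L c
    have horth := (mem_ls_iff K a).1 h
    have ht : ∀ c Y, ev K a (Y.map (c + ·)) = ev K a Y := by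
      rw [← dx_eq_zero_iff, dx_eq_zero_iff_orth]
      intro i
      have := horth (0, Finsupp.single (some i) 1) ⟨(WR K).zero_mem, trivial⟩
      simpa [phi] using this
    rw [← ht (-c) (L.reverse ++ [c])]
    simp [List.map_reverse, sub_eq_neg_add]
  -- The defect of the formula on the generators; it vanishes once its generating polynomials do.
  set J : List ℕ+ → K := fun l =>
    TensorProduct.dualDistrib K _ _ (pairW K a ⊗ₜ[K] pairW K b) (deltaTilde K (gen K l))
      - pairW K (ihara K a b) (gen K l) with hJ
  suffices h : ∀ l, J l = 0 by
    have e : TensorProduct.dualDistrib K _ _ (pairW K a ⊗ₜ[K] pairW K b) ∘ₗ deltaTilde K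
        = pairW K (ihara K a b) := by
      refine Finsupp.lhom_ext' fun l => LinearMap.ext_ring ?_
      have := h l.1
      rw [hJ] at this
      simp only [gen, dif_pos l.2] at this
      exact sub_eq_zero.1 this
    exact LinearMap.congr_fun e w
  refine eq_zero_of_pv (K := K) J fun d ts => ?_
  have hpvJ : pv J d ts = TensorProduct.dualDistrib K _ _ (pairW K a ⊗ₜ[K] pairW K b)
      (deltaTilde K (pv (gen K) d ts)) - pv (fun l => pairW K (ihara K a b) (gen K l)) d ts := by
    have := map_pv (TensorProduct.dualDistrib K _ _ (pairW K a ⊗ₜ[K] pairW K b) ∘ₗ deltaTilde K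
      - pairW K (ihara K a b)) (gen K) d ts
    rw [LinearMap.sub_apply, LinearMap.comp_apply, map_pv (pairW K (ihara K a b))] at this
    rw [this]
    rfl
  rw [hpvJ, sub_eq_zero, pv_pairW K hab (by simp; omega)]
  rcases Nat.eq_zero_or_pos ts.length with h0 | hm
  · rw [List.length_eq_zero_iff] at h0
    subst h0
    have : ¬((([] : List K).length = (p + q).1) ∧ d = (p + q).2 - (p + q).1) := by
      rintro ⟨h, _⟩
      simp at h
      omega
    rw [if_neg this]
    by_cases hd : d = 0 <;> simp [pv, gen]
  obtain ⟨m, c, hmc, rfl⟩ : ∃ (m : ℕ) (c : Fin m → K), 1 ≤ m ∧ ts = List.ofFn c :=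
    ⟨ts.length, ts.get, hm, by simp⟩
  rw [deltaTilde_pv K d hmc, evalSeries_cycleSeries]
  simp only [map_sum, map_sub, dualDistrib_pvTmul K ha hp hb hq]
  set t : Fin (m + 1) → K := Fin.snoc (α := fun _ => K) c 0 with ht
  have hlenL : ∀ p j, (cycL K t p j).length = p := fun p j => by simp [cycL]
  have hlenR : ∀ p j, (cycR K t p j).length = m - p := fun p j => by simp [cycR]
  -- A nonzero bihomogeneous element has depth at most its weight. The truncated subtraction weight
  -- minus depth is then a true difference, hence additive in `p` and `q`.
  have hle : ∀ {p : ℕ × ℕ} {a : Kxz K}, a ∈ xzGrading K p → a ≠ 0 → p.1 ≤ p.2 := by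
    intro p a ha hne
    by_contra hlt
    apply hne
    apply (wordBasis K XZ).repr.injective
    ext w
    rw [map_zero, Finsupp.zero_apply]
    by_contra hw
    obtain ⟨h1, h2⟩ := (mem_xzGrading_iff K).1 ha w hw
    have := count_x_add_count_z w
    omega
  by_cases ha0 : a = 0
  · subst ha0
    simp
  by_cases hb0 : b = 0
  · subst hb0
    simp
  have hpe := hle ha ha0
  have hqe := hle hb hb0
  simp only [hlenL, hlenR, List.length_ofFn, Prod.fst_add, Prod.snd_add]
  by_cases hd : d = (p.2 - p.1) + (q.2 - q.1)
  swap
  · rw [if_neg (by rintro ⟨_, h⟩; omega)]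
    refine Finset.sum_eq_zero fun p' _ => Finset.sum_eq_zero fun j _ => ?_
    rw [if_neg (fun h => hd h.2), if_neg (fun h => hd h.2), sub_zero]
  by_cases hmpq : m = p.1 + q.1
  swap
  · rw [if_neg (by rintro ⟨h, _⟩; omega)]
    refine Finset.sum_eq_zero fun p' hp' => Finset.sum_eq_zero fun j _ => ?_
    rw [Finset.mem_Ico] at hp'
    rw [if_neg (by rintro ⟨⟨h1, h2⟩, _⟩; omega), if_neg (by rintro ⟨⟨h1, h2⟩, _⟩; omega), sub_zero]
  rw [if_pos ⟨hmpq, by omega⟩]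
  simp only [Finset.sum_sub_distrib]
  -- The depths select one term of the sum over k: the left factor of the wedge must have length
  -- `p.1` in its first half and, the factors being exchanged, `q.1` in its second half.
  have outer : ∀ (r : ℕ) (f : ℕ → ℕ → K), 1 ≤ r → r < m →
      (∀ p' ∈ Finset.Ico 1 m, p' ≠ r → ∀ j, f p' j = 0) →
      ∑ p' ∈ Finset.Ico 1 m, ∑ j ∈ Finset.range (m + 1), f p' j
        = ∑ j ∈ Finset.range (m + 1), f r j := by
    intro r f h1 h2 h
    refine Finset.sum_eq_single r (fun p' hp' hne => ?_) fun h' => ?_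
    · exact Finset.sum_eq_zero fun j _ => h p' hp' hne j
    · exact absurd (Finset.mem_Ico.2 ⟨h1, h2⟩) h'
  refine (congrArg₂ (· - ·) (outer p.1 _ hp (by omega) ?_)
    (outer q.1 _ hq (by omega) ?_)).trans ?_
  · intro p' _ hne j
    refine if_neg ?_
    rintro ⟨⟨h1, h2⟩, _⟩
    omega
  · intro p' hp' hne j
    rw [Finset.mem_Ico] at hp'
    refine if_neg ?_
    rintro ⟨⟨h1, h2⟩, _⟩
    omega
  -- The sum over j is matched with the sum over all rotations of the arguments of the Ihara
  -- bracket: reversal comes from φ, and a constant shift does not change a sum over all rotations.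
  have key : ∀ {p q : ℕ × ℕ} {a b : Kxz K}, a ∈ ls K → b ∈ ls K → IsCyclic (ev K b) →
      m = p.1 + q.1 → ∑ j ∈ Finset.range (m + 1), ev K a ((cycL K t p.1 j).reverse ++ [0]) *
        ev K b ((cycR K t p.1 j).reverse ++ [0])
      = ∑ s ∈ Finset.range (m + 1),
        splitProd (ev K a) (ev K b) p.1 (((List.ofFn c).reverse ++ [0]).rotate s) := by
    intro p q a b hla hlb cb hm
    have hY : (List.ofFn c).reverse ++ [0] = (List.ofFn t).reverse.rotate 1 := by
      rw [ht, List.ofFn_succ']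
      simp
    have hlen : m + 1 = (List.ofFn t).length := by simp
    have h1 := sum_rotate_add (splitProd (ev K a) (ev K b) p.1) (List.ofFn t).reverse 1
    have h2 := sum_reverse_rotate (splitProd (ev K a) (ev K b) p.1) (List.ofFn t) (q.1 + 1)
    rw [List.length_reverse, ← hlen] at h1
    rw [← hlen] at h2
    rw [hY]
    simp only [List.rotate_rotate, Nat.add_comm 1]
    rw [h1, ← h2]
    refine Finset.sum_congr rfl fun j _ => ?_
    obtain ⟨P, Q, c', hP, hQ, hrot, hL, hR⟩ := rotate_ofFn K t j (p := p.1) (by omega)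
    rw [hL, hR, htr hla, htr hlb, hrot]
    -- This shift puts the base point `c'` in the shared position. Cyclicity of `b` then moves it
    -- from the front to the end of the arguments of `b`.
    have e : (P ++ Q ++ [c']).reverse.rotate (q.1 + 1) = P.reverse ++ c' :: Q.reverse := by
      have e1 : (P ++ Q ++ [c']).reverse = (c' :: Q.reverse) ++ P.reverse := by simp
      have e2 : q.1 + 1 = (c' :: Q.reverse).length := by simp; omega
      rw [e1, e2, List.rotate_append_length_eq]
    rw [e, splitProd, cb]
    congr 2
    · rw [List.take_append, List.length_reverse, hP, List.take_of_length_le (by simp; omega)]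
      simp
    · rw [List.drop_left' (by simpa using hP)]
  rw [ev_ihara K ha hb ca cb _ (by simp; omega)]
  have hlen : ((List.ofFn c).reverse ++ [0]).length = m + 1 := by simp
  rw [hlen, Finset.sum_sub_distrib, ← key (q := q) hla hlb cb hmpq,
    ← key (q := p) hlb hla ca (by omega)]
  congr 1
  · refine Finset.sum_congr rfl fun j _ => if_pos ⟨⟨rfl, by omega⟩, hd⟩
  · refine Finset.sum_congr rfl fun j _ => ?_
    rw [if_pos ⟨⟨by omega, rfl⟩, hd⟩, mul_comm]

end Cobracket

/-! ### Bigradings given by projections -/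

section Graded

variable {K M N : Type*} [Field K] [AddCommGroup M] [Module K M] [AddCommGroup N] [Module K N]

/-- The maps `P p` are the projections onto the components of the bigrading `gr`. -/
structure IsProjections (gr : ℕ × ℕ → Submodule K M) (P : ℕ × ℕ → M →ₗ[K] M) : Prop where
  mem : ∀ p x, P p x ∈ gr p
  self : ∀ p, ∀ x ∈ gr p, P p x = x
  other : ∀ p q, q ≠ p → ∀ x ∈ gr q, P p x = 0
  exists_sum : ∀ x, ∃ s : Finset (ℕ × ℕ), (∀ p ∉ s, P p x = 0) ∧ x = ∑ p ∈ s, P p x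

namespace IsProjections

variable {gr : ℕ × ℕ → Submodule K M} {P : ℕ × ℕ → M →ₗ[K] M}

lemma sum_of_subset (h : IsProjections gr P) (x : M) :
    ∃ s : Finset (ℕ × ℕ), ∀ t, s ⊆ t → x = ∑ p ∈ t, P p x := by
  obtain ⟨s, h0, hs⟩ := h.exists_sum x
  refine ⟨s, fun t ht => hs.trans (Finset.sum_subset ht fun p _ hp => h0 p hp)⟩

lemma isInternal (h : IsProjections gr P) : DirectSum.IsInternal gr := by
  rw [DirectSum.isInternal_submodule_iff_iSupIndep_and_iSup_eq_top]
  constructor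
  · rw [iSupIndep_def]
    intro p
    rw [Submodule.disjoint_def]
    intro x hx hx'
    have hle : (⨆ (j) (_ : j ≠ p), gr j) ≤ LinearMap.ker (P p) :=
      iSup₂_le fun j hj y hy => h.other p j hj y hy
    rw [← h.self p x hx]
    exact hle hx'
  · rw [eq_top_iff]
    intro x _
    obtain ⟨s, -, hs⟩ := h.exists_sum x
    rw [hs]
    exact Submodule.sum_mem _ fun p _ => Submodule.mem_iSup_of_mem p (h.mem p x)

lemma of_iSup (mem : ∀ p x, P p x ∈ gr p) (self : ∀ p, ∀ x ∈ gr p, P p x = x)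
    (other : ∀ p q, q ≠ p → ∀ x ∈ gr q, P p x = 0) (top : ⨆ p, gr p = ⊤) :
    IsProjections gr P where
  mem := mem
  self := self
  other := other
  exists_sum x := by
    classical
    have hx : x ∈ ⨆ p, gr p := top ▸ Submodule.mem_top
    induction hx using Submodule.iSup_induction' with
    | mem p x hx =>
      refine ⟨{p}, fun q hq => other q p ?_ x hx, ?_⟩
      · rintro rfl
        simp at hq
      · rw [Finset.sum_singleton, self p x hx]
    | zero => exact ⟨∅, by simp, by simp⟩
    | add x y _ _ hx hy =>
      obtain ⟨s, hs0, hs⟩ := hx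
      obtain ⟨t, ht0, ht⟩ := hy
      refine ⟨s ∪ t, fun p hp => ?_, ?_⟩
      · rw [Finset.mem_union, not_or] at hp
        rw [map_add, hs0 p hp.1, ht0 p hp.2, add_zero]
      · simp only [map_add, Finset.sum_add_distrib]
        rw [← Finset.sum_subset Finset.subset_union_left fun p _ hp => hs0 p hp, ← hs,
          ← Finset.sum_subset Finset.subset_union_right fun p _ hp => ht0 p hp, ← ht]

lemma prod (h : IsProjections gr P) {gr' : ℕ × ℕ → Submodule K N} {P' : ℕ × ℕ → N →ₗ[K] N}
    (h' : IsProjections gr' P') :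
    IsProjections (fun p => (gr p).prod (gr' p)) fun p => (P p).prodMap (P' p) where
  mem p x := ⟨h.mem p _, h'.mem p _⟩
  self p x hx := Prod.ext (h.self p _ hx.1) (h'.self p _ hx.2)
  other p q hq x hx := Prod.ext (h.other p q hq _ hx.1) (h'.other p q hq _ hx.2)
  exists_sum x := by
    classical
    obtain ⟨s, hs0, hs⟩ := h.exists_sum x.1
    obtain ⟨t, ht0, ht⟩ := h'.exists_sum x.2
    refine ⟨s ∪ t, fun p hp => ?_, ?_⟩
    · rw [Finset.mem_union, not_or] at hp
      exact Prod.ext (hs0 p hp.1) (ht0 p hp.2)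
    · refine Prod.ext ?_ ?_
      · rw [Prod.fst_sum]
        exact hs.trans (Finset.sum_subset Finset.subset_union_left fun p _ hp => hs0 p hp)
      · rw [Prod.snd_sum]
        exact ht.trans (Finset.sum_subset Finset.subset_union_right fun p _ hp => ht0 p hp)

/-- Stability under the projections says that `F` is a graded subspace, so the projections descend
to the quotient. -/
lemma quot (h : IsProjections gr P) (F : Submodule K M) (hF : ∀ p, F ≤ F.comap (P p)) :
    IsProjections (quotGrading gr F) fun p => F.mapQ F (P p) (hF p) where
  mem p x := by
    obtain ⟨x, rfl⟩ := F.mkQ_surjective x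
    exact ⟨P p x, h.mem p x, rfl⟩
  self p x hx := by
    obtain ⟨x, hx, rfl⟩ := hx
    exact congrArg F.mkQ (h.self p x hx)
  other p q hq x hx := by
    obtain ⟨x, hx, rfl⟩ := hx
    refine (congrArg F.mkQ (h.other p q hq x hx)).trans (map_zero _)
  exists_sum x := by
    obtain ⟨x, rfl⟩ := F.mkQ_surjective x
    obtain ⟨s, hs0, hs⟩ := h.exists_sum x
    refine ⟨s, fun p hp => (congrArg F.mkQ (hs0 p hp)).trans (map_zero _), ?_⟩
    exact (congrArg F.mkQ hs).trans (map_sum _ _ _)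

lemma map_equiv (h : IsProjections gr P) (e : M ≃ₗ[K] N) :
    IsProjections (fun p => (gr p).map e.toLinearMap)
      fun p => e.toLinearMap ∘ₗ P p ∘ₗ e.symm.toLinearMap where
  mem p x := ⟨_, h.mem p _, rfl⟩
  self p x hx := by
    obtain ⟨x, hx, rfl⟩ := hx
    simp [h.self p x hx]
  other p q hq x hx := by
    obtain ⟨x, hx, rfl⟩ := hx
    simp [h.other p q hq x hx]
  exists_sum x := by
    obtain ⟨s, hs0, hs⟩ := h.exists_sum (e.symm x)
    refine ⟨s, fun p hp => by simp [hs0 p hp], ?_⟩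
    conv_lhs => rw [← e.apply_symm_apply x, hs, map_sum]
    rfl

end IsProjections

/-- The projection onto the component of degree `p`, for a basis of homogeneous elements. -/
def basisProj {ι : Type*} (b : Module.Basis ι K M) (d : ι → ℕ × ℕ) (p : ℕ × ℕ) : M →ₗ[K] M :=
  b.constr K fun i => if d i = p then b i else 0

lemma basisProj_apply {ι : Type*} (b : Module.Basis ι K M) (d : ι → ℕ × ℕ) (p : ℕ × ℕ) (i : ι) :
    basisProj b d p (b i) = if d i = p then b i else 0 := by
  rw [basisProj, Module.Basis.constr_basis]

lemma isProjections_basisProj {ι : Type*} (b : Module.Basis ι K M) (d : ι → ℕ × ℕ) :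
    IsProjections (fun p => Submodule.span K (b '' {i | d i = p})) (basisProj b d) := by
  refine IsProjections.of_iSup (fun p x => ?_) (fun p x hx => ?_) (fun p q hq x hx => ?_) ?_
  · have : (⊤ : Submodule K M) ≤ (Submodule.span K (b '' {i | d i = p})).comap (basisProj b d p) := by
      rw [← b.span_eq, Submodule.span_le]
      rintro _ ⟨i, rfl⟩
      rw [SetLike.mem_coe, Submodule.mem_comap, basisProj_apply]
      split_ifs with h
      · exact Submodule.subset_span ⟨i, h, rfl⟩
      · exact Submodule.zero_mem _
    exact this Submodule.mem_top
  · have : Submodule.span K (b '' {i | d i = p}) ≤ LinearMap.eqLocus (basisProj b d p) LinearMap.id := by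
      rw [Submodule.span_le]
      rintro _ ⟨i, hi, rfl⟩
      rw [SetLike.mem_coe, LinearMap.mem_eqLocus, basisProj_apply, if_pos (show d i = p from hi),
        LinearMap.id_apply]
    exact this hx
  · have : Submodule.span K (b '' {i | d i = q}) ≤ LinearMap.ker (basisProj b d p) := by
      rw [Submodule.span_le]
      rintro _ ⟨i, hi, rfl⟩
      rw [SetLike.mem_coe, LinearMap.mem_ker, basisProj_apply, if_neg]
      rintro rfl
      exact hq hi.symm
    exact this hx
  · rw [eq_top_iff, ← b.span_eq, Submodule.span_le]
    rintro _ ⟨i, rfl⟩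
    exact Submodule.mem_iSup_of_mem (d i) (Submodule.subset_span ⟨i, rfl, rfl⟩)

/-! ### Lie coalgebras and surjective maps -/

lemma map_comm_apply (q : M →ₗ[K] N) (x : M ⊗[K] M) :
    TensorProduct.comm K N N (TensorProduct.map q q x)
      = TensorProduct.map q q (TensorProduct.comm K M M x) := by
  induction x using TensorProduct.induction_on with
  | zero => simp
  | tmul a b => simp
  | add a b ha hb => simp only [map_add, ha, hb]

lemma rot_map (q : M →ₗ[K] N) (x : M ⊗[K] (M ⊗[K] M)) :
    rot K N (TensorProduct.map q (TensorProduct.map q q) x)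
      = TensorProduct.map q (TensorProduct.map q q) (rot K M x) := by
  have : rot K N ∘ₗ TensorProduct.map q (TensorProduct.map q q)
      = TensorProduct.map q (TensorProduct.map q q) ∘ₗ rot K M := by
    refine TensorProduct.ext (LinearMap.ext fun a => TensorProduct.ext (LinearMap.ext fun b =>
      LinearMap.ext fun c => ?_))
    simp [rot]
  exact LinearMap.congr_fun this x

lemma map_mem_tensorGrading (q : M →ₗ[K] N) (gr : ℕ × ℕ → Submodule K M) (p : ℕ × ℕ)
    {x : M ⊗[K] M} (hx : x ∈ tensorGrading gr p) :
    TensorProduct.map q q x ∈ tensorGrading (fun p => (gr p).map q) p := by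
  have : tensorGrading gr p
      ≤ (tensorGrading (fun p => (gr p).map q) p).comap (TensorProduct.map q q) := by
    refine iSup_le fun r => iSup_le fun s => iSup_le fun h => ?_
    rintro _ ⟨y, rfl⟩
    rw [Submodule.mem_comap, tensorGrading]
    refine Submodule.mem_iSup_of_mem r (Submodule.mem_iSup_of_mem s (Submodule.mem_iSup_of_mem h ?_))
    induction y using TensorProduct.induction_on with
    | zero => simp
    | tmul a b =>
      exact ⟨(⟨q a, a, a.2, rfl⟩ : (gr r).map q) ⊗ₜ[K] (⟨q b, b, b.2, rfl⟩ : (gr s).map q), by simp⟩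
    | add a b ha hb =>
      rw [map_add, map_add]
      exact Submodule.add_mem _ ha hb
  exact this hx

/-- The image of a bigraded Lie coalgebra under a surjective map that intertwines cobrackets. -/
theorem IsBigradedLieCoalgebra.of_surjective {gr : ℕ × ℕ → Submodule K M}
    {δ : M →ₗ[K] M ⊗[K] M} (h : IsBigradedLieCoalgebra gr δ) (q : M →ₗ[K] N)
    (hq : Function.Surjective q) (δ' : N →ₗ[K] N ⊗[K] N)
    (hδ : ∀ v, δ' (q v) = TensorProduct.map q q (δ v))
    (hint : DirectSum.IsInternal fun p => (gr p).map q) :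
    IsBigradedLieCoalgebra (fun p => (gr p).map q) δ' where
  isInternal := hint
  isLieCobracket :=
    { antisymm := fun a => by
        obtain ⟨a, rfl⟩ := hq a
        rw [hδ, map_comm_apply, h.isLieCobracket.antisymm, map_neg]
      coJacobi := fun a => by
        obtain ⟨a, rfl⟩ := hq a
        have e : TensorProduct.map LinearMap.id δ' (δ' (q a))
            = TensorProduct.map q (TensorProduct.map q q)
                (TensorProduct.map LinearMap.id δ (δ a)) := by
          rw [hδ]
          generalize δ a = x
          induction x using TensorProduct.induction_on with
          | zero => simp
          | tmul a b => simp [hδ]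
          | add a b ha hb => simp only [map_add, ha, hb]
        have := h.isLieCobracket.coJacobi a
        simp only at this ⊢
        rw [e, rot_map, rot_map, ← map_add, ← map_add, this, map_zero] }
  map_grading p a ha := by
    obtain ⟨a, ha, rfl⟩ := ha
    rw [hδ]
    exact map_mem_tensorGrading q gr p (h.map_grading p a ha)

theorem IsBigradedLieCoalgebra.of_equiv {gr : ℕ × ℕ → Submodule K M} {P : ℕ × ℕ → M →ₗ[K] M}
    {δ : M →ₗ[K] M ⊗[K] M} (h : IsBigradedLieCoalgebra gr δ) (hP : IsProjections gr P)
    (e : M ≃ₗ[K] N) (δ' : N →ₗ[K] N ⊗[K] N)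
    (hδ : ∀ v, δ' (e v) = TensorProduct.map e.toLinearMap e.toLinearMap (δ v))
    {gr' : ℕ × ℕ → Submodule K N} (hgr : ∀ p, (gr p).map e.toLinearMap = gr' p) :
    IsBigradedLieCoalgebra gr' δ' := by
  obtain rfl : (fun p => (gr p).map e.toLinearMap) = gr' := funext hgr
  exact h.of_surjective e.toLinearMap e.surjective δ' hδ (hP.map_equiv e).isInternal

lemma IsBigradedLieCoalgebra.neg {gr : ℕ × ℕ → Submodule K M}
    {δ : M →ₗ[K] M ⊗[K] M} (h : IsBigradedLieCoalgebra gr δ) : IsBigradedLieCoalgebra gr (-δ) where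
  isInternal := h.isInternal
  isLieCobracket :=
    { antisymm := fun a => by
        rw [LinearMap.neg_apply, map_neg, h.isLieCobracket.antisymm]
      coJacobi := fun a => by
        have e : TensorProduct.map LinearMap.id (-δ) ((-δ) a)
            = TensorProduct.map LinearMap.id δ (δ a) := by
          rw [LinearMap.neg_apply]
          generalize δ a = x
          induction x using TensorProduct.induction_on with
          | zero => simp
          | tmul a b => simp [TensorProduct.tmul_neg]
          | add a b ha hb => rw [neg_add, map_add, ha, hb, map_add]
        have := h.isLieCobracket.coJacobi a
        simp only at this ⊢
        rw [e, this] }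
  map_grading p a ha := Submodule.neg_mem _ (h.map_grading p a ha)

/-- `F ⊗ M + M ⊗ F` is the kernel of `M ⊗ M → N ⊗ N`, for the kernel `F` of `M → N`. -/
lemma mem_coidealTarget_iff (q : M →ₗ[K] N) (hq : Function.Surjective q) (x : M ⊗[K] M) :
    x ∈ coidealTarget (LinearMap.ker q) ↔ TensorProduct.map q q x = 0 := by
  -- Right exactness of the tensor product, in both factors.
  have hex : Function.Exact (LinearMap.ker q).subtype q := LinearMap.exact_subtype_ker_map q
  have := TensorProduct.map_ker hex hq hex hq
  rw [← LinearMap.mem_ker, this, coidealTarget, sup_comm]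
  rfl

end Graded

/-! ### The Ihara bracket is a Lie bracket -/

section Jacobi

variable (K : Type*) [Field K]

lemma der_one (a : Kxz K) : der K a 1 = 0 := by
  have := der_leibniz K a 1 1
  simpa using this

/-- Two linear maps that satisfy the Leibniz rule and agree on the letters are equal. -/
lemma derivation_ext (D D' : Kxz K →ₗ[K] Kxz K) (h : ∀ a b, D (a * b) = D a * b + a * D b)
    (h' : ∀ a b, D' (a * b) = D' a * b + a * D' b)
    (hx : ∀ c, D (FreeAlgebra.ι K c) = D' (FreeAlgebra.ι K c)) : D = D' := by
  refine linearMap_ext_word K fun w => ?_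
  induction w with
  | nil =>
    have h1 := h 1 1
    have h1' := h' 1 1
    simp only [mul_one, one_mul, left_eq_add] at h1 h1'
    rw [word_nil, h1, h1']
  | cons c w ih => rw [word_cons, h, h', hx, ih]

/-- Both sides are derivations in `c` that kill `x`, and they agree on `z`: the map a ↦ d_a takes
the Ihara bracket to the commutator of derivations. -/
lemma der_ihara (a b c : Kxz K) :
    der K (ihara K a b) c = der K a (der K b c) - der K b (der K a c) := by
  have := derivation_ext K (der K (ihara K a b)) (der K a ∘ₗ der K b - der K b ∘ₗ der K a)
    (der_leibniz K _) (fun c d => by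
      simp only [LinearMap.sub_apply, LinearMap.comp_apply, der_leibniz, map_add]
      noncomm_ring) (fun c => by
      cases c with
      | x => simp [der_x]
      | z =>
        simp only [LinearMap.sub_apply, LinearMap.comp_apply, der_z, der_leibniz, map_sub,
          ihara_apply]
        noncomm_ring)
  exact LinearMap.congr_fun this c

lemma ihara_antisymm (a b : Kxz K) : ihara K b a = -ihara K a b := by
  simp only [ihara_apply]
  abel

/-- Once the derivations of brackets are replaced by commutators and the others are expanded by the
Leibniz rule, all terms cancel in the free noncommutative ring. -/
lemma ihara_jacobi (a b c : Kxz K) :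
    ihara K a (ihara K b c) + ihara K b (ihara K c a) + ihara K c (ihara K a b) = 0 := by
  rw [ihara_apply K a, ihara_apply K b (ihara K c a), ihara_apply K c (ihara K a b)]
  rw [der_ihara, der_ihara, der_ihara]
  simp only [ihara_apply, map_add, map_sub, der_leibniz]
  noncomm_ring

/-! ### The Ihara cobracket is a Lie cobracket -/

lemma pairing₂_apply (X : Kxz K ⊗[K] Kxz K) (b c : Kxz K) :
    pairing₂ K X (b ⊗ₜ[K] c)
      = TensorProduct.dualDistrib K _ _ (pairing K XZ b ⊗ₜ[K] pairing K XZ c) X := by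
  induction X using TensorProduct.induction_on with
  | zero => simp
  | tmul x y =>
    simp only [pairing₂, LinearMap.comp_apply, TensorProduct.map_tmul,
      TensorProduct.dualDistrib_apply, pairing_symm K b, pairing_symm K c]
  | add x y hx hy => rw [map_add, LinearMap.add_apply, hx, hy, map_add]

lemma dualDistrib_iharaCobracket (a b c : Kxz K) :
    TensorProduct.dualDistrib K _ _ (pairing K XZ b ⊗ₜ[K] pairing K XZ c) (iharaCobracket K a)
      = pairing K XZ (ihara K b c) a := by
  rw [← pairing₂_apply, iharaCobracket_adjoint, pairing_symm]

lemma eq_zero_of_pairing (a : Kxz K) (h : ∀ w : List XZ, pairing K XZ (word K w) a = 0) : a = 0 := by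
  apply (wordBasis K XZ).repr.injective
  ext w
  rw [map_zero, Finsupp.zero_apply, ← pairing_word_left]
  exact h w

lemma dualDistrib_comm {A : Type*} [AddCommGroup A] [Module K A] (f g : Module.Dual K A)
    (x : A ⊗[K] A) :
    TensorProduct.dualDistrib K _ _ (f ⊗ₜ[K] g) (TensorProduct.comm K A A x)
      = TensorProduct.dualDistrib K _ _ (g ⊗ₜ[K] f) x := by
  induction x using TensorProduct.induction_on with
  | zero => simp
  | tmul a b => simp [mul_comm]
  | add a b ha hb => simp only [map_add, ha, hb]

lemma dualDistrib_rot {A : Type*} [AddCommGroup A] [Module K A] (f g h : Module.Dual K A)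
    (x : A ⊗[K] (A ⊗[K] A)) :
    TensorProduct.dualDistrib K _ _ (f ⊗ₜ[K] TensorProduct.dualDistrib K _ _ (g ⊗ₜ[K] h))
        (rot K A x)
      = TensorProduct.dualDistrib K _ _ (h ⊗ₜ[K] TensorProduct.dualDistrib K _ _ (f ⊗ₜ[K] g)) x := by
  have : TensorProduct.dualDistrib K _ _ (f ⊗ₜ[K] TensorProduct.dualDistrib K _ _ (g ⊗ₜ[K] h))
        ∘ₗ (rot K A)
      = TensorProduct.dualDistrib K _ _ (h ⊗ₜ[K] TensorProduct.dualDistrib K _ _ (f ⊗ₜ[K] g)) := by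
    refine TensorProduct.ext (LinearMap.ext fun a => TensorProduct.ext (LinearMap.ext fun b =>
      LinearMap.ext fun c => ?_))
    simp [rot]
    ring
  exact LinearMap.congr_fun this x

lemma dualDistrib_map {A B C D : Type*} [AddCommGroup A] [Module K A] [AddCommGroup B] [Module K B]
    [AddCommGroup C] [Module K C] [AddCommGroup D] [Module K D] (f : Module.Dual K C)
    (g : Module.Dual K D) (u : A →ₗ[K] C) (v : B →ₗ[K] D) (x : A ⊗[K] B) :
    TensorProduct.dualDistrib K _ _ (f ⊗ₜ[K] g) (TensorProduct.map u v x)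
      = TensorProduct.dualDistrib K _ _ ((f ∘ₗ u) ⊗ₜ[K] (g ∘ₗ v)) x := by
  induction x using TensorProduct.induction_on with
  | zero => simp
  | tmul a b => simp
  | add a b ha hb => simp only [map_add, ha, hb]

lemma dualDistrib_iharaCobracket₂ (a b c d : Kxz K) :
    TensorProduct.dualDistrib K _ _ (pairing K XZ b ⊗ₜ[K]
        TensorProduct.dualDistrib K _ _ (pairing K XZ c ⊗ₜ[K] pairing K XZ d))
        (TensorProduct.map LinearMap.id (iharaCobracket K) (iharaCobracket K a))
      = pairing K XZ (ihara K b (ihara K c d)) a := by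
  rw [dualDistrib_map, ← dualDistrib_iharaCobracket]
  congr 3
  exact LinearMap.ext fun x => dualDistrib_iharaCobracket K x c d

/-- By adjunction, the two axioms tested on words are the antisymmetry and the Jacobi identity of
the Ihara bracket. -/
theorem isLieCobracket_iharaCobracket : IsLieCobracket (iharaCobracket K) where
  antisymm a := by
    rw [← sub_eq_zero]
    refine tensor_eq_zero_of_separating (fun w => pairing K XZ (word K w))
      (fun w => pairing K XZ (word K w)) (eq_zero_of_pairing K) (eq_zero_of_pairing K) _
      fun u v => ?_
    rw [map_sub, map_neg, dualDistrib_comm, dualDistrib_iharaCobracket, dualDistrib_iharaCobracket,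
      ihara_antisymm K (word K u), map_neg, LinearMap.neg_apply, sub_self]
  coJacobi a := by
    intro t
    -- Separation is used twice: pairs of words separate the tensor square, and with a third word
    -- they separate the tensor cube.
    refine tensor_eq_zero_of_separating (fun w => pairing K XZ (word K w))
      (fun w : List XZ × List XZ => TensorProduct.dualDistrib K _ _
        (pairing K XZ (word K w.1) ⊗ₜ[K] pairing K XZ (word K w.2))) (eq_zero_of_pairing K)
      (fun x hx => tensor_eq_zero_of_separating (fun w => pairing K XZ (word K w))
      (fun w => pairing K XZ (word K w)) (eq_zero_of_pairing K) (eq_zero_of_pairing K) x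
      fun u v => hx (u, v)) _ fun u v => ?_
    rw [map_add, map_add, dualDistrib_rot, dualDistrib_rot, dualDistrib_rot,
      dualDistrib_iharaCobracket₂, dualDistrib_iharaCobracket₂, dualDistrib_iharaCobracket₂]
    have := ihara_jacobi K (word K u) (word K v.1) (word K v.2)
    rw [← LinearMap.add_apply, ← LinearMap.add_apply, ← map_add, ← map_add]
    have e : ∀ A B C : Kxz K, A + B + C = 0 → A + C + B = 0 := fun A B C h => by
      rw [← h]; abel
    rw [e _ _ _ this, map_zero, LinearMap.zero_apply]

/-- The bidegree of a word. -/
def wordDegree (w : List XZ) : ℕ × ℕ := (w.count XZ.z, w.length)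

/-- The projections onto the bigraded components of `K⟨x,z⟩`. -/
def xzProj : ℕ × ℕ → Kxz K →ₗ[K] Kxz K := basisProj (wordBasis K XZ) wordDegree

lemma isProjections_xzProj : IsProjections (xzGrading K) (xzProj K) := by
  have e : xzGrading K = fun p => Submodule.span K (wordBasis K XZ '' {i | wordDegree i = p}) := by
    funext p
    have : (word K : List XZ → Kxz K) = wordBasis K XZ := funext fun w => (wordBasis_apply K w).symm
    rw [xzGrading, this]
    congr 2
    ext w
    simp [wordDegree, Prod.ext_iff]
  rw [e]
  exact isProjections_basisProj _ _

lemma iharaCobracket_mem (p : ℕ × ℕ) (a : Kxz K) (ha : a ∈ xzGrading K p) :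
    iharaCobracket K a ∈ tensorGrading (xzGrading K) p := by
  have : xzGrading K p ≤ (tensorGrading (xzGrading K) p).comap (iharaCobracket K) := by
    rw [xzGrading, Submodule.span_le]
    rintro _ ⟨w, hw, rfl⟩
    rw [SetLike.mem_coe, Submodule.mem_comap, ← wordBasis_apply, iharaCobracket,
      Module.Basis.constr_basis]
    refine Submodule.sum_mem _ fun n _ => Submodule.sum_mem _ fun u _ => Submodule.sum_mem _
      fun v _ => ?_
    have hu := word_mem_xzGrading K (List.ofFn u)
    have hv := word_mem_xzGrading K (List.ofFn v)
    by_cases h0 : pairing K XZ (ihara K (word K (List.ofFn u)) (word K (List.ofFn v))) (word K w) = 0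
    · rw [h0, zero_smul]
      exact Submodule.zero_mem _
    refine Submodule.smul_mem _ _ (Submodule.mem_iSup_of_mem _ (Submodule.mem_iSup_of_mem _
      (Submodule.mem_iSup_of_mem ?_ ⟨(⟨_, hu⟩ : xzGrading K _) ⊗ₜ[K] (⟨_, hv⟩ : xzGrading K _), rfl⟩)))
    rw [pairing_symm, pairing_word_left] at h0
    obtain ⟨h1, h2⟩ := (mem_xzGrading_iff K).1 (ihara_mem_xzGrading K hu hv) w h0
    obtain ⟨h3, h4⟩ := hw
    exact Prod.ext (h1.symm.trans h3) (h2.symm.trans h4)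
  exact this ha

theorem isBigradedLieCoalgebra_iharaCobracket :
    IsBigradedLieCoalgebra (xzGrading K) (iharaCobracket K) where
  isInternal := (isProjections_xzProj K).isInternal
  isLieCobracket := isLieCobracket_iharaCobracket K
  map_grading := iharaCobracket_mem K

end Jacobi

/-! ### Homogeneous maps commute with the projections -/

section

variable {K M N : Type*} [Field K] [AddCommGroup M] [Module K M] [AddCommGroup N] [Module K N]

lemma IsProjections.map_apply {gr : ℕ × ℕ → Submodule K M} {P : ℕ × ℕ → M →ₗ[K] M}
    (h : IsProjections gr P) {gr' : ℕ × ℕ → Submodule K N} {P' : ℕ × ℕ → N →ₗ[K] N}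
    (h' : IsProjections gr' P') (f : M →ₗ[K] N) (hf : ∀ p, ∀ x ∈ gr p, f x ∈ gr' p) (p : ℕ × ℕ)
    (x : M) : f (P p x) = P' p (f x) := by
  classical
  obtain ⟨s, hs⟩ := h.sum_of_subset x
  have e := hs (insert p s) (Finset.subset_insert p s)
  conv_rhs => rw [e, map_sum, map_sum]
  rw [Finset.sum_eq_single p]
  · exact (h'.self p _ (hf p _ (h.mem p x))).symm
  · intro q _ hq
    exact h'.other p q hq _ (hf q _ (h.mem q x))
  · intro hp
    exact absurd (Finset.mem_insert_self p s) hp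

end

/-! ### The bigradings of `W`, `U`, `V`, and of `W_R` and `F` -/

section VGrading

variable (K : Type*) [Field K]

/-- The projections onto the bigraded components of `W`. -/
def wProj : ℕ × ℕ → W K →ₗ[K] W K :=
  basisProj Finsupp.basisSingleOne fun l : WIndex => (l.1.length, listWeight l.1)

/-- The projections onto the bigraded components of `U`. -/
def uProj : ℕ × ℕ → U K →ₗ[K] U K := basisProj Finsupp.basisSingleOne uDegree

/-- The projections onto the bigraded components of `V`. -/
def vProj (p : ℕ × ℕ) : V K →ₗ[K] V K := (wProj K p).prodMap (uProj K p)

lemma isProjections_wProj : IsProjections (wGrading K) (wProj K) := by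
  have e : wGrading K = fun p => Submodule.span K
      ((Finsupp.basisSingleOne : Module.Basis WIndex K (W K)) ''
        {l | ((l.1.length, listWeight l.1) : ℕ × ℕ) = p}) := by
    funext p
    rw [wGrading, Finsupp.supported_eq_span_single, Finsupp.coe_basisSingleOne]
    congr 2
    ext w
    simp [Prod.ext_iff]
  rw [e]
  exact isProjections_basisProj _ _

lemma isProjections_uProj : IsProjections (uGrading K) (uProj K) := by
  have e : uGrading K = fun p => Submodule.span K
      ((Finsupp.basisSingleOne : Module.Basis UIndex K (U K)) '' {i | uDegree i = p}) := by
    funext p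
    rw [uGrading, Finsupp.supported_eq_span_single, Finsupp.coe_basisSingleOne]
  rw [e]
  exact isProjections_basisProj _ _

lemma isProjections_vProj : IsProjections (vGrading K) (vProj K) :=
  (isProjections_wProj K).prod (isProjections_uProj K)

lemma gen_mem_wGrading (l : List ℕ+) : gen K l ∈ wGrading K (l.length, listWeight l) := by
  rw [gen]
  split_ifs with h
  · exact Finsupp.single_mem_supported K 1 ⟨rfl, rfl⟩
  · exact Submodule.zero_mem _

lemma listWeight_ofFn {m : ℕ} (n : Fin m → ℕ) :
    listWeight (List.ofFn fun i => (n i).succPNat) = ∑ i, n i + m := by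
  rw [← idxDegree_add_length, idxDegree, List.map_ofFn, List.sum_ofFn, List.length_ofFn]
  simp

lemma colonSeries_mem_wGrading {τ : Type*} {m : ℕ} (s : Fin m → MvPolynomial τ K)
    (s₀ : MvPolynomial τ K) (a : τ →₀ ℕ) :
    colonSeries (gen K) s s₀ a ∈ wGrading K (m, a.degree + m) := by
  refine Submodule.sum_mem _ fun n hn => Submodule.smul_mem _ _ ?_
  rw [Finset.Nat.mem_antidiagonalTuple] at hn
  have := gen_mem_wGrading K (List.ofFn fun i => (n i).succPNat)
  rwa [listWeight_ofFn, hn, List.length_ofFn] at this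

/-- A projection either fixes or kills a homogeneous element, so it preserves any span of
homogeneous elements. -/
lemma span_le_comap_wProj (S : Set (W K)) (hS : ∀ x ∈ S, ∃ q, x ∈ wGrading K q) (p : ℕ × ℕ) :
    Submodule.span K S ≤ (Submodule.span K S).comap (wProj K p) := by
  rw [Submodule.span_le]
  intro x hx
  obtain ⟨q, hq⟩ := hS x hx
  rw [SetLike.mem_coe, Submodule.mem_comap]
  by_cases h : q = p
  · subst h
    rw [(isProjections_wProj K).self _ x hq]
    exact Submodule.subset_span hx
  · rw [(isProjections_wProj K).other p q h x hq]
    exact Submodule.zero_mem _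

lemma WR_le_comap_wProj (p : ℕ × ℕ) : WR K ≤ (WR K).comap (wProj K p) := by
  have hst : Wst K ≤ (Wst K).comap (wProj K p) := by
    refine span_le_comap_wProj K _ ?_ p
    rintro _ ⟨p, q, -, -, a, rfl⟩
    refine ⟨(p + q, a.degree + (p + q)), ?_⟩
    rw [Finset.sum_apply]
    exact Submodule.sum_mem _ fun σ _ => colonSeries_mem_wGrading K _ _ _
  have hsh : Wsh K ≤ (Wsh K).comap (wProj K p) := by
    refine span_le_comap_wProj K _ ?_ p
    rintro _ ⟨p, q, -, -, a, rfl⟩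
    refine ⟨(p + q, a.degree + (p + q)), ?_⟩
    rw [Finset.sum_apply]
    exact Submodule.sum_mem _ fun σ _ => colonSeries_mem_wGrading K _ _ _
  have hev : WoneEven K ≤ (WoneEven K).comap (wProj K p) := by
    refine span_le_comap_wProj K _ ?_ p
    rintro _ ⟨n, -, rfl⟩
    exact ⟨_, gen_mem_wGrading K [n]⟩
  refine sup_le (sup_le ?_ ?_) ?_
  · exact hst.trans (Submodule.comap_mono (le_sup_left.trans le_sup_left))
  · exact hsh.trans (Submodule.comap_mono (le_sup_right.trans le_sup_left))
  · exact hev.trans (Submodule.comap_mono le_sup_right)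

lemma F_le_comap_vProj (p : ℕ × ℕ) : F K ≤ (F K).comap (vProj K p) :=
  fun _ hv => ⟨WR_le_comap_wProj K p hv.1, trivial⟩

/-! ### `φ` is homogeneous -/

lemma shuffleWord_x_mem (u : List XZ) :
    shuffleWord K u [XZ.x] ∈ xzGrading K (u.count XZ.z, u.length + 1) := by
  induction u with
  | nil =>
    have := word_mem_xzGrading K [XZ.x]
    simpa [shuffleWord] using this
  | cons c u ih =>
    rw [shuffleWord, shuffleWord_nil_right, ← word_cons]
    refine Submodule.add_mem _ ?_ ?_
    · have h1 := word_mem_xzGrading K [c]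
      have h2 := mul_mem_xzGrading K h1 ih
      rw [word_cons, word_nil, mul_one] at h2
      have e : (c :: u).count XZ.z = [c].count XZ.z + u.count XZ.z := by
        rw [← List.count_append]; rfl
      rw [e]
      convert h2 using 2
      simp
      ring
    · have := word_mem_xzGrading K (XZ.x :: c :: u)
      rwa [List.count_cons_of_ne (by simp)] at this

lemma phi_mem_xzGrading (p : ℕ × ℕ) (v : V K) (hv : v ∈ vGrading K p) :
    phi K v ∈ xzGrading K p := by
  have hW : wGrading K p ≤ (xzGrading K p).comap (phi K ∘ₗ LinearMap.inl K (W K) (U K)) := by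
    rw [wGrading, Finsupp.supported_eq_span_single, Submodule.span_le]
    rintro _ ⟨l, ⟨h1, h2⟩, rfl⟩
    have := word_mem_xzGrading K (blockWord l.1.reverse ++ List.replicate 0 XZ.x)
    rw [count_blockWord, length_blockWord, List.length_reverse, listWeight_reverse, h1, h2,
      List.replicate_zero, List.append_nil] at this
    simpa [phi] using this
  have hU : uGrading K p ≤ (xzGrading K p).comap (phi K ∘ₗ LinearMap.inr K (W K) (U K)) := by
    rw [uGrading, Finsupp.supported_eq_span_single, Submodule.span_le]
    rintro _ ⟨i, hi, rfl⟩
    have hi : uDegree i = p := hi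
    have e : phi K (0, Finsupp.single i 1) = phiU K i := by simp [phi]
    change phi K (0, Finsupp.single i 1) ∈ xzGrading K p
    rw [e, ← hi]
    rcases i with _ | ⟨n, l⟩
    · exact word_mem_xzGrading K []
    · rw [phiU, shuffle_word]
      have := shuffleWord_x_mem K (blockWord l.reverse ++ List.replicate n.natPred XZ.x)
      rw [count_blockWord, length_blockWord, List.length_reverse, listWeight_reverse] at this
      convert this using 2
      have := PNat.natPred_add_one n
      simp only [uDegree, Prod.mk.injEq, true_and]
      omega
  have e : phi K v = phi K (v.1, 0) + phi K (0, v.2) := by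
    rw [← map_add]
    simp
  rw [e]
  exact Submodule.add_mem _ (hW hv.1) (hU hv.2)

lemma phi_vProj (p : ℕ × ℕ) (v : V K) : phi K (vProj K p v) = xzProj K p (phi K v) :=
  (isProjections_vProj K).map_apply (isProjections_xzProj K) (phi K) (phi_mem_xzGrading K) p v

lemma pairing_eq_zero_of_mem {p q : ℕ × ℕ} (hpq : p ≠ q) {a b : Kxz K} (ha : a ∈ xzGrading K p)
    (hb : b ∈ xzGrading K q) : pairing K XZ a b = 0 := by
  have : xzGrading K p ≤ LinearMap.ker ((pairing K XZ).flip b) := by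
    rw [xzGrading, Submodule.span_le]
    rintro _ ⟨w, ⟨h1, h2⟩, rfl⟩
    rw [SetLike.mem_coe, LinearMap.mem_ker, LinearMap.flip_apply, pairing_word_left]
    by_contra h
    obtain ⟨h3, h4⟩ := (mem_xzGrading_iff K).1 hb w h
    exact hpq (Prod.ext (h1.symm.trans h3) (h2.symm.trans h4))
  exact this ha

/-- A linear form that factors through a bigraded component is represented by an element. -/
lemma exists_pairing_eq (p : ℕ × ℕ) (g : Module.Dual K (Kxz K)) :
    ∃ ψ ∈ xzGrading K p, ∀ a, pairing K XZ a ψ = g (xzProj K p a) := by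
  -- The weight bounds the sum to finitely many words; the projection inside `g` selects the depth.
  set ψ : Kxz K := ∑ u : Fin p.2 → XZ, g (xzProj K p (word K (List.ofFn u))) • word K (List.ofFn u)
    with hψ
  have hproj : ∀ w : List XZ, wordDegree w ≠ p → xzProj K p (word K w) = 0 := fun w hw =>
    (isProjections_xzProj K).other p _ hw _ (word_mem_xzGrading K w)
  have hw : ∀ w, pairing K XZ (word K w) ψ = g (xzProj K p (word K w)) := by
    intro w
    rw [hψ, map_sum]
    simp only [map_smul, pairing_word, smul_eq_mul, mul_ite, mul_one, mul_zero]
    by_cases h : w.length = p.2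
    · obtain ⟨m, u, rfl⟩ : ∃ (m : ℕ) (u : Fin m → XZ), w = List.ofFn u := ⟨w.length, w.get, by simp⟩
      rw [List.length_ofFn] at h
      subst h
      rw [Finset.sum_eq_single u]
      · simp
      · intro v _ hv
        rw [if_neg]
        intro h
        exact hv (List.ofFn_injective h).symm
      · simp
    · rw [hproj w fun h' => h (congrArg Prod.snd h'), map_zero]
      refine Finset.sum_eq_zero fun u _ => if_neg ?_
      rintro rfl
      simp at h
  refine ⟨ψ, (mem_xzGrading_iff K).2 fun w h => ?_, fun a => ?_⟩
  · rw [← pairing_word_left, hw] at h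
    by_contra h'
    apply h
    rw [hproj w, map_zero]
    intro h''
    exact h' (Prod.ext_iff.1 h'')
  · have : (pairing K XZ).flip ψ = g ∘ₗ xzProj K p := linearMap_ext_word K hw
    exact LinearMap.congr_fun this a

variable [CharZero K]

lemma phiEquiv_symm_mem (p : ℕ × ℕ) (a : Kxz K) (ha : a ∈ xzGrading K p) :
    (phiEquiv K).symm a ∈ vGrading K p := by
  have e : vProj K p ((phiEquiv K).symm a) = (phiEquiv K).symm a := by
    apply (phiEquiv K).injective
    rw [phiEquiv_apply, phi_vProj, ← phiEquiv_apply, LinearEquiv.apply_symm_apply,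
      (isProjections_xzProj K).self p a ha]
  rw [← e]
  exact (isProjections_vProj K).mem p _

lemma map_xzGrading : (fun p => (xzGrading K p).map (phiEquiv K).symm.toLinearMap) = vGrading K := by
  funext p
  apply le_antisymm
  · rintro _ ⟨a, ha, rfl⟩
    exact phiEquiv_symm_mem K p a ha
  · intro v hv
    exact ⟨phi K v, phi_mem_xzGrading K p v hv, (phiEquiv K).symm_apply_apply v⟩

theorem isBigradedLieCoalgebra_pullbackCobracket :
    IsBigradedLieCoalgebra (vGrading K) (pullbackCobracket K) := by
  have := (isBigradedLieCoalgebra_iharaCobracket K).of_surjective (phiEquiv K).symm.toLinearMap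
    (phiEquiv K).symm.surjective (pullbackCobracket K) (fun v => by
      simp [pullbackCobracket]) (by
      rw [map_xzGrading]
      exact (isProjections_vProj K).isInternal)
  rwa [map_xzGrading] at this

/-! ### Bigraded duality between `V / F` and `ls` -/

/-- `F` is the orthogonal of `ls`. -/
theorem mem_F_of_orth (v : V K) (h : ∀ ψ ∈ ls K, pairing K XZ (phi K v) ψ = 0) : v ∈ F K := by
  have key : ∀ p, vProj K p v ∈ F K := by
    intro p
    by_contra hp
    -- A form that kills F but not this component is cut down to bidegree `p`. It is then
    -- represented by an element of K⟨x,z⟩, which lies in `ls` because F is bigraded.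
    obtain ⟨f, hf, hfF⟩ := Submodule.exists_le_ker_of_notMem hp
    obtain ⟨ψ, -, hψ⟩ := exists_pairing_eq K p (f ∘ₗ (phiEquiv K).symm.toLinearMap)
    have hψ' : ∀ v, pairing K XZ (phi K v) ψ = f (vProj K p v) := by
      intro v
      rw [hψ, ← phi_vProj, ← phiEquiv_apply]
      simp
    apply hf
    rw [← hψ']
    refine h ψ ((mem_ls_iff K ψ).2 fun v hv => ?_)
    rw [hψ']
    exact hfF (F_le_comap_vProj K p hv)
  obtain ⟨s, -, hs⟩ := (isProjections_vProj K).exists_sum v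
  rw [hs]
  exact Submodule.sum_mem _ fun p _ => key p

/-- The projections are self-adjoint for the pairing and preserve F, hence they preserve its
orthogonal. -/
lemma xzProj_mem_ls {ψ : Kxz K} (h : ψ ∈ ls K) (p : ℕ × ℕ) : xzProj K p ψ ∈ ls K := by
  rw [mem_ls_iff] at h ⊢
  intro v hv
  have hP := isProjections_xzProj K
  have adj : pairing K XZ (phi K v) (xzProj K p ψ) = pairing K XZ (xzProj K p (phi K v)) ψ := by
    have : ((pairing K XZ).compl₂ (xzProj K p)) = (pairing K XZ) ∘ₗ xzProj K p := by
      refine linearMap_ext_word K fun u => linearMap_ext_word K fun w => ?_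
      rw [LinearMap.compl₂_apply, LinearMap.comp_apply]
      have hu := word_mem_xzGrading K u
      have hw := word_mem_xzGrading K w
      by_cases h1 : wordDegree u = p
      · rw [hP.self p (word K u) (h1 ▸ hu)]
        by_cases h2 : wordDegree w = p
        · rw [hP.self p (word K w) (h2 ▸ hw)]
        · rw [hP.other p _ h2 _ hw, map_zero]
          exact (pairing_eq_zero_of_mem K (h1.trans_ne (Ne.symm h2)) hu hw).symm
      · rw [hP.other p _ h1 (word K u) hu, map_zero, LinearMap.zero_apply]
        exact pairing_eq_zero_of_mem K h1 hu (hP.mem p _)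
    exact LinearMap.congr_fun (LinearMap.congr_fun this _) _
  rw [adj, ← phi_vProj]
  exact h _ (F_le_comap_vProj K p hv)

/-- Reduces additive statements about `ls` to bihomogeneous elements of positive depth, since
components of depth 0 vanish. -/
lemma ls_induction {C : Kxz K → Prop} (hom : ∀ p a, a ∈ ls K → a ∈ xzGrading K p → 1 ≤ p.1 → C a)
    (h0 : C 0) (hadd : ∀ a b, C a → C b → C (a + b)) {a : Kxz K} (ha : a ∈ ls K) : C a := by
  obtain ⟨s, -, hs⟩ := (isProjections_xzProj K).exists_sum a
  rw [hs]
  refine Finset.sum_induction _ C hadd h0 fun p _ => ?_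
  have hl := xzProj_mem_ls K ha p
  have hm := (isProjections_xzProj K).mem p a
  rcases Nat.eq_zero_or_pos p.1 with hp | hp
  · have : xzProj K p a = 0 := by
      apply (wordBasis K XZ).repr.injective
      ext w
      rw [map_zero, Finsupp.zero_apply]
      by_contra hw
      exact hw (hl.2.2.1 w (((mem_xzGrading_iff K).1 hm w hw).1.trans hp))
    rw [this]
    exact h0
  · exact hom p _ hl hm hp

end VGrading

/-! ### The Ihara bracket of elements killed by the derivation `x ↦ 1`, `z ↦ 0` -/

section Dx

variable (K : Type*) [Field K]

lemma dx_leibniz (a b : Kxz K) : dx K (a * b) = dx K a * b + a * dx K b := by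
  have key : ∀ u v : List XZ, dx K (word K u * word K v)
      = dx K (word K u) * word K v + word K u * dx K (word K v) := by
    intro u v
    rw [← word_append, dx_word, dx_word, dx_word]
    induction u with
    | nil => simp [dxWord, word]
    | cons c u ih =>
      cases c <;>
      · simp only [List.cons_append, dxWord, ih, word_append, word_cons]
        noncomm_ring
  have h : (LinearMap.mul K (Kxz K)).compr₂ (dx K)
      = (LinearMap.mul K (Kxz K)) ∘ₗ (dx K) + ((LinearMap.mul K (Kxz K)).compl₂ (dx K)) := by
    refine linearMap_ext_word K fun u => linearMap_ext_word K fun v => ?_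
    simpa using key u v
  simpa using LinearMap.congr_fun (LinearMap.congr_fun h a) b

/-- The commutator of the two derivations is a derivation. It kills `x`, since d_a kills x and 1,
and it kills `z` because `dx` kills both z and a. -/
lemma dx_der (a b : Kxz K) (ha : dx K a = 0) : dx K (der K a b) = der K a (dx K b) := by
  have hx : dx K (FreeAlgebra.ι K XZ.x) = 1 := by
    have := dx_word K [XZ.x]
    simpa [dxWord, word] using this
  have hz : dx K (FreeAlgebra.ι K XZ.z) = 0 := by
    have := dx_word K [XZ.z]
    simpa [dxWord, word] using this
  have := derivation_ext K (dx K ∘ₗ der K a - der K a ∘ₗ dx K) 0 (fun c d => by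
      simp only [LinearMap.sub_apply, LinearMap.comp_apply, der_leibniz, dx_leibniz, map_add]
      noncomm_ring) (fun c d => by simp) (fun c => by
      cases c with
      | x => simp [der_x, hx, der_one]
      | z => simp [der_z, dx_leibniz, hz, ha])
  exact sub_eq_zero.1 (LinearMap.congr_fun this b)

lemma dx_ihara (a b : Kxz K) (ha : dx K a = 0) (hb : dx K b = 0) : dx K (ihara K a b) = 0 := by
  rw [ihara_apply, map_add, map_sub, map_sub, dx_der K a b ha, dx_der K b a hb, dx_leibniz,
    dx_leibniz, ha, hb]
  simp

end Dx

/-! ### Comparison of the cobrackets on `V / F` -/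

section Compare

variable (K : Type*) [Field K]

/-- The projection `V → W / W_R`, with kernel `F`. -/
def redW : V K →ₗ[K] W K ⧸ WR K := (WR K).mkQ ∘ₗ LinearMap.fst K (W K) (U K)

lemma redW_surjective : Function.Surjective (redW K) :=
  (WR K).mkQ_surjective.comp LinearMap.fst_surjective

lemma ker_redW : LinearMap.ker (redW K) = F K := by
  ext v
  simp [redW, F, Submodule.mem_prod]

lemma isCoideal_WR_iff : IsCoideal (WR K) (deltaTilde K) ↔
    ∀ w ∈ WR K, TensorProduct.map (WR K).mkQ (WR K).mkQ (deltaTilde K w) = 0 := by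
  have := fun x => mem_coidealTarget_iff (WR K).mkQ (WR K).mkQ_surjective x
  rw [Submodule.ker_mkQ] at this
  unfold IsCoideal
  simp only [this]

variable [CharZero K]

lemma dx_eq_zero_of_mem_ls {a : Kxz K} (ha : a ∈ ls K) : dx K a = 0 := by
  rw [dx_eq_zero_iff_orth]
  intro i
  have := (mem_ls_iff K a).1 ha (0, Finsupp.single (some i) 1) ⟨(WR K).zero_mem, trivial⟩
  simpa [phi] using this

/-- The part of the stability of `ls` that always holds: {a,b} stays translation invariant, and its
depth is at least 2, so it has no constant term. This is why U plays no role in the coideal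
condition. -/
lemma pairing_phi_ihara_U {a b : Kxz K} (ha : a ∈ ls K) (hb : b ∈ ls K) (u : U K) :
    pairing K XZ (phi K (0, u)) (ihara K a b) = 0 := by
  have hdx := dx_ihara K a b (dx_eq_zero_of_mem_ls K ha) (dx_eq_zero_of_mem_ls K hb)
  rw [dx_eq_zero_iff_orth] at hdx
  have h1 : pairing K XZ 1 (ihara K a b) = 0 := by
    refine ls_induction K (C := fun a => pairing K XZ 1 (ihara K a b) = 0) (fun p a _ ha' hp => ?_)
      (by simp) (fun a a' h h' => by simp [h, h']) ha
    refine ls_induction K (C := fun b => pairing K XZ 1 (ihara K a b) = 0) (fun q b _ hb' hq => ?_)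
      (by simp) (fun b b' h h' => by simp [h, h']) hb
    refine pairing_eq_zero_of_mem K ?_ (word_mem_xzGrading K []) (ihara_mem_xzGrading K ha' hb')
    intro h
    have := congrArg Prod.fst h
    simp at this
    omega
  have : (pairing K XZ).flip (ihara K a b) ∘ₗ phi K ∘ₗ LinearMap.inr K (W K) (U K) = 0 := by
    refine Finsupp.lhom_ext' fun i => LinearMap.ext_ring ?_
    change pairing K XZ (phi K (0, Finsupp.single i 1)) (ihara K a b) = 0
    have e : phi K (0, Finsupp.single i 1) = phiU K i := by simp [phi]
    rw [e]
    rcases i with _ | i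
    · exact h1
    · exact hdx i
  exact LinearMap.congr_fun this u

/-- On `ls`, the map `δ̃` is dual to the Ihara bracket. -/
theorem dualDistrib_deltaTilde {a b : Kxz K} (ha : a ∈ ls K) (hb : b ∈ ls K) (w : W K) :
    TensorProduct.dualDistrib K _ _ (pairW K a ⊗ₜ[K] pairW K b) (deltaTilde K w)
      = pairW K (ihara K a b) w := by
  have p0 : pairW K (0 : Kxz K) = 0 := by ext; simp [pairW_apply]
  have padd : ∀ c d : Kxz K, pairW K (c + d) = pairW K c + pairW K d := fun c d => by
    ext; simp [pairW_apply]
  refine ls_induction K (C := fun a => TensorProduct.dualDistrib K _ _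
    (pairW K a ⊗ₜ[K] pairW K b) (deltaTilde K w) = pairW K (ihara K a b) w)
    (fun p a hla ha hp => ?_) (by simp [p0])
    (fun a a' h h' => by
      rw [padd, TensorProduct.add_tmul, map_add, LinearMap.add_apply, h, h', map_add,
        LinearMap.add_apply, padd, LinearMap.add_apply]) ha
  refine ls_induction K (C := fun b => TensorProduct.dualDistrib K _ _
    (pairW K a ⊗ₜ[K] pairW K b) (deltaTilde K w) = pairW K (ihara K a b) w)
    (fun q b hlb hb hq => ?_) (by simp [p0])
    (fun b b' h h' => by
      rw [padd, TensorProduct.tmul_add, map_add, LinearMap.add_apply, h, h', map_add,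
        padd, LinearMap.add_apply]) hb
  exact dualDistrib_deltaTilde_of_mem K hla hlb ha hb hp hq w

lemma WR_le_ker_pairW (ψ : ls K) : WR K ≤ LinearMap.ker (pairW K ψ.1) := fun w hw =>
  (mem_ls_iff K ψ.1).1 ψ.2 (w, 0) ⟨hw, trivial⟩

/-- The linear form on `W / W_R` defined by an element of `ls`. -/
def lsForm (ψ : ls K) : Module.Dual K (W K ⧸ WR K) := (WR K).liftQ (pairW K ψ.1) (WR_le_ker_pairW K ψ)

lemma lsForm_mkQ (ψ : ls K) : lsForm K ψ ∘ₗ (WR K).mkQ = pairW K ψ.1 := (WR K).liftQ_mkQ _ _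

lemma lsForm_redW (ψ : ls K) : lsForm K ψ ∘ₗ redW K = (pairing K XZ).flip ψ.1 ∘ₗ phi K := by
  ext1
  · exact lsForm_mkQ K ψ
  · refine LinearMap.ext fun u => ?_
    have := (mem_ls_iff K ψ.1).1 ψ.2 (0, u) ⟨(WR K).zero_mem, trivial⟩
    simpa [redW] using this.symm

/-- A restatement of the fact that F is the orthogonal of `ls`. -/
lemma lsForm_separating (x : W K ⧸ WR K) (h : ∀ ψ, lsForm K ψ x = 0) : x = 0 := by
  obtain ⟨v, rfl⟩ := redW_surjective K x
  rw [← LinearMap.mem_ker, ker_redW]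
  exact mem_F_of_orth K v fun ψ hψ =>
    (LinearMap.congr_fun (lsForm_redW K ⟨ψ, hψ⟩) v).symm.trans (h ⟨ψ, hψ⟩)

lemma dualDistrib_pullbackCobracket (a b : Kxz K) (v : V K) :
    TensorProduct.dualDistrib K _ _ (((pairing K XZ).flip a ∘ₗ phi K) ⊗ₜ[K]
        ((pairing K XZ).flip b ∘ₗ phi K)) (pullbackCobracket K v)
      = pairing K XZ (phi K v) (ihara K a b) := by
  have hflip : ∀ a, (pairing K XZ).flip a = pairing K XZ a := fun a =>
    LinearMap.ext fun b => pairing_symm K b a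
  have hphi : phi K ∘ₗ (phiEquiv K).symm.toLinearMap = LinearMap.id :=
    LinearMap.ext fun x => (phiEquiv K).apply_symm_apply x
  rw [pullbackCobracket, LinearMap.comp_apply, dualDistrib_map, LinearMap.comp_assoc,
    LinearMap.comp_assoc, hphi, LinearMap.comp_id, LinearMap.comp_id, hflip, hflip,
    LinearMap.comp_apply, dualDistrib_iharaCobracket, pairing_symm]
  rfl

lemma dualDistrib_redW (a b : ls K) (v : V K) :
    TensorProduct.dualDistrib K _ _ (lsForm K a ⊗ₜ[K] lsForm K b)
      (TensorProduct.map (redW K) (redW K) (pullbackCobracket K v))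
      = pairing K XZ (phi K v) (ihara K a b) := by
  rw [dualDistrib_map, lsForm_redW, lsForm_redW, dualDistrib_pullbackCobracket]

lemma tensor_eq_zero_of_lsForm (x : (W K ⧸ WR K) ⊗[K] (W K ⧸ WR K))
    (h : ∀ a b, TensorProduct.dualDistrib K _ _ (lsForm K a ⊗ₜ[K] lsForm K b) x = 0) : x = 0 :=
  tensor_eq_zero_of_separating (lsForm K) (lsForm K) (lsForm_separating K) (lsForm_separating K) x h

/-- Modulo `F`, the pullback of the Ihara cobracket is `δ̃`. -/
theorem map_redW_pullbackCobracket (v : V K) :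
    TensorProduct.map (redW K) (redW K) (pullbackCobracket K v)
      = TensorProduct.map (WR K).mkQ (WR K).mkQ (deltaTilde K v.1) := by
  rw [← sub_eq_zero]
  refine tensor_eq_zero_of_lsForm K _ fun a b => ?_
  -- Against two elements of `ls` both sides give the pairing with their Ihara bracket, since the
  -- component of `v` in U contributes 0.
  have e : phi K v = phi K (v.1, 0) + phi K (0, v.2) := by
    rw [← map_add]
    simp
  rw [map_sub, dualDistrib_redW, dualDistrib_map, lsForm_mkQ, lsForm_mkQ,
    dualDistrib_deltaTilde K a.2 b.2, pairW_apply, e, map_add, LinearMap.add_apply,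
    pairing_phi_ihara_U K a.2 b.2, add_zero, sub_self]

lemma isCoideal_F_iff : IsCoideal (F K) (pullbackCobracket K) ↔
    ∀ v ∈ F K, TensorProduct.map (redW K) (redW K) (pullbackCobracket K v) = 0 := by
  unfold IsCoideal
  rw [← ker_redW]
  simp only [mem_coidealTarget_iff _ (redW_surjective K)]

/-- Since `ls` separates V/F, the image of δ(v) in V/F ⊗ V/F vanishes if and only if ⟨φ(v), {a,b}⟩ =
0 for all a, b in `ls`. For all v in F this says that {a,b} is orthogonal to φ(F), that is, lies in
`ls`. -/
theorem lsStable_iff_isCoideal_F : LsStable K ↔ IsCoideal (F K) (pullbackCobracket K) := by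
  rw [isCoideal_F_iff]
  constructor
  · intro h v hv
    refine tensor_eq_zero_of_lsForm K _ fun a b => ?_
    rw [dualDistrib_redW]
    exact (mem_ls_iff K _).1 (h a a.2 b b.2) v hv
  · intro h a ha b hb
    rw [mem_ls_iff]
    intro v hv
    rw [← dualDistrib_redW K ⟨a, ha⟩ ⟨b, hb⟩, h v hv, map_zero]

/-- After reduction modulo F, the cobracket of (w, u) depends only on w and is that of δ̃. -/
theorem isCoideal_F_iff_isCoideal_WR :
    IsCoideal (F K) (pullbackCobracket K) ↔ IsCoideal (WR K) (deltaTilde K) := by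
  rw [isCoideal_F_iff, isCoideal_WR_iff]
  simp only [map_redW_pullbackCobracket]
  exact ⟨fun h w hw => h (w, 0) ⟨hw, trivial⟩, fun h v hv => h v.1 hv.1⟩

end Compare

/-! ### The dihedral Lie coalgebra -/

section Dihedral

lemma map_cycleSeries {K M N : Type*} [Field K] [AddCommGroup M] [Module K M] [AddCommGroup N]
    [Module K N] (f : M →ₗ[K] N) (I : List ℕ+ → M) (m : ℕ) (a : Fin (m + 1) →₀ ℕ) :
    TensorProduct.map f f (cycleSeries K I m a) = cycleSeries K (fun l => f (I l)) m a := by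
  simp only [cycleSeries, Finset.sum_apply, map_sum, wedgeSeries, Pi.sub_apply, map_sub,
    map_tmulSeries, map_colonSeries]

variable (K : Type*) [Field K] [CharZero K]

/-- Goncharov's formula on a quotient of `W` determines the cobracket. -/
lemma cobracket_mkQ_of_formula (R : Submodule K (W K)) (δ : (W K ⧸ R) →ₗ[K] (W K ⧸ R) ⊗[K] (W K ⧸ R))
    (h : ∀ m : ℕ, 1 ≤ m → ∀ a : Fin (m + 1) →₀ ℕ,
      δ (colonSeries (fun l => R.mkQ (gen K l)) (fun i : Fin m => (MvPolynomial.X i.castSucc :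
        MvPolynomial (Fin (m + 1)) K)) (MvPolynomial.X (Fin.last m)) a)
      = -cycleSeries K (fun l => R.mkQ (gen K l)) m a) (w : W K) :
    δ (R.mkQ w) = -TensorProduct.map R.mkQ R.mkQ (deltaTilde K w) := by
  set T : W K →ₗ[K] (W K ⧸ R) ⊗[K] (W K ⧸ R) :=
    δ ∘ₗ R.mkQ + TensorProduct.map R.mkQ R.mkQ ∘ₗ deltaTilde K with hT
  have hT0 : ∀ (m : ℕ), 1 ≤ m → ∀ a : Fin (m + 1) →₀ ℕ, colonSeries (fun l => T (gen K l))
      (fun i : Fin m => (MvPolynomial.X i.castSucc : MvPolynomial (Fin (m + 1)) K))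
      (MvPolynomial.X (Fin.last m)) a = 0 := by
    intro m hm a
    rw [← map_colonSeries, hT, LinearMap.add_apply, LinearMap.comp_apply, LinearMap.comp_apply,
      deltaTilde_colonSeries K hm, map_cycleSeries, map_colonSeries, h m hm, neg_add_cancel]
  have hg : ∀ l, T (gen K l) = 0 := by
    refine eq_zero_of_pv (K := K) (fun l => T (gen K l)) fun d ts => ?_
    rcases Nat.eq_zero_or_pos ts.length with h0 | hm
    · rw [List.length_eq_zero_iff] at h0
      subst h0
      simp [pv, gen]
    obtain ⟨m, c, hmc, rfl⟩ : ∃ (m : ℕ) (c : Fin m → K), 1 ≤ m ∧ ts = List.ofFn c :=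
      ⟨ts.length, ts.get, hm, by simp⟩
    -- At last variable 0 the values of the series are those of `pv`, so the vanishing of all
    -- coefficients of the series forces `T` to vanish on the generators.
    have e := evalSeries_colonSeries (fun l => T (gen K l)) d (Fin.snoc (α := fun _ => K) c 0)
      (fun i : Fin m => (MvPolynomial.X i.castSucc : MvPolynomial (Fin (m + 1)) K))
      (MvPolynomial.X (Fin.last m)) (fun i => isHomogeneous_X K _) (isHomogeneous_X K _)
    simp only [MvPolynomial.eval_X, Fin.snoc_castSucc, Fin.snoc_last, sub_zero] at e
    rw [← e, evalSeries_apply]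
    exact Finset.sum_eq_zero fun a _ => by rw [hT0 m hmc a, smul_zero]
  have : T = 0 := by
    refine Finsupp.lhom_ext' fun l => LinearMap.ext_ring ?_
    have := hg l.1
    rw [gen, dif_pos l.2] at this
    exact this
  exact eq_neg_of_add_eq_zero_left (LinearMap.congr_fun this w)

/-- The relations of D are W_R, so Goncharov's formula forces δ to be minus the map induced by δ̃,
and such a δ exists exactly when W_R is a coideal. The Lie axioms then hold automatically. -/
theorem isCoideal_WR_iff_dihedral :
    IsCoideal (WR K) (deltaTilde K) ↔ DihedralIsLieCoalgebra K := by
  unfold DihedralIsLieCoalgebra GoncharovFormula dihedralGen Dihedral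
  rw [dihedralRel_eq]
  constructor
  · intro h
    rw [isCoideal_WR_iff] at h
    obtain ⟨δ, hδ⟩ : ∃ δ : (W K ⧸ WR K) →ₗ[K] (W K ⧸ WR K) ⊗[K] (W K ⧸ WR K),
        ∀ w, δ ((WR K).mkQ w) = TensorProduct.map (WR K).mkQ (WR K).mkQ (deltaTilde K w) :=
      ⟨(WR K).liftQ (TensorProduct.map (WR K).mkQ (WR K).mkQ ∘ₗ deltaTilde K) h, fun w => rfl⟩
    refine ⟨-δ, fun m hm a => ?_, ?_⟩
    · rw [← map_colonSeries, LinearMap.neg_apply, hδ, deltaTilde_colonSeries K hm, map_cycleSeries]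
    -- The axioms are inherited from V, whose cobracket comes from a genuine Lie bracket, along the
    -- surjection onto W/W_R. They are not checked for δ̃ on W.
    · have hgr : (fun p => (vGrading K p).map (redW K)) = quotGrading (wGrading K) (WR K) := by
        funext p
        apply le_antisymm
        · rintro _ ⟨v, hv, rfl⟩
          exact ⟨v.1, hv.1, rfl⟩
        · rintro _ ⟨w, hw, rfl⟩
          exact ⟨(w, 0), ⟨hw, Submodule.zero_mem _⟩, rfl⟩
      rw [← hgr]
      refine ((isBigradedLieCoalgebra_pullbackCobracket K).of_surjective (redW K)
        (redW_surjective K) δ (fun v => ?_) ?_).neg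
      · rw [map_redW_pullbackCobracket, ← hδ]
        rfl
      · rw [hgr]
        exact ((isProjections_wProj K).quot (WR K) (WR_le_comap_wProj K)).isInternal
  · rintro ⟨δ, hδ, -⟩
    rw [isCoideal_WR_iff]
    intro w hw
    have := cobracket_mkQ_of_formula K (WR K) δ hδ w
    rw [(Submodule.Quotient.mk_eq_zero (WR K)).2 hw |> fun h => (show (WR K).mkQ w = 0 from h),
      map_zero] at this
    exact neg_eq_zero.1 this.symm

end Dihedral

/-! ### The isomorphism `ε` -/

section Epsilon

variable (K : Type*) [Field K]

/-- The restriction of `⟨a, -⟩` to `ls`. -/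
def resPairing : Kxz K →ₗ[K] Module.Dual K (ls K) := (pairing K XZ).compl₂ (ls K).subtype

/-- The map `v ↦ ⟨φ(v), -⟩`. -/
def epsilonV : V K →ₗ[K] Module.Dual K (ls K) := resPairing K ∘ₗ phi K

lemma epsilonV_apply (v : V K) (ψ : ls K) : epsilonV K v ψ = pairing K XZ (phi K v) ψ := rfl

lemma mem_dualPiece_iff {p : ℕ × ℕ} {f : Module.Dual K (ls K)} :
    f ∈ dualPiece (lsGrading K) p ↔ ∀ q, q ≠ p → ∀ ψ ∈ lsGrading K q, f ψ = 0 := by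
  simp [dualPiece, Submodule.mem_iInf, Submodule.mem_dualAnnihilator]

lemma dualDistrib_map_resPairing (X : Kxz K ⊗[K] Kxz K) (a b : ls K) :
    TensorProduct.dualDistrib K (ls K) (ls K)
      (TensorProduct.map (resPairing K) (resPairing K) X) (a ⊗ₜ[K] b)
      = pairing₂ K X (a.1 ⊗ₜ[K] b.1) := by
  induction X using TensorProduct.induction_on with
  | zero => simp
  | tmul x y => rfl
  | add x y hx hy => simp only [map_add, LinearMap.add_apply, hx, hy]

variable [CharZero K]

lemma ker_epsilonV : LinearMap.ker (epsilonV K) = F K := by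
  ext v
  constructor
  · intro h
    exact mem_F_of_orth K v fun ψ hψ => LinearMap.congr_fun h ⟨ψ, hψ⟩
  · intro hv
    exact LinearMap.ext fun ψ => (mem_ls_iff K ψ.1).1 ψ.2 v hv

/-- A form of bidegree `p` on `ls` extends to K⟨x,z⟩; the extension cut down to bidegree `p` is
given by pairing with an element of that bidegree, and φ is onto. -/
lemma map_epsilonV (p : ℕ × ℕ) :
    (vGrading K p).map (epsilonV K) = dualPiece (lsGrading K) p := by
  have hP := isProjections_xzProj K
  apply le_antisymm
  · rintro _ ⟨v, hv, rfl⟩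
    rw [mem_dualPiece_iff]
    intro q hq ψ hψ
    exact pairing_eq_zero_of_mem K hq.symm (phi_mem_xzGrading K p v hv) hψ
  · intro g hg
    rw [mem_dualPiece_iff] at hg
    obtain ⟨G, hG⟩ := LinearMap.exists_extend g
    obtain ⟨ψ, hψ, h⟩ := exists_pairing_eq K p G
    refine ⟨(phiEquiv K).symm ψ, phiEquiv_symm_mem K p ψ hψ, LinearMap.ext fun χ => ?_⟩
    rw [epsilonV_apply, ← phiEquiv_apply, LinearEquiv.apply_symm_apply, pairing_symm, h]
    -- Cutting down does not change the restriction to `ls`: the components of an element of `ls`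
    -- lie in `ls`, and `g` kills those of bidegree other than `p`.
    have hGg : ∀ q, G (xzProj K q χ.1) = g ⟨xzProj K q χ.1, xzProj_mem_ls K χ.2 q⟩ := fun q =>
      LinearMap.congr_fun hG ⟨xzProj K q χ.1, xzProj_mem_ls K χ.2 q⟩
    have hχ : g χ = G χ.1 := (LinearMap.congr_fun hG χ).symm
    classical
    obtain ⟨s, hs⟩ := hP.sum_of_subset χ.1
    rw [hχ]
    conv_rhs => rw [hs (insert p s) (Finset.subset_insert p s), map_sum]
    rw [Finset.sum_eq_single p]
    · intro q _ hq
      rw [hGg]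
      exact hg q hq _ (hP.mem q χ.1)
    · intro hp
      exact absurd (Finset.mem_insert_self p s) hp

lemma range_epsilonV : LinearMap.range (epsilonV K) = bigradedDual (lsGrading K) := by
  have htop : (⨆ p, vGrading K p) = ⊤ :=
    (isProjections_vProj K).isInternal.submodule_iSup_eq_top
  rw [LinearMap.range_eq_map, ← htop, Submodule.map_iSup, bigradedDual]
  simp only [map_epsilonV]

/-- The isomorphism `ε : V / F → ls^∨`. -/
def epsilon : (V K ⧸ F K) ≃ₗ[K] bigradedDual (lsGrading K) :=
  (Submodule.quotEquivOfEq _ _ (ker_epsilonV K).symm).trans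
    ((epsilonV K).quotKerEquivRange.trans (LinearEquiv.ofEq _ _ (range_epsilonV K)))

lemma epsilon_mkQ (v : V K) : (epsilon K ((F K).mkQ v)).1 = epsilonV K v := rfl

lemma map_epsilon (p : ℕ × ℕ) :
    (quotGrading (vGrading K) (F K) p).map (epsilon K).toLinearMap = dualGrading (lsGrading K) p := by
  ext f
  rw [dualGrading, Submodule.mem_comap, ← map_epsilonV]
  constructor
  · rintro ⟨_, ⟨v, hv, rfl⟩, rfl⟩
    exact ⟨v, hv, rfl⟩
  · rintro ⟨v, hv, hvf⟩
    exact ⟨_, ⟨v, hv, rfl⟩, Subtype.ext hvf⟩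

lemma map_epsilonV_pullbackCobracket (v : V K) :
    TensorProduct.map (epsilonV K) (epsilonV K) (pullbackCobracket K v)
      = TensorProduct.map (resPairing K) (resPairing K) (iharaCobracket K (phi K v)) := by
  have e : epsilonV K ∘ₗ (phiEquiv K).symm.toLinearMap = resPairing K :=
    LinearMap.ext fun x => congrArg (resPairing K) ((phiEquiv K).apply_symm_apply x)
  rw [pullbackCobracket, LinearMap.comp_apply, TensorProduct.map_map, e]
  rfl

end Epsilon

end DihedralLS

end

/-! ### The equivalences and the isomorphism ε -/

theorem mainTheorem2 (K : Type*) [Field K] [CharZero K] :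
    List.TFAE [
      LsStable K,
      IsCoideal (F K) (pullbackCobracket K),
      IsCoideal (WR K) (deltaTilde K),
      DihedralIsLieCoalgebra K] ∧
    (LsStable K ∨ IsCoideal (F K) (pullbackCobracket K) ∨ IsCoideal (WR K) (deltaTilde K) ∨
        DihedralIsLieCoalgebra K →
      ∃ (h : LsStable K)
        (δ : (V K ⧸ F K) →ₗ[K] (V K ⧸ F K) ⊗[K] (V K ⧸ F K))
        (δls : bigradedDual (lsGrading K) →ₗ[K]
          bigradedDual (lsGrading K) ⊗[K] bigradedDual (lsGrading K))
        (ε : (V K ⧸ F K) ≃ₗ[K] bigradedDual (lsGrading K)),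
        (∀ v : V K, δ ((F K).mkQ v) =
          TensorProduct.map (F K).mkQ (F K).mkQ (pullbackCobracket K v)) ∧
        IsBigradedLieCoalgebra (quotGrading (vGrading K) (F K)) δ ∧
        IsDualCobracket (lsGrading K) (iharaLs K h) δls ∧
        IsBigradedLieCoalgebra (M := bigradedDual (lsGrading K)) (dualGrading (lsGrading K)) δls ∧
        (∀ (v : V K) (ψ : ls K), (ε ((F K).mkQ v)).1 ψ = pairing K XZ (phi K v) ψ) ∧
        (∀ p : ℕ × ℕ, (quotGrading (vGrading K) (F K) p).map ε.toLinearMap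
          = dualGrading (lsGrading K) p) ∧
        (∀ a : V K ⧸ F K,
          TensorProduct.map ε.toLinearMap ε.toLinearMap (δ a) = δls (ε a))) := by
  have h12 := lsStable_iff_isCoideal_F K
  have h23 := isCoideal_F_iff_isCoideal_WR K
  have h34 := isCoideal_WR_iff_dihedral K
  refine ⟨?_, fun h => ?_⟩
  · tfae_have 1 ↔ 2 := h12
    tfae_have 2 ↔ 3 := h23
    tfae_have 3 ↔ 4 := h34
    tfae_finish
  have hs : LsStable K := by
    rcases h with h | h | h | h
    · exact h
    · exact h12.2 h
    · exact h12.2 (h23.2 h)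
    · exact h12.2 (h23.2 (h34.2 h))
  have hF := h12.1 hs
  have hker : F K ≤ LinearMap.ker
      (TensorProduct.map (F K).mkQ (F K).mkQ ∘ₗ pullbackCobracket K) := by
    intro v hv
    have := mem_coidealTarget_iff (F K).mkQ (F K).mkQ_surjective (pullbackCobracket K v)
    rw [Submodule.ker_mkQ] at this
    exact this.1 (hF v hv)
  obtain ⟨δ, hδ⟩ : ∃ δ : (V K ⧸ F K) →ₗ[K] (V K ⧸ F K) ⊗[K] (V K ⧸ F K), ∀ v : V K,
      δ ((F K).mkQ v) = TensorProduct.map (F K).mkQ (F K).mkQ (pullbackCobracket K v) :=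
    ⟨(F K).liftQ _ hker, fun v => rfl⟩
  have hq := (isProjections_vProj K).quot (F K) (F_le_comap_vProj K)
  have hgr : IsBigradedLieCoalgebra (quotGrading (vGrading K) (F K)) δ :=
    (isBigradedLieCoalgebra_pullbackCobracket K).of_surjective (F K).mkQ (F K).mkQ_surjective δ hδ
      hq.isInternal
  obtain ⟨e, he, hegr⟩ : ∃ e : (V K ⧸ F K) ≃ₗ[K] bigradedDual (lsGrading K),
      (∀ v, (e ((F K).mkQ v)).1 = epsilonV K v) ∧
      ∀ p, (quotGrading (vGrading K) (F K) p).map e.toLinearMap = dualGrading (lsGrading K) p :=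
    ⟨epsilon K, epsilon_mkQ K, map_epsilon K⟩
  -- The cobracket on the dual is defined by transport along ε. Compatibility with ε and the Lie
  -- axioms are then automatic, and what remains is that it is dual to the Ihara bracket.
  obtain ⟨δls, hδls⟩ : ∃ δls : bigradedDual (lsGrading K) →ₗ[K]
      bigradedDual (lsGrading K) ⊗[K] bigradedDual (lsGrading K), ∀ a : V K ⧸ F K,
      δls (e a) = TensorProduct.map e.toLinearMap e.toLinearMap (δ a) :=
    ⟨TensorProduct.map e.toLinearMap e.toLinearMap ∘ₗ δ ∘ₗ e.symm.toLinearMap, fun a => by simp⟩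
  refine ⟨hs, δ, δls, e, hδ, hgr, ?_, ?_, fun v ψ => by rw [he, epsilonV_apply], hegr,
    fun a => (hδls a).symm⟩
  · intro f a b
    obtain ⟨x, rfl⟩ := e.surjective f
    obtain ⟨v, rfl⟩ := (F K).mkQ_surjective x
    -- Duality comes down to the adjunction between the Ihara bracket and cobracket: followed by the
    -- inclusion into the full dual, ε is restriction to `ls` of the pairing with φ(v).
    have h1 : ((bigradedDual (lsGrading K)).subtype ∘ₗ e.toLinearMap) ∘ₗ (F K).mkQ
        = epsilonV K := LinearMap.ext he
    rw [hδls, hδ, TensorProduct.map_map, TensorProduct.map_map, h1, map_epsilonV_pullbackCobracket,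
      dualDistrib_map_resPairing, iharaCobracket_adjoint, he]
    rfl
  · exact hgr.of_equiv (N := bigradedDual (lsGrading K)) hq e δls hδls hegr
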